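/- **Conventions.** All algebras are unital associative algebras over $\mathbb C$; homomorphisms preserve units. A *quasi-Hopf algebra* $(\mathcal G,\Delta,\epsilon,\phi,S,\alpha,\beta)$ is a finite-dimensional algebra $\mathcal G$ with algebra homomorphisms $\Delta:\mathcal G\to\mathcal G\otimes\mathcal G$, $\epsilon:\mathcal G\to\mathbb C$, an invertible $\phi\in\mathcal G^{\otimes 3}$, a bijective linear anti-homomorphism $S:\mathcal G\to\mathcal G$ with $S(1)=1$, and $\alpha,\beta\in\mathcal G$ such that $(\mathrm{id}\otimes\Delta)(\Delta(x))\,\phi=\phi\,(\Delta\otimes\mathrm{id})(\Delta(x))$, $(\mathrm{id}\otimes\mathrm{id}\otimes\Delta)(\phi)\,(\Delta\otimes\mathrm{id}\otimes\mathrm{id})(\phi)=(1\otimes\phi)\,(\mathrm{id}\otimes\Delta\otimes\mathrm{id})(\phi)\,(\phi\otimes1)$, $(\epsilon\otimes\mathrm{id})\Delta=\mathrm{id}=(\mathrm{id}\otimes\epsilon)\Delta$, $(\mathrm{id}\otimes\epsilon\otimes\mathrm{id})(\phi)=1\otimes1$, $\ S(x_1)\alpha x_2=\epsilon(x)\alpha$,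 $\ x_1\beta S(x_2)=\epsilon(x)\beta$, and $\phi^1\beta S(\phi^2)\alpha\phi^3=1=S(\bar\phi^1)\alpha\bar\phi^2\beta S(\bar\phi^3)$, where $\Delta(x)=x_1\otimes x_2$, $\phi=\phi^1\otimes\phi^2\otimes\phi^3$ and $\phi^{-1}=\bar\phi^1\otimes\bar\phi^2\otimes\bar\phi^3$ (sums suppressed). A *left coaction* of $\mathcal G$ on an algebra $M$ is a pair $(\lambda,\phi_\lambda)$ of an algebra homomorphism $\lambda:M\to\mathcal G\otimes M$ and an invertible $\phi_\lambda\in\mathcal G\otimes\mathcal G\otimes M$ with $(\mathrm{id}\otimes\lambda)(\lambda(m))\,\phi_\lambda=\phi_\lambda\,(\Delta\otimes\mathrm{id})(\lambda(m))$, $(1\otimes\phi_\lambda)(\mathrm{id}\otimes\Delta\otimes\mathrm{id})(\phi_\lambda)(\phi\otimes1)=(\mathrm{id}\otimes\mathrm{id}\otimes\lambda)(\phi_\lambda)(\Delta\otimes\mathrm{id}\otimes\mathrm{id})(\phi_\lambda)$, $(\epsilon\otimes\mathrm{id})\lambda=\mathrm{id}$ and $(\mathrm{id}\otimes\epsilon\otimes\mathrm{id})(\phi_\lambda)=(\epsilon\otimes\mathrm{id}\otimes\mathrm{id})(\phi_\lambda)=1\otimes1$;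 then $M$ is a *left comodule algebra*. A *right coaction* is a pair $(\rho,\phi_\rho)$ of an algebra homomorphism $\rho:M\to M\otimes\mathcal G$ and an invertible $\phi_\rho\in M\otimes\mathcal G\otimes\mathcal G$ with $\phi_\rho\,(\rho\otimes\mathrm{id})(\rho(m))=(\mathrm{id}\otimes\Delta)(\rho(m))\,\phi_\rho$, $(1\otimes\phi)(\mathrm{id}\otimes\Delta\otimes\mathrm{id})(\phi_\rho)(\phi_\rho\otimes1)=(\mathrm{id}\otimes\mathrm{id}\otimes\Delta)(\phi_\rho)(\rho\otimes\mathrm{id}\otimes\mathrm{id})(\phi_\rho)$, $(\mathrm{id}\otimes\epsilon)\rho=\mathrm{id}$ and $(\mathrm{id}\otimes\epsilon\otimes\mathrm{id})(\phi_\rho)=(\mathrm{id}\otimes\mathrm{id}\otimes\epsilon)(\phi_\rho)=1\otimes1$; then $M$ is a *right comodule algebra*. A *two-sided comodule algebra* is an algebra $M$ with a left coaction $(\lambda,\phi_\lambda)$, a right coaction $(\rho,\phi_\rho)$ and an invertible $\phi_{\lambda\rho}\in\mathcal G\otimes M\otimes\mathcal G$ such that $\phi_{\lambda\rho}(\lambda\otimes\mathrm{id})(\rho(m))=(\mathrm{id}\otimes\rho)(\lambda(m))\phi_{\lambda\rho}$,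 $(1\otimes\phi_{\lambda\rho})(\mathrm{id}\otimes\lambda\otimes\mathrm{id})(\phi_{\lambda\rho})(\phi_\lambda\otimes1)=(\mathrm{id}\otimes\mathrm{id}\otimes\rho)(\phi_\lambda)(\Delta\otimes\mathrm{id}\otimes\mathrm{id})(\phi_{\lambda\rho})$ and $(1\otimes\phi_\rho)(\mathrm{id}\otimes\rho\otimes\mathrm{id})(\phi_{\lambda\rho})(\phi_{\lambda\rho}\otimes1)=(\mathrm{id}\otimes\mathrm{id}\otimes\Delta)(\phi_{\lambda\rho})(\lambda\otimes\mathrm{id}\otimes\mathrm{id})(\phi_\rho)$. Let $\hat{\mathcal G}$ be the linear dual of $\mathcal G$. For a right comodule algebra $(\mathcal A,\rho,\phi_\rho)$ and a left comodule algebra $(\mathcal B,\lambda,\phi_\lambda)$ the *two-sided crossed product* $\mathcal A{}_\rho{\rtimes}\,\hat{\mathcal G}\,{\ltimes}_\lambda\mathcal B$ is the vector space $\mathcal A\otimes\hat{\mathcal G}\otimes\mathcal B$ (elements $a\rtimes f\ltimes b$) with unit $1\rtimes\epsilon\ltimes1$ and the associative multiplication $$(a\rtimes f\ltimes b)(a'\rtimes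 g\ltimes b')=a\,a'_{0}\,\bar\rho^1\rtimes\Big[x\mapsto f\big(a'_{1}\bar\rho^2x_1\bar\lambda^1\big)\,g\big(\bar\rho^3x_2\bar\lambda^2b_{-1}\big)\Big]\ltimes\bar\lambda^3\,b_{0}\,b',$$ where $\rho(a')=a'_0\otimes a'_1$, $\lambda(b)=b_{-1}\otimes b_0$, $\phi_\rho^{-1}=\bar\rho^1\otimes\bar\rho^2\otimes\bar\rho^3$, $\phi_\lambda^{-1}=\bar\lambda^1\otimes\bar\lambda^2\otimes\bar\lambda^3$. The algebra $\mathcal A\otimes\mathcal B$ is embedded in it by $a\otimes b\mapsto a\rtimes\epsilon\ltimes b$. Put $\Gamma_{\mathcal A\mathcal B}=\sum_\mu e_\mu\otimes(1\rtimes e^\mu\ltimes1)\in\mathcal G\otimes(\mathcal A\rtimes\hat{\mathcal G}\ltimes\mathcal B)$ for dual bases $(e_\mu)$ of $\mathcal G$ and $(e^\mu)$ of $\hat{\mathcal G}$. **Proposition.** Let $\mathcal G$ be a quasi-Hopf algebra, let $(\mathcal A,\rho_{\mathcal A},\phi_{\rho_{\mathcal A}})$ be a right, $(\mathcal B,\lambda_{\mathcal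 B},\rho_{\mathcal B},\phi_{\lambda_{\mathcal B}},\phi_{\rho_{\mathcal B}},\phi_{\lambda_{\mathcal B}\rho_{\mathcal B}})$ a two-sided and $(\mathcal C,\lambda_{\mathcal C},\phi_{\lambda_{\mathcal C}})$ a left comodule algebra. (i) There is exactly one right coaction $(\tilde\rho,\phi_{\tilde\rho})$ of $\mathcal G$ on $\mathcal A{}_{\rho_{\mathcal A}}{\rtimes}\,\hat{\mathcal G}\,{\ltimes}_{\lambda_{\mathcal B}}\mathcal B$ such that $\phi_{\tilde\rho}=\phi_{\rho_{\mathcal B}}$, $\tilde\rho|_{\mathcal A\otimes\mathcal B}=\mathrm{id}_{\mathcal A}\otimes\rho_{\mathcal B}$ and $$(\mathrm{id}\otimes\tilde\rho)(\Gamma_{\mathcal A\mathcal B})=(\Gamma_{\mathcal A\mathcal B}\otimes1)\,\phi_{\lambda_{\mathcal B}\rho_{\mathcal B}}^{-1}.$$ (ii) There is exactly one left coaction $(\tilde\lambda,\phi_{\tilde\lambda})$ of $\mathcal G$ on $\mathcal B{}_{\rho_{\mathcal B}}{\rtimes}\,\hat{\mathcal G}\,{\ltimes}_{\lambda_{\mathcal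 C}}\mathcal C$ such that $\phi_{\tilde\lambda}=\phi_{\lambda_{\mathcal B}}$, $\tilde\lambda|_{\mathcal B\otimes\mathcal C}=\lambda_{\mathcal B}\otimes\mathrm{id}_{\mathcal C}$ and $$(\mathrm{id}\otimes\tilde\lambda)(\Gamma_{\mathcal B\mathcal C})=(\phi_{\lambda_{\mathcal B}\rho_{\mathcal B}}^{-1})^{231}\,\Gamma_{\mathcal B\mathcal C}^{13},$$ where $(x\otimes y\otimes z)^{231}=z\otimes x\otimes y$ and $(x\otimes m)^{13}=x\otimes1\otimes m$. (Here the elements of $\mathcal A$, $\mathcal B$, $\mathcal C$ are identified with their images in the crossed products.) (iii) With these coactions, $\ (a\rtimes f\ltimes b)\rtimes g\ltimes c\ \mapsto\ a\rtimes f\ltimes(b\rtimes g\ltimes c)\ $ defines an isomorphism of algebras $$(\mathcal A{}_{\rho_{\mathcal A}}{\rtimes}\,\hat{\mathcal G}\,{\ltimes}_{\lambda_{\mathcal B}}\mathcal B)\,{}_{\tilde\rho}{\rtimes}\,\hat{\mathcal G}\,{\ltimes}_{\lambda_{\mathcal C}}\mathcal C\ \cong\ \mathcal A\,{}_{\rho_{\mathcal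 A}}{\rtimes}\,\hat{\mathcal G}\,{\ltimes}_{\tilde\lambda}(\mathcal B{}_{\rho_{\mathcal B}}{\rtimes}\,\hat{\mathcal G}\,{\ltimes}_{\lambda_{\mathcal C}}\mathcal C).$$ -/

import Mathlib

open scoped TensorProduct

namespace QuasiHopf

/-! ## Leg bookkeeping

All iterated tensor products are bracketed to the right, e.g. `A ⊗ (B ⊗ (C ⊗ D))`. -/

section Legs

variable {k : Type*} [Field k]
variable {A B C D E : Type*} [Ring A] [Algebra k A] [Ring B] [Algebra k B]
  [Ring C] [Algebra k C] [Ring D] [Algebra k D] [Ring E] [Algebra k E]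

/-- `id ⊗ f`. -/
noncomputable abbrev onTail (f : B →ₐ[k] C) : A ⊗[k] B →ₐ[k] A ⊗[k] C :=
  Algebra.TensorProduct.map (AlgHom.id k A) f

/-- `f ⊗ id` for a homomorphism `f : A → C ⊗ D`, re-bracketed to the right. -/
noncomputable def splitHead (f : A →ₐ[k] C ⊗[k] D) : A ⊗[k] B →ₐ[k] C ⊗[k] (D ⊗[k] B) :=
  (Algebra.TensorProduct.assoc k k k C D B).toAlgHom.comp
    (Algebra.TensorProduct.map f (AlgHom.id k B))

/-- `ε ⊗ id` for a character `ε`. -/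
noncomputable def evalHead (ε : A →ₐ[k] k) : A ⊗[k] B →ₐ[k] B :=
  (Algebra.TensorProduct.lid k B).toAlgHom.comp
    (Algebra.TensorProduct.map ε (AlgHom.id k B))

/-- `id ⊗ ε` for a character `ε`. -/
noncomputable def evalTail (ε : B →ₐ[k] k) : A ⊗[k] B →ₐ[k] A :=
  (Algebra.TensorProduct.rid k k A).toAlgHom.comp
    (Algebra.TensorProduct.map (AlgHom.id k A) ε)

/-- `x ↦ x ⊗ 1`, from two to three tensor factors. -/
noncomputable def append₂ : A ⊗[k] B →ₐ[k] A ⊗[k] (B ⊗[k] C) :=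
  onTail Algebra.TensorProduct.includeLeft

/-- `x ↦ x ⊗ 1`, from three to four tensor factors. -/
noncomputable def append₃ : A ⊗[k] (B ⊗[k] C) →ₐ[k] A ⊗[k] (B ⊗[k] (C ⊗[k] D)) :=
  onTail append₂

/-- The cyclic permutation `x¹ ⊗ x² ⊗ x³ ↦ x³ ⊗ x¹ ⊗ x²`, i.e. `x ↦ x²³¹`
(the `i`-th factor of `x` is put into the position given by the `i`-th index). -/
noncomputable def cycle : A ⊗[k] (B ⊗[k] C) →ₐ[k] C ⊗[k] (A ⊗[k] B) :=
  (Algebra.TensorProduct.comm k (A ⊗[k] B) C).toAlgHom.comp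
    (Algebra.TensorProduct.assoc k k k A B C).symm.toAlgHom

@[simp] lemma splitHead_tmul (f : A →ₐ[k] C ⊗[k] D) (a : A) (b : B) :
    splitHead f (a ⊗ₜ[k] b) = Algebra.TensorProduct.assoc k k k C D B (f a ⊗ₜ b) := rfl

@[simp] lemma evalHead_tmul (ε : A →ₐ[k] k) (a : A) (b : B) :
    evalHead ε (a ⊗ₜ[k] b) = ε a • b := rfl

@[simp] lemma evalTail_tmul (ε : B →ₐ[k] k) (a : A) (b : B) :
    evalTail ε (a ⊗ₜ[k] b) = ε b • a := rfl

@[simp] lemma append₂_tmul (a : A) (b : B) :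
    (append₂ (a ⊗ₜ[k] b) : A ⊗[k] (B ⊗[k] C)) = a ⊗ₜ (b ⊗ₜ 1) := rfl

@[simp] lemma append₃_tmul (a : A) (b : B) (c : C) :
    (append₃ (a ⊗ₜ[k] (b ⊗ₜ[k] c)) : A ⊗[k] (B ⊗[k] (C ⊗[k] D))) =
      a ⊗ₜ (b ⊗ₜ (c ⊗ₜ 1)) := rfl

@[simp] lemma cycle_tmul (a : A) (b : B) (c : C) :
    cycle (a ⊗ₜ[k] (b ⊗ₜ[k] c)) = c ⊗ₜ[k] (a ⊗ₜ[k] b) := rfl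

end Legs

/-! ## Quasi-Hopf algebras and their coactions -/

/-- A quasi-bialgebra `(G, Δ, ε, φ)`. -/
class QuasiBialgebra (k : Type*) (G : Type*) [Field k] [Ring G] [Algebra k G] where
  /-- the coproduct `Δ` -/
  comul : G →ₐ[k] G ⊗[k] G
  /-- the counit `ε` -/
  counit : G →ₐ[k] k
  /-- the reassociator `φ` -/
  reassoc : (G ⊗[k] (G ⊗[k] G))ˣ
  /-- `(id ⊗ Δ)(Δ a) φ = φ (Δ ⊗ id)(Δ a)` -/
  quasi_coassoc : ∀ a : G,
    onTail comul (comul a) * (reassoc : G ⊗[k] (G ⊗[k] G)) =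
      (reassoc : G ⊗[k] (G ⊗[k] G)) * splitHead comul (comul a)
  /-- `(id ⊗ id ⊗ Δ)(φ) (Δ ⊗ id ⊗ id)(φ) = (1 ⊗ φ) (id ⊗ Δ ⊗ id)(φ) (φ ⊗ 1)` -/
  pentagon :
    onTail (onTail comul) (reassoc : G ⊗[k] (G ⊗[k] G)) *
        splitHead comul (reassoc : G ⊗[k] (G ⊗[k] G)) =
      (1 : G) ⊗ₜ[k] (reassoc : G ⊗[k] (G ⊗[k] G)) *
        onTail (splitHead comul) (reassoc : G ⊗[k] (G ⊗[k] G)) *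
        append₃ (reassoc : G ⊗[k] (G ⊗[k] G))
  /-- `(ε ⊗ id) ∘ Δ = id` -/
  counit_comul : ∀ a : G, evalHead counit (comul a) = a
  /-- `(id ⊗ ε) ∘ Δ = id` -/
  comul_counit : ∀ a : G, evalTail counit (comul a) = a
  /-- `(id ⊗ ε ⊗ id)(φ) = 1 ⊗ 1` -/
  counit_reassoc : onTail (evalHead counit) (reassoc : G ⊗[k] (G ⊗[k] G)) = 1

open QuasiBialgebra

/-- A quasi-Hopf algebra `(G, Δ, ε, φ, S, α, β)` with invertible antipode. -/
class QuasiHopfAlgebra (k : Type*) (G : Type*) [Field k] [Ring G] [Algebra k G]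
    extends QuasiBialgebra k G where
  /-- the (invertible) antipode `S` -/
  antipode : G ≃ₗ[k] G
  /-- the element `α` -/
  alpha : G
  /-- the element `β` -/
  beta : G
  antipode_one : antipode 1 = 1
  antipode_mul : ∀ a b : G, antipode (a * b) = antipode b * antipode a
  /-- `S(a₁) α a₂ = ε(a) α` -/
  antipode_alpha : ∀ a : G,
    LinearMap.mul' k G
      (TensorProduct.map antipode.toLinearMap (LinearMap.mulLeft k alpha) (comul a)) =
      counit a • alpha
  /-- `a₁ β S(a₂) = ε(a) β` -/
  beta_antipode : ∀ a : G,
    LinearMap.mul' k G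
      (TensorProduct.map (LinearMap.mulRight k beta) antipode.toLinearMap (comul a)) =
      counit a • beta
  /-- `X β S(Y) α Z = 1` for `φ = X ⊗ Y ⊗ Z` -/
  reassoc_antipode :
    LinearMap.mul' k G
      (TensorProduct.map LinearMap.id
        (LinearMap.mul' k G ∘ₗ
          TensorProduct.map (LinearMap.mulLeft k beta ∘ₗ antipode.toLinearMap)
            (LinearMap.mulLeft k alpha))
        (reassoc : G ⊗[k] (G ⊗[k] G))) = 1
  /-- `S(P) α Q β S(R) = 1` for `φ⁻¹ = P ⊗ Q ⊗ R` -/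
  reassoc_inv_antipode :
    LinearMap.mul' k G
      (TensorProduct.map antipode.toLinearMap
        (LinearMap.mul' k G ∘ₗ
          TensorProduct.map (LinearMap.mulLeft k alpha)
            (LinearMap.mulLeft k beta ∘ₗ antipode.toLinearMap))
        (↑(reassoc⁻¹) : G ⊗[k] (G ⊗[k] G))) = 1

section Coactions

variable (k : Type*) (G : Type*) [Field k] [Ring G] [Algebra k G] [QuasiBialgebra k G]
variable (M : Type*) [Ring M] [Algebra k M]

/-- A left coaction `(λ, φ_λ)` of the quasi-bialgebra `G` on the algebra `M`; together with it
`M` is a left comodule algebra. -/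
@[ext]
structure LeftCoaction where
  /-- the algebra map `λ` -/
  coact : M →ₐ[k] G ⊗[k] M
  /-- the reassociator `φ_λ` -/
  reassoc : (G ⊗[k] (G ⊗[k] M))ˣ
  /-- `(id ⊗ λ)(λ m) φ_λ = φ_λ (Δ ⊗ id)(λ m)` -/
  quasi_coassoc : ∀ m : M,
    onTail coact (coact m) * (reassoc : G ⊗[k] (G ⊗[k] M)) =
      (reassoc : G ⊗[k] (G ⊗[k] M)) * splitHead comul (coact m)
  /-- `(1 ⊗ φ_λ) (id ⊗ Δ ⊗ id)(φ_λ) (φ ⊗ 1) = (id ⊗ id ⊗ λ)(φ_λ) (Δ ⊗ id ⊗ id)(φ_λ)` -/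
  pentagon :
    (1 : G) ⊗ₜ[k] (reassoc : G ⊗[k] (G ⊗[k] M)) *
        onTail (splitHead comul) (reassoc : G ⊗[k] (G ⊗[k] M)) *
        append₃ (QuasiBialgebra.reassoc (k := k) (G := G)).val =
      onTail (onTail coact) (reassoc : G ⊗[k] (G ⊗[k] M)) *
        splitHead comul (reassoc : G ⊗[k] (G ⊗[k] M))
  /-- `(ε ⊗ id) ∘ λ = id` -/
  counit_coact : ∀ m : M, evalHead counit (coact m) = m
  /-- `(id ⊗ ε ⊗ id)(φ_λ) = 1 ⊗ 1` -/
  counit_mid : onTail (evalHead counit) (reassoc : G ⊗[k] (G ⊗[k] M)) = 1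
  /-- `(ε ⊗ id ⊗ id)(φ_λ) = 1 ⊗ 1` -/
  counit_head : evalHead counit (reassoc : G ⊗[k] (G ⊗[k] M)) = 1

/-- A right coaction `(ρ, φ_ρ)` of the quasi-bialgebra `G` on the algebra `M`; together with it
`M` is a right comodule algebra. -/
@[ext]
structure RightCoaction where
  /-- the algebra map `ρ` -/
  coact : M →ₐ[k] M ⊗[k] G
  /-- the reassociator `φ_ρ` -/
  reassoc : (M ⊗[k] (G ⊗[k] G))ˣ
  /-- `φ_ρ (ρ ⊗ id)(ρ m) = (id ⊗ Δ)(ρ m) φ_ρ` -/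
  quasi_coassoc : ∀ m : M,
    (reassoc : M ⊗[k] (G ⊗[k] G)) * splitHead coact (coact m) =
      onTail comul (coact m) * (reassoc : M ⊗[k] (G ⊗[k] G))
  /-- `(1 ⊗ φ) (id ⊗ Δ ⊗ id)(φ_ρ) (φ_ρ ⊗ 1) = (id ⊗ id ⊗ Δ)(φ_ρ) (ρ ⊗ id ⊗ id)(φ_ρ)` -/
  pentagon :
    (1 : M) ⊗ₜ[k] (QuasiBialgebra.reassoc (k := k) (G := G)).val *
        onTail (splitHead comul) (reassoc : M ⊗[k] (G ⊗[k] G)) *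
        append₃ (reassoc : M ⊗[k] (G ⊗[k] G)) =
      onTail (onTail comul) (reassoc : M ⊗[k] (G ⊗[k] G)) *
        splitHead coact (reassoc : M ⊗[k] (G ⊗[k] G))
  /-- `(id ⊗ ε) ∘ ρ = id` -/
  counit_coact : ∀ m : M, evalTail counit (coact m) = m
  /-- `(id ⊗ ε ⊗ id)(φ_ρ) = 1 ⊗ 1` -/
  counit_mid : onTail (evalHead counit) (reassoc : M ⊗[k] (G ⊗[k] G)) = 1
  /-- `(id ⊗ id ⊗ ε)(φ_ρ) = 1 ⊗ 1` -/
  counit_tail : onTail (evalTail counit) (reassoc : M ⊗[k] (G ⊗[k] G)) = 1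

/-- A quasi-commuting pair `(λ, ρ, φ_λ, φ_ρ, φ_λρ)` of coactions of `G` on `M`; together with it
`M` is a two-sided comodule algebra. -/
structure QuasiCommutingPair where
  /-- the left coaction `(λ, φ_λ)` -/
  left : LeftCoaction k G M
  /-- the right coaction `(ρ, φ_ρ)` -/
  right : RightCoaction k G M
  /-- the element `φ_λρ` -/
  mixed : (G ⊗[k] (M ⊗[k] G))ˣ
  /-- `φ_λρ (λ ⊗ id)(ρ m) = (id ⊗ ρ)(λ m) φ_λρ` -/
  quasi_comm : ∀ m : M,
    (mixed : G ⊗[k] (M ⊗[k] G)) * splitHead left.coact (right.coact m) =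
      onTail right.coact (left.coact m) * (mixed : G ⊗[k] (M ⊗[k] G))
  /-- `(1 ⊗ φ_λρ) (id ⊗ λ ⊗ id)(φ_λρ) (φ_λ ⊗ 1) = (id ⊗ id ⊗ ρ)(φ_λ) (Δ ⊗ id ⊗ id)(φ_λρ)` -/
  pentagon_left :
    (1 : G) ⊗ₜ[k] (mixed : G ⊗[k] (M ⊗[k] G)) *
        onTail (splitHead left.coact) (mixed : G ⊗[k] (M ⊗[k] G)) *
        append₃ (left.reassoc : G ⊗[k] (G ⊗[k] M)) =
      onTail (onTail right.coact) (left.reassoc : G ⊗[k] (G ⊗[k] M)) *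
        splitHead comul (mixed : G ⊗[k] (M ⊗[k] G))
  /-- `(1 ⊗ φ_ρ) (id ⊗ ρ ⊗ id)(φ_λρ) (φ_λρ ⊗ 1) = (id ⊗ id ⊗ Δ)(φ_λρ) (λ ⊗ id ⊗ id)(φ_ρ)` -/
  pentagon_right :
    (1 : G) ⊗ₜ[k] (right.reassoc : M ⊗[k] (G ⊗[k] G)) *
        onTail (splitHead right.coact) (mixed : G ⊗[k] (M ⊗[k] G)) *
        append₃ (mixed : G ⊗[k] (M ⊗[k] G)) =
      onTail (onTail comul) (mixed : G ⊗[k] (M ⊗[k] G)) *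
        splitHead left.coact (right.reassoc : M ⊗[k] (G ⊗[k] G))

end Coactions

/-! ## Two-sided crossed products -/

section Core

variable {k : Type*} [Field k]
variable {G H K A B : Type*} [Ring G] [Algebra k G] [Ring H] [Algebra k H]
  [Ring K] [Algebra k K] [Ring A] [Algebra k A] [Ring B] [Algebra k B]

/-- For an algebra map `δ : G → H`, `t, s ∈ H` and `Φ ∈ Ĥ` the functional
`x ↦ Φ (t δ(x) s)` on `G`. -/
def sandwich (δ : G →ₐ[k] H) :
    H →ₗ[k] Module.Dual k H →ₗ[k] H →ₗ[k] Module.Dual k G :=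
  LinearMap.mk₂ k
    (fun t Φ => LinearMap.mk₂ k (fun s x => Φ (t * δ x * s))
      (fun _ _ _ => by simp [mul_add]) (fun _ _ _ => by simp)
      (fun _ _ _ => by simp [mul_add, add_mul]) (fun _ _ _ => by simp))
    (fun _ _ _ => by ext; simp [add_mul]) (fun _ _ _ => by ext; simp)
    (fun _ _ _ => by ext; simp) (fun _ _ _ => by ext; simp)

@[simp] lemma sandwich_apply (δ : G →ₐ[k] H) (t s : H) (Φ : Module.Dual k H) (x : G) :
    sandwich δ t Φ s x = Φ (t * δ x * s) := rfl

/-- The linear map `(a ⊗ t) ⊗ (Φ ⊗ (s ⊗ b)) ↦ a ⊗ Φ(t δ(·) s) ⊗ b`. -/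
noncomputable def core (δ : G →ₐ[k] H) :
    (A ⊗[k] H) ⊗[k] (Module.Dual k H ⊗[k] (H ⊗[k] B)) →ₗ[k]
      A ⊗[k] (Module.Dual k G ⊗[k] B) :=
  TensorProduct.map LinearMap.id
      (TensorProduct.map (TensorProduct.lift (TensorProduct.lift (sandwich δ))) LinearMap.id ∘ₗ
        (TensorProduct.assoc k (H ⊗[k] Module.Dual k H) H B).symm.toLinearMap ∘ₗ
        (TensorProduct.assoc k H (Module.Dual k H) (H ⊗[k] B)).symm.toLinearMap) ∘ₗ
    (TensorProduct.assoc k A H (Module.Dual k H ⊗[k] (H ⊗[k] B))).toLinearMap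

@[simp] lemma core_tmul (δ : G →ₐ[k] H) (a : A) (t s : H) (Φ : Module.Dual k H) (b : B) :
    core δ ((a ⊗ₜ[k] t) ⊗ₜ[k] (Φ ⊗ₜ[k] (s ⊗ₜ[k] b))) = a ⊗ₜ (sandwich δ t Φ s ⊗ₜ b) := rfl

/-- Changing the intermediate algebra along `η : H → K`. -/
lemma core_comp (δ : G →ₐ[k] H) (η : H →ₐ[k] K) (X : A ⊗[k] H) (Φ : Module.Dual k K)
    (Y : H ⊗[k] B) :
    core δ (X ⊗ₜ[k] ((Φ ∘ₗ η.toLinearMap) ⊗ₜ[k] Y)) =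
      core (η.comp δ) (onTail η X ⊗ₜ[k] (Φ ⊗ₜ[k] Algebra.TensorProduct.map η (.id k B) Y)) := by
  induction X with
  | zero => simp
  | add X X' h h' => simp only [TensorProduct.add_tmul, map_add, h, h']
  | tmul a t =>
    induction Y with
    | zero => simp
    | add Y Y' h h' => simp only [TensorProduct.tmul_add, map_add, h, h']
    | tmul s b =>
      simp only [core_tmul, Algebra.TensorProduct.map_tmul, AlgHom.coe_id, id]
      congr 2
      ext x
      simp

/-- Moving an intertwiner `U` between `δ` and `δ'` through the middle. -/
lemma core_intertwine (δ δ' : G →ₐ[k] H) (U : H) (hU : ∀ x, U * δ x = δ' x * U)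
    (X : A ⊗[k] H) (Φ : Module.Dual k H) (Y : H ⊗[k] B) :
    core δ ((X * (1 : A) ⊗ₜ[k] U) ⊗ₜ[k] (Φ ⊗ₜ[k] Y)) =
      core δ' (X ⊗ₜ[k] (Φ ⊗ₜ[k] (U ⊗ₜ[k] (1 : B) * Y))) := by
  induction X with
  | zero => simp
  | add X X' h h' => simp only [TensorProduct.add_tmul, map_add, add_mul, h, h']
  | tmul a t =>
    induction Y with
    | zero => simp
    | add Y Y' h h' => simp only [TensorProduct.tmul_add, map_add, mul_add, h, h']
    | tmul s b =>
      simp only [core_tmul, Algebra.TensorProduct.tmul_mul_tmul, mul_one, one_mul]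
      congr 2
      ext x
      simp only [sandwich_apply, mul_assoc]
      rw [← mul_assoc U, hU, mul_assoc]

lemma dualDistrib_sandwich (δ : G →ₐ[k] H) (t s : H)
    (Φ : Module.Dual k H) (χ : Module.Dual k G) (w : G ⊗[k] G) :
    TensorProduct.dualDistrib k G G (sandwich δ t Φ s ⊗ₜ χ) w =
      TensorProduct.dualDistrib k H G (Φ ⊗ₜ χ)
        (t ⊗ₜ[k] (1 : G) * Algebra.TensorProduct.map δ (.id k G) w * s ⊗ₜ[k] (1 : G)) := by
  induction w with
  | zero => simp
  | add w w' h h' => simp only [map_add, mul_add, add_mul, h, h']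
  | tmul x y => simp

lemma dualDistrib_sandwich' (δ : G →ₐ[k] H) (t s : H)
    (Φ : Module.Dual k H) (χ : Module.Dual k G) (w : G ⊗[k] G) :
    TensorProduct.dualDistrib k G G (χ ⊗ₜ sandwich δ t Φ s) w =
      TensorProduct.dualDistrib k G H (χ ⊗ₜ Φ)
        ((1 : G) ⊗ₜ[k] t * Algebra.TensorProduct.map (.id k G) δ w * (1 : G) ⊗ₜ[k] s) := by
  induction w with
  | zero => simp
  | add w w' h h' => simp only [map_add, mul_add, add_mul, h, h']
  | tmul x y => simp

lemma append₃_append₂ (w : A ⊗[k] G) :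
    (append₃ (append₂ w : A ⊗[k] (G ⊗[k] G)) : A ⊗[k] (G ⊗[k] (G ⊗[k] G))) =
      onTail Algebra.TensorProduct.includeLeft w := by
  induction w with
  | zero => simp
  | add x y hx hy => simp only [map_add, hx, hy]
  | tmul x y => rfl

/-- Re-bracketing. -/
noncomputable abbrev unfold (k G B : Type*) [Field k] [Ring G] [Algebra k G] [Ring B]
    [Algebra k B] : (G ⊗[k] (G ⊗[k] G)) ⊗[k] B ≃ₐ[k] G ⊗[k] (G ⊗[k] (G ⊗[k] B)) :=
  (Algebra.TensorProduct.assoc k k k G (G ⊗[k] G) B).trans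
    (Algebra.TensorProduct.congr .refl (Algebra.TensorProduct.assoc k k k G G B))

lemma dualDistrib_assoc (f g χ : Module.Dual k G) :
    TensorProduct.dualDistrib k (G ⊗[k] G) G (TensorProduct.dualDistrib k G G (f ⊗ₜ g) ⊗ₜ χ) ∘ₗ
        (Algebra.TensorProduct.assoc k k k G G G).symm.toLinearMap =
      TensorProduct.dualDistrib k G (G ⊗[k] G)
        (f ⊗ₜ TensorProduct.dualDistrib k G G (g ⊗ₜ χ)) := by
  ext x y z
  simp [mul_assoc]

lemma unfold_symm_append₃ (w : G ⊗[k] (G ⊗[k] G)) :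
    w ⊗ₜ[k] (1 : B) = (unfold k G B).symm (append₃ w) := by
  rw [AlgEquiv.eq_symm_apply]
  induction w with
  | zero => simp
  | add x y hx hy => simp only [map_add, TensorProduct.add_tmul, hx, hy]
  | tmul x y =>
    induction y with
    | zero => simp
    | add y z hx hy => simp only [map_add, TensorProduct.tmul_add, TensorProduct.add_tmul, hx, hy]
    | tmul y z => rfl

lemma map_unit_mul_inv (F : G →ₐ[k] H) (u : Gˣ) : F u * F ↑(u⁻¹) = 1 := by
  rw [← map_mul, Units.mul_inv, map_one]

lemma map_unit_inv_mul (F : G →ₐ[k] H) (u : Gˣ) : F ↑(u⁻¹) * F u = 1 := by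
  rw [← map_mul, Units.inv_mul, map_one]

lemma monoid_aux₁ {R : Type*} [Monoid R] {u v w x y v' w' x' y' : R} (h : u * v * w = x * y)
    (hv : v * v' = 1) (hw : w * w' = 1) (hx : x' * x = 1) (hy : y' * y = 1) :
    w' * v' = y' * x' * u :=
  calc w' * v' = y' * (x' * x) * y * (w' * v') := by rw [hx, mul_one, hy, one_mul]
    _ = y' * x' * (x * y) * (w' * v') := by simp only [mul_assoc]
    _ = y' * x' * u * v * (w * w') * v' := by rw [← h]; simp only [mul_assoc]
    _ = y' * x' * u * (v * v') := by rw [hw, mul_one, mul_assoc]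
    _ = _ := by rw [hv, mul_one]

lemma monoid_aux₂ {R : Type*} [Monoid R] {u v w x y u' v' x' y' : R} (h : u * v * w = x * y)
    (hu : u' * u = 1) (hv : v' * v = 1) (hx : x * x' = 1) (hy : y * y' = 1) :
    w * y' * x' = v' * u' :=
  calc w * y' * x' = v' * (u' * u) * v * (w * y' * x') := by rw [hu, mul_one, hv, one_mul]
    _ = v' * u' * (u * v * w) * (y' * x') := by simp only [mul_assoc]
    _ = v' * u' * x * (y * y') * x' := by rw [h]; simp only [mul_assoc]
    _ = v' * u' * (x * x') := by rw [hy, mul_one, mul_assoc]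
    _ = _ := by rw [hx, mul_one]

lemma monoid_aux₃ {R : Type*} [Monoid R] {a p q w w' r s t u : R} (h : q * w = w' * q)
    (h' : q * r = s * t * u) :
    a * (p * q) * (w * r) = a * (p * (w' * s)) * t * u :=
  calc a * (p * q) * (w * r) = a * p * (q * w) * r := by simp only [mul_assoc]
    _ = a * p * w' * (q * r) := by rw [h]; simp only [mul_assoc]
    _ = _ := by rw [h']; simp only [mul_assoc]

lemma monoid_aux₄ {R : Type*} [Monoid R] {f s t v j m m' b c : R} (h : f * s * t = v * j)
    (h' : m' * j = j * m) :
    f * (s * (t * m * b) * c) = v * m' * (j * b * c) :=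
  calc f * (s * (t * m * b) * c) = f * s * t * m * b * c := by simp only [mul_assoc]
    _ = v * (j * m) * b * c := by rw [h]; simp only [mul_assoc]
    _ = _ := by rw [← h']; simp only [mul_assoc]

end Core

section CrossedProduct

variable {k : Type*} {G : Type*} [Field k] [Ring G] [Algebra k G] [QuasiBialgebra k G]
variable {A B : Type*} [Ring A] [Algebra k A] [Ring B] [Algebra k B]

/-- `(a, a') ↦ a a'₀ φ¹ ⊗ (a'₁ φ² ⊗ φ³)`, where `ρ(a') = a'₀ ⊗ a'₁` and
`φ_ρ⁻¹ = φ¹ ⊗ φ² ⊗ φ³`. -/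
noncomputable def RightCoaction.factor (ρ : RightCoaction k G A) :
    A →ₗ[k] A →ₗ[k] A ⊗[k] (G ⊗[k] G) :=
  (LinearMap.mul k (A ⊗[k] (G ⊗[k] G))).compl₁₂
    Algebra.TensorProduct.includeLeft.toLinearMap
    (LinearMap.mulRight k (↑(ρ.reassoc⁻¹) : A ⊗[k] (G ⊗[k] G)) ∘ₗ
      append₂.toLinearMap ∘ₗ ρ.coact.toLinearMap)

/-- `(b, b') ↦ (φ¹ ⊗ φ² b₋₁) ⊗ φ³ b₀ b'`, where `λ(b) = b₋₁ ⊗ b₀` and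
`φ_λ⁻¹ = φ¹ ⊗ φ² ⊗ φ³`. -/
noncomputable def LeftCoaction.factor (l : LeftCoaction k G B) :
    B →ₗ[k] B →ₗ[k] (G ⊗[k] G) ⊗[k] B :=
  ((LinearMap.mul k (G ⊗[k] (G ⊗[k] B))).compl₁₂
    (LinearMap.mulLeft k (↑(l.reassoc⁻¹) : G ⊗[k] (G ⊗[k] B)) ∘ₗ
      Algebra.TensorProduct.includeRight.toLinearMap ∘ₗ l.coact.toLinearMap)
    (Algebra.TensorProduct.includeRight.toLinearMap ∘ₗ
      Algebra.TensorProduct.includeRight.toLinearMap)).compr₂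
    (TensorProduct.assoc k G G B).symm.toLinearMap

variable (ρ : RightCoaction k G A) (l : LeftCoaction k G B)

/-- The multiplication of the two-sided crossed product on the vector space `A ⊗ (Ĝ ⊗ B)`:
`(a ⋊ f ⋉ b)(a' ⋊ g ⋉ b') =
  a (f₁ ▷ a') ρ¹ ⋊ [λ¹ ⇀ f₂ ↼ ρ²][λ² ⇀ g₁ ↼ ρ³] ⋉ λ³ (b ◁ g₂) b'`, where
`φ_ρ⁻¹ = ρ¹ ⊗ ρ² ⊗ ρ³` and `φ_λ⁻¹ = λ¹ ⊗ λ² ⊗ λ³`. Here `f ▷ a = a₀ f(a₁)` and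
`b ◁ f = f(b₋₁) b₀` for `ρ(a) = a₀ ⊗ a₁` and `λ(b) = b₋₁ ⊗ b₀`, and
`(x ⇀ f ↼ y)(z) = f(y z x)`. Since `(f₁ ▷ a') ⊗ f₂ = a'₀ ⊗ (f ↼ a'₁)` and
`g₁ ⊗ (b ◁ g₂) = (b₋₁ ⇀ g) ⊗ b₀`, the product is
`a a'₀ ρ¹ ⋊ (x ↦ f (a'₁ ρ² x₁ λ¹) g (ρ³ x₂ λ² b₋₁)) ⋉ λ³ b₀ b'`. -/
noncomputable def crossedMul :
    A ⊗[k] (Module.Dual k G ⊗[k] B) →ₗ[k] A ⊗[k] (Module.Dual k G ⊗[k] B) →ₗ[k]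
      A ⊗[k] (Module.Dual k G ⊗[k] B) :=
  TensorProduct.curry
    (core (comul : G →ₐ[k] G ⊗[k] G) ∘ₗ
      TensorProduct.map (TensorProduct.lift ρ.factor)
        (TensorProduct.map (TensorProduct.dualDistrib k G G) (TensorProduct.lift l.factor)) ∘ₗ
      TensorProduct.map LinearMap.id
        (TensorProduct.tensorTensorTensorComm k (Module.Dual k G) B
          (Module.Dual k G) B).toLinearMap ∘ₗ
      (TensorProduct.tensorTensorTensorComm k A (Module.Dual k G ⊗[k] B) A
        (Module.Dual k G ⊗[k] B)).toLinearMap)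

lemma crossedMul_tmul (a a' : A) (f g : Module.Dual k G) (b b' : B) :
    crossedMul ρ l (a ⊗ₜ (f ⊗ₜ b)) (a' ⊗ₜ (g ⊗ₜ b')) =
      core comul (ρ.factor a a' ⊗ₜ[k]
        (TensorProduct.dualDistrib k G G (f ⊗ₜ g) ⊗ₜ[k] l.factor b b')) := rfl

lemma core_sandwich {H : Type*} [Ring H] [Algebra k H] (δ : G →ₐ[k] H) (t s : H)
    (Φ : Module.Dual k H) (χ : Module.Dual k G) (X : A ⊗[k] (G ⊗[k] G))
    (Y : (G ⊗[k] G) ⊗[k] B) :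
    core comul (X ⊗ₜ[k] (TensorProduct.dualDistrib k G G (sandwich δ t Φ s ⊗ₜ χ) ⊗ₜ[k] Y)) =
      core ((Algebra.TensorProduct.map δ (.id k G)).comp comul)
        (((1 : A) ⊗ₜ[k] (t ⊗ₜ[k] (1 : G)) *
            onTail (Algebra.TensorProduct.map δ (.id k G)) X) ⊗ₜ[k]
          (TensorProduct.dualDistrib k H G (Φ ⊗ₜ χ) ⊗ₜ[k]
            (Algebra.TensorProduct.map (Algebra.TensorProduct.map δ (.id k G)) (.id k B) Y *
              (s ⊗ₜ[k] (1 : G)) ⊗ₜ[k] (1 : B)))) := by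
  induction X with
  | zero => simp
  | add X X' h h' => simp only [TensorProduct.add_tmul, map_add, mul_add, h, h']
  | tmul a u =>
    induction Y with
    | zero => simp
    | add Y Y' h h' => simp only [TensorProduct.tmul_add, map_add, add_mul, h, h']
    | tmul v b =>
      simp only [core_tmul, Algebra.TensorProduct.map_tmul, AlgHom.coe_id, id,
        Algebra.TensorProduct.tmul_mul_tmul, mul_one, one_mul]
      congr 2
      ext x
      simp only [sandwich_apply, dualDistrib_sandwich, map_mul, AlgHom.comp_apply, mul_assoc]

lemma core_sandwich' {H : Type*} [Ring H] [Algebra k H] (δ : G →ₐ[k] H) (t s : H)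
    (Φ : Module.Dual k H) (χ : Module.Dual k G) (X : A ⊗[k] (G ⊗[k] G))
    (Y : (G ⊗[k] G) ⊗[k] B) :
    core comul (X ⊗ₜ[k] (TensorProduct.dualDistrib k G G (χ ⊗ₜ sandwich δ t Φ s) ⊗ₜ[k] Y)) =
      core ((Algebra.TensorProduct.map (.id k G) δ).comp comul)
        (((1 : A) ⊗ₜ[k] ((1 : G) ⊗ₜ[k] t) *
            onTail (Algebra.TensorProduct.map (.id k G) δ) X) ⊗ₜ[k]
          (TensorProduct.dualDistrib k G H (χ ⊗ₜ Φ) ⊗ₜ[k]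
            (Algebra.TensorProduct.map (Algebra.TensorProduct.map (.id k G) δ) (.id k B) Y *
              ((1 : G) ⊗ₜ[k] s) ⊗ₜ[k] (1 : B)))) := by
  induction X with
  | zero => simp
  | add X X' h h' => simp only [TensorProduct.add_tmul, map_add, mul_add, h, h']
  | tmul a u =>
    induction Y with
    | zero => simp
    | add Y Y' h h' => simp only [TensorProduct.tmul_add, map_add, add_mul, h, h']
    | tmul v b =>
      simp only [core_tmul, Algebra.TensorProduct.map_tmul, AlgHom.coe_id, id,
        Algebra.TensorProduct.tmul_mul_tmul, mul_one, one_mul]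
      congr 2
      ext x
      simp only [sandwich_apply, dualDistrib_sandwich', map_mul, AlgHom.comp_apply, mul_assoc]

lemma rightFactor_apply (a a' : A) :
    ρ.factor a a' = a ⊗ₜ 1 * (append₂ (ρ.coact a') * (↑(ρ.reassoc⁻¹) : A ⊗[k] (G ⊗[k] G))) :=
  rfl

lemma leftFactor_apply (b b' : B) :
    l.factor b b' = (Algebra.TensorProduct.assoc k k k G G B).symm
      ((↑(l.reassoc⁻¹) : G ⊗[k] (G ⊗[k] B)) * (1 : G) ⊗ₜ[k] l.coact b *
        (1 : G) ⊗ₜ[k] ((1 : G) ⊗ₜ[k] b')) :=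
  rfl

lemma onTail_splitHead_eq (w : A ⊗[k] (G ⊗[k] G)) :
    onTail (Algebra.TensorProduct.assoc k k k G G G).toAlgHom
        (onTail (Algebra.TensorProduct.map (comul : G →ₐ[k] G ⊗[k] G) (.id k G)) w) =
      onTail (splitHead comul) w := by
  induction w with
  | zero => simp
  | add x y hx hy => simp only [map_add, hx, hy]
  | tmul x y => rfl

lemma unfold_map_head (w : G ⊗[k] (G ⊗[k] B)) :
    unfold k G B (Algebra.TensorProduct.map
        (Algebra.TensorProduct.assoc k k k G G G).toAlgHom (.id k B)
      (Algebra.TensorProduct.map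
        (Algebra.TensorProduct.map (comul : G →ₐ[k] G ⊗[k] G) (.id k G)) (.id k B)
          ((Algebra.TensorProduct.assoc k k k G G B).symm w))) = splitHead comul w := by
  induction w with
  | zero => simp
  | add x y hx hy => simp only [map_add, hx, hy]
  | tmul x w =>
    induction w with
    | zero => simp
    | add x y hx hy => simp only [map_add, TensorProduct.tmul_add, hx, hy]
    | tmul y b =>
      simp only [Algebra.TensorProduct.assoc_symm_tmul, Algebra.TensorProduct.map_tmul,
        AlgHom.coe_id, id, splitHead_tmul]
      induction (comul x : G ⊗[k] G) with
      | zero => simp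
      | add x y hx hy => simp only [map_add, TensorProduct.add_tmul, hx, hy]
      | tmul x y => rfl

lemma unfold_map_tail (w : G ⊗[k] (G ⊗[k] B)) :
    unfold k G B (Algebra.TensorProduct.map
        (Algebra.TensorProduct.map (.id k G) (comul : G →ₐ[k] G ⊗[k] G)) (.id k B)
          ((Algebra.TensorProduct.assoc k k k G G B).symm w)) =
      onTail (splitHead comul) w := by
  induction w with
  | zero => simp
  | add x y hx hy => simp only [map_add, hx, hy]
  | tmul x w =>
    induction w with
    | zero => simp
    | add x y hx hy => simp only [map_add, TensorProduct.tmul_add, hx, hy]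
    | tmul y b => rfl

lemma monoid_aux₆ {R : Type*} [Monoid R] {s p q r t : R} (h : p * (q * r) = t * q) :
    s * p * q * r = s * t * q := by
  rw [mul_assoc, mul_assoc, h, mul_assoc]

lemma head_factor_right (x a : A) (t : G ⊗[k] G) :
    onTail (Algebra.TensorProduct.assoc k k k G G G).toAlgHom
        ((1 : A) ⊗ₜ[k] (t ⊗ₜ[k] (1 : G)) *
          onTail (Algebra.TensorProduct.map comul (.id k G)) (ρ.factor x a)) =
      append₃ (x ⊗ₜ[k] t) * onTail (splitHead comul)
            (append₂ (ρ.coact a) * (↑(ρ.reassoc⁻¹) : A ⊗[k] (G ⊗[k] G))) := by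
  rw [map_mul, onTail_splitHead_eq, rightFactor_apply, map_mul (onTail (splitHead (B := G) (comul : G →ₐ[k] G ⊗[k] G))) (x ⊗ₜ[k] (1 : G ⊗[k] G)),
    ← mul_assoc]
  congr 1
  induction t with
  | zero => simp
  | add x y hx hy =>
    simp only [TensorProduct.tmul_add, TensorProduct.add_tmul, map_add, add_mul, hx, hy]
  | tmul t₁ t₂ =>
    have : onTail (splitHead comul) (x ⊗ₜ[k] (1 : G ⊗[k] G)) =
      x ⊗ₜ[k] (1 : G ⊗[k] (G ⊗[k] G)) := by
      simp [Algebra.TensorProduct.map_tmul]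
    rw [this]
    simp [Algebra.TensorProduct.map_tmul]

set_option maxHeartbeats 1000000 in
set_option synthInstance.maxHeartbeats 200000 in
lemma head_factor_left (s₁ s₂ : G) (y b : B) :
    Algebra.TensorProduct.map (Algebra.TensorProduct.assoc k k k G G G).toAlgHom (.id k B)
        (Algebra.TensorProduct.map (Algebra.TensorProduct.map comul (.id k G)) (.id k B)
          (l.factor y b) * ((s₁ ⊗ₜ[k] s₂) ⊗ₜ[k] (1 : G)) ⊗ₜ[k] (1 : B)) =
      (unfold k G B).symm
        (splitHead comul (↑(l.reassoc⁻¹) : G ⊗[k] (G ⊗[k] B)) *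
          onTail (onTail l.coact) (s₁ ⊗ₜ[k] (s₂ ⊗ₜ[k] y)) *
          (1 : G) ⊗ₜ[k] ((1 : G) ⊗ₜ[k] ((1 : G) ⊗ₜ[k] b))) := by
  have e1 : splitHead comul ((1 : G) ⊗ₜ[k] l.coact y) =
      (1 : G) ⊗ₜ[k] ((1 : G) ⊗ₜ[k] l.coact y) := by
    simp [Algebra.TensorProduct.one_def]
  have e2 : splitHead comul ((1 : G) ⊗ₜ[k] ((1 : G) ⊗ₜ[k] b)) =
      (1 : G) ⊗ₜ[k] ((1 : G) ⊗ₜ[k] ((1 : G) ⊗ₜ[k] b)) := by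
    simp [Algebra.TensorProduct.one_def]
  have e3 : unfold k G B (Algebra.TensorProduct.map
      (Algebra.TensorProduct.assoc k k k G G G).toAlgHom (.id k B)
        (((s₁ ⊗ₜ[k] s₂) ⊗ₜ[k] (1 : G)) ⊗ₜ[k] (1 : B))) =
      s₁ ⊗ₜ[k] (s₂ ⊗ₜ[k] ((1 : G) ⊗ₜ[k] (1 : B))) := rfl
  have e4 : onTail (onTail l.coact) (s₁ ⊗ₜ[k] (s₂ ⊗ₜ[k] y)) =
      s₁ ⊗ₜ[k] (s₂ ⊗ₜ[k] l.coact y) := rfl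
  rw [AlgEquiv.eq_symm_apply,
    map_mul (Algebra.TensorProduct.map (Algebra.TensorProduct.assoc k k k G G G).toAlgHom (.id k B)),
    map_mul (unfold k G B), leftFactor_apply, unfold_map_head,
    map_mul (splitHead comul), map_mul (splitHead comul), e1, e2, e3, e4]
  refine monoid_aux₆ (R := G ⊗[k] (G ⊗[k] (G ⊗[k] B))) ?_
  simp only [Algebra.TensorProduct.tmul_mul_tmul, one_mul, mul_one]

lemma assoc_tmul_eq {E : Type*} [Ring E] [Algebra k E] (w : A ⊗[k] G) (t : E) :
    Algebra.TensorProduct.assoc k k k A G E (w ⊗ₜ[k] t) =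
      (1 : A) ⊗ₜ[k] ((1 : G) ⊗ₜ[k] t) * append₂ w := by
  induction w with
  | zero => rw [TensorProduct.zero_tmul, map_zero, map_zero, mul_zero]
  | add x y hx hy => rw [TensorProduct.add_tmul, map_add, map_add, mul_add, hx, hy]
  | tmul x y =>
    simp only [append₂_tmul, Algebra.TensorProduct.assoc_tmul,
      Algebra.TensorProduct.tmul_mul_tmul, one_mul, mul_one]

lemma onTail_comul_append₂ (w : A ⊗[k] G) :
    onTail (onTail (comul : G →ₐ[k] G ⊗[k] G)) (append₂ w : A ⊗[k] (G ⊗[k] G)) =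
      append₂ (C := G ⊗[k] G) w := by
  induction w with
  | zero => simp only [map_zero]
  | add x y hx hy => simp only [map_add, hx, hy]
  | tmul x y => simp only [append₂_tmul, Algebra.TensorProduct.map_tmul, AlgHom.coe_id, id, map_one]

lemma tmul_comm {E : Type*} [Ring E] [Algebra k E] (a : A) (t : E) :
    (1 : A) ⊗ₜ[k] t * a ⊗ₜ[k] (1 : E) = a ⊗ₜ[k] (1 : E) * (1 : A) ⊗ₜ[k] t := by
  simp only [Algebra.TensorProduct.tmul_mul_tmul, one_mul, mul_one]

lemma monoid_aux₅ {R : Type*} [Monoid R] {t a u c : R} (h : t * a = a * t) :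
    t * (a * (u * c)) = a * (t * u) * c := by
  simp only [← mul_assoc, h]

lemma tail_factor_right (a x : A) (t : G ⊗[k] G) :
    (1 : A) ⊗ₜ[k] ((1 : G) ⊗ₜ[k] t) * onTail (onTail comul) (ρ.factor a x) =
      a ⊗ₜ[k] 1 * splitHead ρ.coact (x ⊗ₜ[k] t) *
        onTail (onTail comul) (↑(ρ.reassoc⁻¹) : A ⊗[k] (G ⊗[k] G)) := by
  have e1 : onTail (onTail comul) (a ⊗ₜ[k] (1 : G ⊗[k] G)) =
      a ⊗ₜ[k] (1 : G ⊗[k] (G ⊗[k] G)) := by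
    rw [Algebra.TensorProduct.map_tmul, map_one]; rfl
  rw [rightFactor_apply, map_mul (onTail (onTail comul)), map_mul (onTail (onTail comul)), e1,
    splitHead_tmul, assoc_tmul_eq, onTail_comul_append₂]
  exact monoid_aux₅ (tmul_comm a ((1 : G) ⊗ₜ[k] t))

set_option maxHeartbeats 1000000 in
set_option synthInstance.maxHeartbeats 200000 in
lemma tail_factor_left (s₁ s₂ : G) (b y : B) :
    Algebra.TensorProduct.map (onTail comul) (.id k B)
        (l.factor b y) * ((1 : G) ⊗ₜ[k] (s₁ ⊗ₜ[k] s₂)) ⊗ₜ[k] (1 : B) =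
      (unfold k G B).symm
        (onTail (splitHead comul)
            ((↑(l.reassoc⁻¹) : G ⊗[k] (G ⊗[k] B)) * (1 : G) ⊗ₜ[k] l.coact b) *
          (1 : G) ⊗ₜ[k] (s₁ ⊗ₜ[k] (s₂ ⊗ₜ[k] y))) := by
  have e2 : onTail (splitHead (B := B) (comul : G →ₐ[k] G ⊗[k] G))
      ((1 : G) ⊗ₜ[k] ((1 : G) ⊗ₜ[k] y)) =
      (1 : G) ⊗ₜ[k] ((1 : G) ⊗ₜ[k] ((1 : G) ⊗ₜ[k] y)) := by
    simp [Algebra.TensorProduct.one_def]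
  have e3 : unfold k G B (((1 : G) ⊗ₜ[k] (s₁ ⊗ₜ[k] s₂)) ⊗ₜ[k] (1 : B)) =
      (1 : G) ⊗ₜ[k] (s₁ ⊗ₜ[k] (s₂ ⊗ₜ[k] (1 : B))) := rfl
  rw [AlgEquiv.eq_symm_apply, map_mul (unfold k G B), leftFactor_apply, unfold_map_tail,
    map_mul (onTail (splitHead (B := B) (comul : G →ₐ[k] G ⊗[k] G))), mul_assoc, e2, e3]
  congr 1
  simp only [Algebra.TensorProduct.tmul_mul_tmul, one_mul, mul_one]

lemma core_induction {H : Type*} [Ring H] [Algebra k H] (δ : G →ₐ[k] H)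
    (Φ : Module.Dual k (G ⊗[k] G)) (Ψ : Module.Dual k H)
    (T : A ⊗[k] (Module.Dual k G ⊗[k] B) →ₗ[k] A ⊗[k] (Module.Dual k G ⊗[k] B))
    (P : A ⊗[k] (G ⊗[k] G) →ₗ[k] A ⊗[k] H) (Q : G ⊗[k] (G ⊗[k] B) →ₗ[k] H ⊗[k] B)
    (h : ∀ x t s₁ s₂ y, T (x ⊗ₜ[k] (sandwich comul t Φ (s₁ ⊗ₜ[k] s₂) ⊗ₜ[k] y)) =
      core δ (P (x ⊗ₜ t) ⊗ₜ[k] (Ψ ⊗ₜ[k] Q (s₁ ⊗ₜ (s₂ ⊗ₜ y)))))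
    (R : A ⊗[k] (G ⊗[k] G)) (L : G ⊗[k] (G ⊗[k] B)) :
    T (core comul (R ⊗ₜ[k] (Φ ⊗ₜ[k] (Algebra.TensorProduct.assoc k k k G G B).symm L))) =
      core δ (P R ⊗ₜ[k] (Ψ ⊗ₜ[k] Q L)) := by
  induction R with
  | zero => simp only [TensorProduct.zero_tmul, map_zero]
  | add x y hx hy => simp only [TensorProduct.add_tmul, map_add, hx, hy]
  | tmul x t =>
  induction L with
  | zero => simp only [TensorProduct.tmul_zero, map_zero]
  | add x y hx hy => simp only [TensorProduct.tmul_add, map_add, hx, hy]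
  | tmul s₁ L =>
  induction L with
  | zero => simp only [TensorProduct.tmul_zero, map_zero]
  | add x y hx hy => simp only [TensorProduct.tmul_add, map_add, hx, hy]
  | tmul s₂ y => exact h x t s₁ s₂ y

lemma crossedMul_core_tmul (R : A ⊗[k] (G ⊗[k] G)) (Φ : Module.Dual k (G ⊗[k] G))
    (L : G ⊗[k] (G ⊗[k] B)) (a : A) (χ : Module.Dual k G) (b : B) :
    crossedMul ρ l
        (core comul (R ⊗ₜ[k] (Φ ⊗ₜ[k] (Algebra.TensorProduct.assoc k k k G G B).symm L)))
        (a ⊗ₜ[k] (χ ⊗ₜ[k] b)) =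
      core (splitHead comul |>.comp comul)
        ((append₃ R * onTail (splitHead comul)
            (append₂ (ρ.coact a) * (↑(ρ.reassoc⁻¹) : A ⊗[k] (G ⊗[k] G)))) ⊗ₜ[k]
          ((TensorProduct.dualDistrib k (G ⊗[k] G) G (Φ ⊗ₜ χ) ∘ₗ
              (Algebra.TensorProduct.assoc k k k G G G).symm.toLinearMap) ⊗ₜ[k]
            (unfold k G B).symm
              (splitHead comul (↑(l.reassoc⁻¹) : G ⊗[k] (G ⊗[k] B)) *
                onTail (onTail l.coact) L *
                (1 : G) ⊗ₜ[k] ((1 : G) ⊗ₜ[k] ((1 : G) ⊗ₜ[k] b))))) := by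
  refine core_induction _ Φ _ ((crossedMul ρ l).flip (a ⊗ₜ[k] (χ ⊗ₜ[k] b)))
    (LinearMap.mulRight k (onTail (splitHead comul)
            (append₂ (ρ.coact a) * (↑(ρ.reassoc⁻¹) : A ⊗[k] (G ⊗[k] G)))) ∘ₗ append₃.toLinearMap)
    ((unfold k G B).symm.toLinearMap ∘ₗ
      LinearMap.mulRight k ((1 : G) ⊗ₜ[k] ((1 : G) ⊗ₜ[k] ((1 : G) ⊗ₜ[k] b))) ∘ₗ
      LinearMap.mulLeft k (splitHead comul (↑(l.reassoc⁻¹) : G ⊗[k] (G ⊗[k] B))) ∘ₗ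
      (onTail (onTail l.coact)).toLinearMap) (fun x t s₁ s₂ y => ?_) R L
  have h2 : TensorProduct.dualDistrib k (G ⊗[k] G) G (Φ ⊗ₜ χ) =
      (TensorProduct.dualDistrib k (G ⊗[k] G) G (Φ ⊗ₜ χ) ∘ₗ
        (Algebra.TensorProduct.assoc k k k G G G).symm.toLinearMap) ∘ₗ
        (Algebra.TensorProduct.assoc k k k G G G).toAlgHom.toLinearMap := by
    ext; simp
  rw [LinearMap.flip_apply, crossedMul_tmul, core_sandwich]
  conv_lhs => rw [h2]
  rw [core_comp, head_factor_right, head_factor_left]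
  rfl

set_option maxHeartbeats 1000000 in
set_option synthInstance.maxHeartbeats 200000 in
lemma crossedMul_tmul_core (R : A ⊗[k] (G ⊗[k] G)) (Φ : Module.Dual k (G ⊗[k] G))
    (L : G ⊗[k] (G ⊗[k] B)) (a : A) (χ : Module.Dual k G) (b : B) :
    crossedMul ρ l (a ⊗ₜ[k] (χ ⊗ₜ[k] b))
        (core comul (R ⊗ₜ[k] (Φ ⊗ₜ[k] (Algebra.TensorProduct.assoc k k k G G B).symm L))) =
      core ((onTail comul).comp comul)
        ((a ⊗ₜ[k] 1 * splitHead ρ.coact R *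
            onTail (onTail comul) (↑(ρ.reassoc⁻¹) : A ⊗[k] (G ⊗[k] G))) ⊗ₜ[k]
          (TensorProduct.dualDistrib k G (G ⊗[k] G) (χ ⊗ₜ Φ) ⊗ₜ[k]
            (unfold k G B).symm
              (onTail (splitHead comul)
                ((↑(l.reassoc⁻¹) : G ⊗[k] (G ⊗[k] B)) * (1 : G) ⊗ₜ[k] l.coact b) *
                (1 : G) ⊗ₜ[k] L))) := by
  obtain ⟨P, hP⟩ : ∃ P : A ⊗[k] (G ⊗[k] G) →ₗ[k] A ⊗[k] (G ⊗[k] (G ⊗[k] G)), ∀ R, P R =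
      a ⊗ₜ[k] 1 * splitHead ρ.coact R *
        onTail (onTail comul) (↑(ρ.reassoc⁻¹) : A ⊗[k] (G ⊗[k] G)) :=
    ⟨LinearMap.mulRight k (onTail (onTail comul) (↑(ρ.reassoc⁻¹) : A ⊗[k] (G ⊗[k] G))) ∘ₗ
      LinearMap.mulLeft k (a ⊗ₜ[k] 1) ∘ₗ (splitHead ρ.coact).toLinearMap, fun _ => rfl⟩
  obtain ⟨Q, hQ⟩ : ∃ Q : G ⊗[k] (G ⊗[k] B) →ₗ[k] (G ⊗[k] (G ⊗[k] G)) ⊗[k] B, ∀ L, Q L =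
      (unfold k G B).symm (onTail (splitHead comul)
        ((↑(l.reassoc⁻¹) : G ⊗[k] (G ⊗[k] B)) * (1 : G) ⊗ₜ[k] l.coact b) * (1 : G) ⊗ₜ[k] L) :=
    ⟨(unfold k G B).symm.toLinearMap ∘ₗ
      LinearMap.mulLeft k (onTail (splitHead comul)
        ((↑(l.reassoc⁻¹) : G ⊗[k] (G ⊗[k] B)) * (1 : G) ⊗ₜ[k] l.coact b)) ∘ₗ
      TensorProduct.mk k G (G ⊗[k] (G ⊗[k] B)) 1, fun _ => rfl⟩
  rw [← hP, ← hQ]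
  refine core_induction ((onTail comul).comp comul) Φ
    (TensorProduct.dualDistrib k G (G ⊗[k] G) (χ ⊗ₜ Φ)) (crossedMul ρ l (a ⊗ₜ[k] (χ ⊗ₜ[k] b)))
    P Q (fun x t s₁ s₂ y => ?_) R L
  rw [crossedMul_tmul, core_sandwich', hP, hQ]
  exact congrArg (core ((onTail comul).comp comul)) (congrArg₂ _ (tail_factor_right ρ a x t)
    (congrArg _ (tail_factor_left l s₁ s₂ b y)))

lemma splitHead_tmul_one (a : A) :
    splitHead ρ.coact (a ⊗ₜ[k] (1 : G ⊗[k] G)) = append₃ (append₂ (ρ.coact a)) := by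
  rw [splitHead_tmul]
  induction ρ.coact a with
  | zero => simp
  | add x y hx hy => simp only [map_add, TensorProduct.add_tmul, hx, hy]
  | tmul x y => rfl

lemma onTail_splitHead_append₂ (w : A ⊗[k] G) :
    onTail (splitHead comul) (append₂ w : A ⊗[k] (G ⊗[k] G)) =
      append₃ (onTail (comul : G →ₐ[k] G ⊗[k] G) w) := by
  induction w with
  | zero => simp
  | add x y hx hy => simp only [map_add, hx, hy]
  | tmul x y =>
    simp only [append₂_tmul, Algebra.TensorProduct.map_tmul, AlgHom.coe_id, id, splitHead_tmul]
    induction (comul y : G ⊗[k] G) with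
    | zero => simp
    | add x y hx hy => simp only [map_add, TensorProduct.add_tmul, TensorProduct.tmul_add, hx, hy]
    | tmul x y => rfl

lemma splitHead_append₂ (w : A ⊗[k] G) :
    splitHead ρ.coact (append₂ w : A ⊗[k] (G ⊗[k] G)) = append₃ (splitHead ρ.coact w) := by
  induction w with
  | zero => simp
  | add x y hx hy => simp only [map_add, hx, hy]
  | tmul x y =>
    simp only [append₂_tmul, splitHead_tmul]
    induction ρ.coact x with
    | zero => simp
    | add x y hx hy => simp only [map_add, TensorProduct.add_tmul, hx, hy]
    | tmul x y => rfl

lemma right_reassoc_inv :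
    append₃ (↑(ρ.reassoc⁻¹) : A ⊗[k] (G ⊗[k] G)) *
        onTail (splitHead comul) (↑(ρ.reassoc⁻¹) : A ⊗[k] (G ⊗[k] G)) =
      splitHead ρ.coact (↑(ρ.reassoc⁻¹) : A ⊗[k] (G ⊗[k] G)) *
        onTail (onTail comul) (↑(ρ.reassoc⁻¹) : A ⊗[k] (G ⊗[k] G)) *
        (1 : A) ⊗ₜ[k] (reassoc (k := k) (G := G)).val :=
  monoid_aux₁ ρ.pentagon (map_unit_mul_inv _ _) (map_unit_mul_inv _ _) (map_unit_inv_mul _ _)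
    (map_unit_inv_mul _ _)

lemma left_reassoc_inv :
    append₃ (reassoc (k := k) (G := G)).val *
        splitHead comul (↑(l.reassoc⁻¹) : G ⊗[k] (G ⊗[k] B)) *
        onTail (onTail l.coact) (↑(l.reassoc⁻¹) : G ⊗[k] (G ⊗[k] B)) =
      onTail (splitHead comul) (↑(l.reassoc⁻¹) : G ⊗[k] (G ⊗[k] B)) *
        (1 : G) ⊗ₜ[k] (↑(l.reassoc⁻¹) : G ⊗[k] (G ⊗[k] B)) :=
  monoid_aux₂ l.pentagon (map_unit_inv_mul (k := k)
      (Algebra.TensorProduct.includeRight : G ⊗[k] (G ⊗[k] B) →ₐ[k] G ⊗[k] (G ⊗[k] (G ⊗[k] B)))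
      l.reassoc)
    (map_unit_inv_mul _ _) (map_unit_mul_inv _ _) (map_unit_mul_inv _ _)

lemma rightFactor_assoc (a a' a'' : A) :
    append₃ (ρ.factor a a') * onTail (splitHead comul)
        (append₂ (ρ.coact a'') * (↑(ρ.reassoc⁻¹) : A ⊗[k] (G ⊗[k] G))) =
      a ⊗ₜ[k] 1 * splitHead ρ.coact (ρ.factor a' a'') *
        onTail (onTail comul) (↑(ρ.reassoc⁻¹) : A ⊗[k] (G ⊗[k] G)) *
        (1 : A) ⊗ₜ[k] (reassoc (k := k) (G := G)).val := by
  have hq : (↑(ρ.reassoc⁻¹) : A ⊗[k] (G ⊗[k] G)) * onTail comul (ρ.coact a'') =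
      splitHead ρ.coact (ρ.coact a'') * (↑(ρ.reassoc⁻¹) : A ⊗[k] (G ⊗[k] G)) := by
    rw [Units.inv_mul_eq_iff_eq_mul, ← mul_assoc, ρ.quasi_coassoc, mul_assoc, Units.mul_inv,
      mul_one]
  have hq' := congrArg (append₃ (D := G)) hq
  rw [map_mul append₃, map_mul append₃] at hq'
  have h0 : append₃ (a ⊗ₜ[k] (1 : G ⊗[k] G)) = a ⊗ₜ[k] (1 : G ⊗[k] (G ⊗[k] G)) := rfl
  rw [rightFactor_apply, rightFactor_apply, map_mul append₃, map_mul append₃,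
    map_mul (onTail _), map_mul (splitHead _), map_mul (splitHead _), splitHead_tmul_one,
    onTail_splitHead_append₂, splitHead_append₂, h0]
  exact monoid_aux₃ hq' (right_reassoc_inv ρ)

lemma leftFactor_assoc (b b' b'' : B) :
    append₃ (reassoc (k := k) (G := G)).val *
      (splitHead comul (↑(l.reassoc⁻¹) : G ⊗[k] (G ⊗[k] B)) *
        onTail (onTail l.coact)
          ((↑(l.reassoc⁻¹) : G ⊗[k] (G ⊗[k] B)) * (1 : G) ⊗ₜ[k] l.coact b *
            (1 : G) ⊗ₜ[k] ((1 : G) ⊗ₜ[k] b')) *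
        (1 : G) ⊗ₜ[k] ((1 : G) ⊗ₜ[k] ((1 : G) ⊗ₜ[k] b''))) =
      onTail (splitHead comul)
          ((↑(l.reassoc⁻¹) : G ⊗[k] (G ⊗[k] B)) * (1 : G) ⊗ₜ[k] l.coact b) *
        (1 : G) ⊗ₜ[k] ((↑(l.reassoc⁻¹) : G ⊗[k] (G ⊗[k] B)) * (1 : G) ⊗ₜ[k] l.coact b' *
            (1 : G) ⊗ₜ[k] ((1 : G) ⊗ₜ[k] b'')) := by
  have hq : splitHead comul (l.coact b) * (↑(l.reassoc⁻¹) : G ⊗[k] (G ⊗[k] B)) =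
      (↑(l.reassoc⁻¹) : G ⊗[k] (G ⊗[k] B)) * onTail l.coact (l.coact b) := by
    rw [Units.eq_inv_mul_iff_mul_eq, ← mul_assoc, ← l.quasi_coassoc, mul_assoc, Units.mul_inv,
      mul_one]
  have e1 : ∀ u v : G ⊗[k] (G ⊗[k] B), (1 : G) ⊗ₜ[k] (u * v) = (1 : G) ⊗ₜ[k] u * 1 ⊗ₜ[k] v :=
    fun u v => map_mul Algebra.TensorProduct.includeRight u v
  have e2 : onTail (onTail l.coact) ((1 : G) ⊗ₜ[k] l.coact b) =
      (1 : G) ⊗ₜ[k] onTail l.coact (l.coact b) := rfl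
  have e3 : onTail (onTail l.coact) ((1 : G) ⊗ₜ[k] ((1 : G) ⊗ₜ[k] b')) =
      (1 : G) ⊗ₜ[k] ((1 : G) ⊗ₜ[k] l.coact b') := rfl
  have e4 : onTail (splitHead (B := B) (comul : G →ₐ[k] G ⊗[k] G))
      ((1 : G) ⊗ₜ[k] l.coact b) = (1 : G) ⊗ₜ[k] splitHead comul (l.coact b) := rfl
  rw [map_mul (onTail (onTail l.coact)), map_mul (onTail (onTail l.coact)),
    map_mul (onTail (splitHead (B := B) (comul : G →ₐ[k] G ⊗[k] G))), e1, e1, e2, e3, e4]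
  refine monoid_aux₄ (left_reassoc_inv l) ?_
  rw [← e1, hq, e1]

lemma crossed_induction {P : A ⊗[k] (Module.Dual k G ⊗[k] B) → Prop}
    (x : A ⊗[k] (Module.Dual k G ⊗[k] B))
    (zero : P 0) (add : ∀ x y, P x → P y → P (x + y)) (tmul : ∀ a f b, P (a ⊗ₜ (f ⊗ₜ b))) :
    P x := by
  refine TensorProduct.induction_on x zero (fun a z => ?_) add
  refine TensorProduct.induction_on z ?_ (fun f b => tmul a f b) (fun z z' h h' => ?_)
  · rw [TensorProduct.tmul_zero]; exact zero
  · rw [TensorProduct.tmul_add]; exact add _ _ h h'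

lemma crossedMul_assoc (x y z : A ⊗[k] (Module.Dual k G ⊗[k] B)) :
    crossedMul ρ l (crossedMul ρ l x y) z = crossedMul ρ l x (crossedMul ρ l y z) := by
  induction x using crossed_induction with
  | zero => simp only [map_zero, LinearMap.zero_apply]
  | add x x' h h' => simp only [map_add, LinearMap.add_apply, h, h']
  | tmul a f b =>
  induction y using crossed_induction with
  | zero => simp only [map_zero, LinearMap.zero_apply]
  | add x x' h h' => simp only [map_add, LinearMap.add_apply, h, h']
  | tmul a' g b' =>
  induction z using crossed_induction with
  | zero => simp only [map_zero]
  | add x x' h h' => simp only [map_add, h, h']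
  | tmul a'' χ b'' =>
  rw [crossedMul_tmul, crossedMul_tmul, leftFactor_apply, leftFactor_apply, crossedMul_core_tmul,
    crossedMul_tmul_core, dualDistrib_assoc, rightFactor_assoc,
    core_intertwine (splitHead comul |>.comp comul) ((onTail comul).comp comul) _
      (fun x => (quasi_coassoc x).symm), unfold_symm_append₃, ← map_mul, leftFactor_assoc]

lemma map_evalHead_assoc_symm (w : G ⊗[k] (G ⊗[k] B)) :
    Algebra.TensorProduct.map (evalHead (counit : G →ₐ[k] k)) (.id k B)
      ((Algebra.TensorProduct.assoc k k k G G B).symm w) = evalHead counit w := by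
  induction w with
  | zero => simp only [map_zero]
  | add x y hx hy => simp only [map_add, hx, hy]
  | tmul x w =>
    induction w with
    | zero => simp only [map_zero, TensorProduct.tmul_zero]
    | add x y hx hy => simp only [map_add, TensorProduct.tmul_add, hx, hy]
    | tmul y b => simp [TensorProduct.smul_tmul']

lemma map_evalTail_assoc_symm (w : G ⊗[k] (G ⊗[k] B)) :
    Algebra.TensorProduct.map (evalTail (counit : G →ₐ[k] k)) (.id k B)
      ((Algebra.TensorProduct.assoc k k k G G B).symm w) = onTail (evalHead counit) w := by
  induction w with
  | zero => simp only [map_zero]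
  | add x y hx hy => simp only [map_add, hx, hy]
  | tmul x w =>
    induction w with
    | zero => simp only [map_zero, TensorProduct.tmul_zero]
    | add x y hx hy => simp only [map_add, TensorProduct.tmul_add, hx, hy]
    | tmul y b => simp [TensorProduct.smul_tmul]

lemma onTail_evalHead_append₂ (w : A ⊗[k] G) :
    onTail (evalHead (counit : G →ₐ[k] k)) (append₂ w : A ⊗[k] (G ⊗[k] G)) =
      evalTail counit w ⊗ₜ 1 := by
  induction w with
  | zero => simp only [map_zero, TensorProduct.zero_tmul]
  | add x y hx hy => simp only [map_add, TensorProduct.add_tmul, hx, hy]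
  | tmul x y => simp [TensorProduct.smul_tmul]

lemma onTail_evalTail_append₂ (w : A ⊗[k] G) :
    onTail (evalTail (counit : G →ₐ[k] k)) (append₂ w : A ⊗[k] (G ⊗[k] G)) = w := by
  induction w with
  | zero => simp only [map_zero]
  | add x y hx hy => simp only [map_add, hx, hy]
  | tmul x y => simp

lemma inv_counit {H K : Type*} [Ring H] [Algebra k H] [Ring K] [Algebra k K] (F : H →ₐ[k] K)
    (u : Hˣ) (h : F u = 1) : F ↑(u⁻¹) = 1 := by
  have := map_unit_mul_inv F u
  rwa [h, one_mul] at this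

lemma crossedMul_counit_tmul (a a' : A) (g : Module.Dual k G) (b b' : B) :
    crossedMul ρ l (a ⊗ₜ (counit.toLinearMap ⊗ₜ b)) (a' ⊗ₜ (g ⊗ₜ b')) =
      core (.id k G) (((a * a') ⊗ₜ[k] (1 : G)) ⊗ₜ[k] (g ⊗ₜ[k] (l.coact b * (1 : G) ⊗ₜ[k] b'))) := by
  have h : TensorProduct.dualDistrib k G G (counit.toLinearMap ⊗ₜ g) =
      g ∘ₗ (evalHead counit).toLinearMap := by
    ext x y; simp
  have hδ : (evalHead (counit : G →ₐ[k] k)).comp comul = .id k G :=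
    AlgHom.ext counit_comul
  have hX : onTail (evalHead counit) (ρ.factor a a') = (a * a') ⊗ₜ[k] (1 : G) := by
    rw [rightFactor_apply, map_mul, map_mul, onTail_evalHead_append₂, ρ.counit_coact,
      inv_counit _ _ ρ.counit_mid, mul_one]
    simp
  have hY : Algebra.TensorProduct.map (evalHead (counit : G →ₐ[k] k)) (.id k B) (l.factor b b') =
      l.coact b * (1 : G) ⊗ₜ[k] b' := by
    rw [leftFactor_apply, map_evalHead_assoc_symm, map_mul, map_mul,
      inv_counit _ _ l.counit_head, one_mul]
    simp
  rw [crossedMul_tmul, h, core_comp, hX, hY, hδ]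

lemma crossedMul_tmul_counit (a a' : A) (f : Module.Dual k G) (b b' : B) :
    crossedMul ρ l (a ⊗ₜ (f ⊗ₜ b)) (a' ⊗ₜ (counit.toLinearMap ⊗ₜ b')) =
      core (.id k G) ((a ⊗ₜ[k] (1 : G) * ρ.coact a') ⊗ₜ[k] (f ⊗ₜ[k] ((1 : G) ⊗ₜ[k] (b * b')))) := by
  have h : TensorProduct.dualDistrib k G G (f ⊗ₜ counit.toLinearMap) =
      f ∘ₗ (evalTail counit).toLinearMap := by
    ext x y; simp [mul_comm]
  have hδ : (evalTail (counit : G →ₐ[k] k)).comp comul = .id k G :=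
    AlgHom.ext comul_counit
  have hX : onTail (evalTail counit) (ρ.factor a a') = a ⊗ₜ[k] (1 : G) * ρ.coact a' := by
    rw [rightFactor_apply, map_mul, map_mul, onTail_evalTail_append₂,
      inv_counit _ _ ρ.counit_tail, mul_one]
    simp
  have hb : onTail (evalHead counit) ((1 : G) ⊗ₜ[k] l.coact b) = (1 : G) ⊗ₜ[k] b := by
    simp [l.counit_coact]
  have hY : Algebra.TensorProduct.map (evalTail (counit : G →ₐ[k] k)) (.id k B) (l.factor b b') =
      (1 : G) ⊗ₜ[k] (b * b') := by
    rw [leftFactor_apply, map_evalTail_assoc_symm, map_mul, map_mul,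
      inv_counit _ _ l.counit_mid, one_mul, hb]
    simp
  rw [crossedMul_tmul, h, core_comp, hX, hY, hδ]

lemma core_id_one (a : A) (f : Module.Dual k G) (b : B) :
    core (.id k G) ((a ⊗ₜ[k] (1 : G)) ⊗ₜ[k] (f ⊗ₜ[k] ((1 : G) ⊗ₜ[k] b))) =
      a ⊗ₜ (f ⊗ₜ b) := by
  rw [core_tmul]
  congr 2
  ext x
  simp

lemma core_id_counit (a : A) (y : G ⊗[k] B) :
    core (.id k G) ((a ⊗ₜ[k] (1 : G)) ⊗ₜ[k] ((counit : G →ₐ[k] k).toLinearMap ⊗ₜ[k] y)) =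
      a ⊗ₜ ((counit : G →ₐ[k] k).toLinearMap ⊗ₜ evalHead counit y) := by
  induction y with
  | zero => simp only [map_zero, TensorProduct.tmul_zero]
  | add x y hx hy => simp only [map_add, TensorProduct.tmul_add, hx, hy]
  | tmul s b =>
    have : sandwich (.id k G) 1 (counit : G →ₐ[k] k).toLinearMap s =
        (counit s : k) • (counit : G →ₐ[k] k).toLinearMap := by
      ext x; simp [mul_comm]
    rw [core_tmul, this, evalHead_tmul, TensorProduct.smul_tmul]

lemma crossedMul_one (x : A ⊗[k] (Module.Dual k G ⊗[k] B)) :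
    crossedMul ρ l x (1 ⊗ₜ (counit.toLinearMap ⊗ₜ 1)) = x := by
  induction x using crossed_induction with
  | zero => simp only [map_zero, LinearMap.zero_apply]
  | add x x' h h' => simp only [map_add, LinearMap.add_apply, h, h']
  | tmul a f b =>
    rw [crossedMul_tmul_counit, map_one, mul_one, mul_one, core_id_one]

lemma one_crossedMul (x : A ⊗[k] (Module.Dual k G ⊗[k] B)) :
    crossedMul ρ l (1 ⊗ₜ (counit.toLinearMap ⊗ₜ 1)) x = x := by
  induction x using crossed_induction with
  | zero => simp only [map_zero]
  | add x x' h h' => simp only [map_add, h, h']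
  | tmul a f b =>
    rw [crossedMul_counit_tmul, map_one, one_mul, one_mul, core_id_one]

lemma crossedMul_counit_counit (a a' : A) (b b' : B) :
    crossedMul ρ l (a ⊗ₜ (counit.toLinearMap ⊗ₜ b)) (a' ⊗ₜ (counit.toLinearMap ⊗ₜ b')) =
      (a * a') ⊗ₜ (counit.toLinearMap ⊗ₜ (b * b')) := by
  rw [crossedMul_counit_tmul, core_id_counit, map_mul, l.counit_coact]
  simp

/-- The two-sided crossed product `A ⋊ Ĝ ⋉ B` of a right comodule algebra `A` and a left
comodule algebra `B`: the vector space `A ⊗ Ĝ ⊗ B`, where `Ĝ` is the linear dual of `G`, with the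
multiplication
`(a ⋊ f ⋉ b)(a' ⋊ g ⋉ b') =
  a (f₁ ▷ a') ρ¹ ⋊ [λ¹ ⇀ f₂ ↼ ρ²][λ² ⇀ g₁ ↼ ρ³] ⋉ λ³ (b ◁ g₂) b'` and the unit `1 ⋊ ε ⋉ 1`, where
`φ_ρ⁻¹ = ρ¹ ⊗ ρ² ⊗ ρ³` and `φ_λ⁻¹ = λ¹ ⊗ λ² ⊗ λ³`. -/
def TwoSidedCrossedProduct (_ρ : RightCoaction k G A) (_l : LeftCoaction k G B) : Type _ :=
  A ⊗[k] (Module.Dual k G ⊗[k] B)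

namespace TwoSidedCrossedProduct

noncomputable instance : AddCommGroup (TwoSidedCrossedProduct ρ l) :=
  inferInstanceAs (AddCommGroup (A ⊗[k] (Module.Dual k G ⊗[k] B)))

noncomputable instance : Module k (TwoSidedCrossedProduct ρ l) :=
  inferInstanceAs (Module k (A ⊗[k] (Module.Dual k G ⊗[k] B)))

/-- The element `a ⋊ f ⋉ b`. -/
def mk (a : A) (f : Module.Dual k G) (b : B) : TwoSidedCrossedProduct ρ l :=
  a ⊗ₜ[k] (f ⊗ₜ[k] b)

noncomputable instance : Ring (TwoSidedCrossedProduct ρ l) :=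
  { (inferInstance : AddCommGroup (TwoSidedCrossedProduct ρ l)) with
    mul := fun x y => crossedMul ρ l x y
    one := mk ρ l 1 counit.toLinearMap 1
    left_distrib := fun x y z => map_add (crossedMul ρ l x) y z
    right_distrib := fun x y z => LinearMap.map_add₂ (crossedMul ρ l) x y z
    zero_mul := fun x => LinearMap.map_zero₂ (crossedMul ρ l) x
    mul_zero := fun x => map_zero (crossedMul ρ l x)
    mul_assoc := crossedMul_assoc ρ l
    one_mul := one_crossedMul ρ l
    mul_one := crossedMul_one ρ l }

noncomputable instance : Algebra k (TwoSidedCrossedProduct ρ l) :=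
  Algebra.ofModule (fun r x y => LinearMap.map_smul₂ (crossedMul ρ l) r x y)
    (fun r x y => map_smul (crossedMul ρ l x) r y)

lemma one_def : (1 : TwoSidedCrossedProduct ρ l) = mk ρ l 1 counit.toLinearMap 1 := rfl

lemma mk_mul_mk (a a' : A) (f g : Module.Dual k G) (b b' : B) :
    mk ρ l a f b * mk ρ l a' g b' =
      core comul (ρ.factor a a' ⊗ₜ[k]
        (TensorProduct.dualDistrib k G G (f ⊗ₜ g) ⊗ₜ[k] l.factor b b')) := rfl

/-- The embedding `A ⊗ B → A ⋊ Ĝ ⋉ B`, `a ⊗ b ↦ a ⋊ ε ⋉ b`, of algebras. -/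
noncomputable def incl : A ⊗[k] B →ₐ[k] TwoSidedCrossedProduct ρ l :=
  Algebra.TensorProduct.algHomOfLinearMapTensorProduct
    (TensorProduct.map LinearMap.id (TensorProduct.mk k (Module.Dual k G) B counit.toLinearMap))
    (fun a a' b b' => (crossedMul_counit_counit ρ l a a' b b').symm) rfl

@[simp] lemma incl_tmul (a : A) (b : B) :
    incl ρ l (a ⊗ₜ[k] b) = mk ρ l a counit.toLinearMap b := rfl

/-- The embedding `A → A ⋊ Ĝ ⋉ B`, `a ↦ a ⋊ ε ⋉ 1`. -/
noncomputable abbrev inclLeft : A →ₐ[k] TwoSidedCrossedProduct ρ l :=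
  (incl ρ l).comp Algebra.TensorProduct.includeLeft

/-- The embedding `B → A ⋊ Ĝ ⋉ B`, `b ↦ 1 ⋊ ε ⋉ b`. -/
noncomputable abbrev inclRight : B →ₐ[k] TwoSidedCrossedProduct ρ l :=
  (incl ρ l).comp Algebra.TensorProduct.includeRight

/-- The linear map `f ↦ 1 ⋊ f ⋉ 1`. -/
noncomputable def inclDual : Module.Dual k G →ₗ[k] TwoSidedCrossedProduct ρ l :=
  TensorProduct.mk k A (Module.Dual k G ⊗[k] B) 1 ∘ₗ (TensorProduct.mk k (Module.Dual k G) B).flip 1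

@[simp] lemma inclDual_apply (f : Module.Dual k G) : inclDual ρ l f = mk ρ l 1 f 1 := rfl

/-- The element `Γ = ∑ e_μ ⊗ (1 ⋊ e^μ ⋉ 1)` of `G ⊗ (A ⋊ Ĝ ⋉ B)`, for any pair of dual bases
`(e_μ)` of `G` and `(e^μ)` of `Ĝ`. -/
noncomputable def intertwiner [FiniteDimensional k G] : G ⊗[k] TwoSidedCrossedProduct ρ l :=
  LinearMap.lTensor G (inclDual ρ l) (coevaluation k G 1)

end TwoSidedCrossedProduct

end CrossedProduct

/-! ## The induced coactions on two-sided crossed products -/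

section Induced

open TwoSidedCrossedProduct

variable {k : Type*} {G : Type*} [Field k] [Ring G] [Algebra k G] [QuasiBialgebra k G]
  [FiniteDimensional k G]
variable {A B C : Type*} [Ring A] [Algebra k A] [Ring B] [Algebra k B] [Ring C] [Algebra k C]

/-- The formulas for the right coaction `(ρt, φ_ρt)` on `A ⋊ Ĝ ⋉ B`, where `A` is a right and `B`
a two-sided comodule algebra. -/
structure IsInducedRight (ρA : RightCoaction k G A) (PB : QuasiCommutingPair k G B)
    (ρt : RightCoaction k G (TwoSidedCrossedProduct ρA PB.left)) : Prop where
  /-- `φ_ρt` is the image of `φ_ρB` -/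
  reassoc_eq : (ρt.reassoc : TwoSidedCrossedProduct ρA PB.left ⊗[k] (G ⊗[k] G)) =
    Algebra.TensorProduct.map (inclRight ρA PB.left) (.id k (G ⊗[k] G))
      (PB.right.reassoc : B ⊗[k] (G ⊗[k] G))
  /-- `ρt = id ⊗ ρ_B` on `A ⊗ B` -/
  coact_incl : ∀ (a : A) (b : B), ρt.coact (incl ρA PB.left (a ⊗ₜ b)) =
    Algebra.TensorProduct.map (incl ρA PB.left) (.id k G)
      ((Algebra.TensorProduct.assoc k k k A B G).symm (a ⊗ₜ PB.right.coact b))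
  /-- `(id ⊗ ρt)(Γ) = (Γ ⊗ 1) φ_λρ⁻¹` -/
  coact_intertwiner : onTail ρt.coact (intertwiner ρA PB.left) =
    append₂ (intertwiner ρA PB.left) *
      onTail (Algebra.TensorProduct.map (inclRight ρA PB.left) (.id k G))
        (↑(PB.mixed⁻¹) : G ⊗[k] (B ⊗[k] G))

/-- The formulas for the left coaction `(lt, φ_lt)` on `B ⋊ Ĝ ⋉ C`, where `B` is a two-sided and
`C` a left comodule algebra. -/
structure IsInducedLeft (PB : QuasiCommutingPair k G B) (lC : LeftCoaction k G C)
    (lt : LeftCoaction k G (TwoSidedCrossedProduct PB.right lC)) : Prop where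
  /-- `φ_lt` is the image of `φ_λB` -/
  reassoc_eq : (lt.reassoc : G ⊗[k] (G ⊗[k] TwoSidedCrossedProduct PB.right lC)) =
    onTail (onTail (inclLeft PB.right lC)) (PB.left.reassoc : G ⊗[k] (G ⊗[k] B))
  /-- `lt = λ_B ⊗ id` on `B ⊗ C` -/
  coact_incl : ∀ (b : B) (c : C), lt.coact (incl PB.right lC (b ⊗ₜ c)) =
    onTail (incl PB.right lC)
      (Algebra.TensorProduct.assoc k k k G B C (PB.left.coact b ⊗ₜ c))
  /-- `(id ⊗ lt)(Γ) = (φ_λρ⁻¹)²³¹ Γ¹³` -/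
  coact_intertwiner : onTail lt.coact (intertwiner PB.right lC) =
    onTail (onTail (inclLeft PB.right lC)) (cycle (↑(PB.mixed⁻¹) : G ⊗[k] (B ⊗[k] G))) *
      onTail Algebra.TensorProduct.includeRight (intertwiner PB.right lC)

end Induced

end QuasiHopf

open scoped TensorProduct

namespace QuasiHopf

/-! Everything rests on a universal property of the crossed product. An algebra map `A ⋊ Ĝ ⋉ B → N`
amounts to two algebra maps `α : A → N`, `β : B → N` with commuting images and an element `Γ ∈ G ⊗
N`, normalised by `ε`, which passes `α(a)` at the cost of `ρ(a)`, passes `β(b)` at the cost of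
`λ(b)`, and for which `Γ¹³ Γ²³` equals `(Δ ⊗ id)(Γ)` corrected by `φ_ρ⁻¹` on the left and `φ_λ⁻¹` on
the right. These relations form the structure `Intertwines`. `Intertwines.lift` builds the map, and
`intertwines_intertwiner` shows that the crossed product itself carries such a triple. As `A`, `B`
and the slices of `Γ` generate, `intertwining_of_generators` reduces an identity `u F(m) = F'(m) u`
to three checks; the case `u = 1` gives uniqueness in (i) and (ii).

For existence in (i), the prescribed values on `A`, `B` and `Γ` form a triple with values in `(A ⋊ Ĝ
⋉ B) ⊗ G` (`Intertwines.rightExtension`). Its relation with `B` is the quasi-commutativity of `λ`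
and `ρ`, and its fusion relation is the pentagon relating `φ_λρ` to `φ_λ`. Quasi-coassociativity of
the resulting map, checked on `Γ`, is the pentagon relating `φ_λρ` to `φ_ρ`; the remaining axioms
are inherited from `B` or concern counits. Part (ii) is the mirror image: the two pentagons exchange
roles, and their legs must first be permuted so that the module algebra stands last.

For (iii), restricting the canonical triple of `A ⋊ Ĝ ⋉ (B ⋊ Ĝ ⋉ C)` along `B → B ⋊ Ĝ ⋉ C` gives a
map from `A ⋊ Ĝ ⋉ B`, and this map, the embedding of `C` and `Γ_BC` form a triple for the outer
product. The decisive relation is the exchange of `Γ_BC` with `Γ_AB`: one side is governed by the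
left coaction of `Γ_BC`, the other by the right coaction of `Γ_AB`, and both insert the same
`φ_λρ⁻¹`. The lifted map sends a product of generators to the same product in the same order, so it
is the reassociation of tensor factors and therefore bijective. -/

open QuasiBialgebra TwoSidedCrossedProduct

/-! ### Slicing tensor legs with functionals. -/

section Slice

variable {k : Type*} [Field k]
variable {H K N N' : Type*} [Ring H] [Algebra k H] [Ring K] [Algebra k K] [Ring N] [Algebra k N]
  [Ring N'] [Algebra k N']

/-- `f ⊗ id` for a functional `f`. -/
noncomputable def slice (f : Module.Dual k H) : H ⊗[k] N →ₗ[k] N :=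
  (TensorProduct.lid k N).toLinearMap ∘ₗ LinearMap.rTensor N f

@[simp] lemma slice_tmul (f : Module.Dual k H) (x : H) (n : N) :
    slice f (x ⊗ₜ[k] n) = f x • n := rfl

/-- `slice` as a linear map in the functional. -/
noncomputable def sliceLinear (X : H ⊗[k] N) : Module.Dual k H →ₗ[k] N where
  toFun f := slice f X
  map_add' f g := by simp [slice, LinearMap.rTensor_add]
  map_smul' r f := by simp [slice, LinearMap.rTensor_smul]

@[simp] lemma sliceLinear_apply (X : H ⊗[k] N) (f : Module.Dual k H) :
    sliceLinear X f = slice f X := rfl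

/-- Expanding the first leg in a finite basis recovers a tensor from its slices by the dual basis.
This turns identities about `Γ` into identities about the elements `1 ⋊ f ⋉ 1`, and back. -/
lemma slice_ext [FiniteDimensional k H] {X Y : H ⊗[k] N}
    (h : ∀ f : Module.Dual k H, slice f X = slice f Y) : X = Y := by
  let b := Module.Free.chooseBasis k H
  have key : ∀ Z : H ⊗[k] N, Z = ∑ i, b i ⊗ₜ[k] slice (b.coord i) Z := by
    intro Z
    induction Z with
    | zero => simp only [map_zero, TensorProduct.tmul_zero, Finset.sum_const_zero]
    | add x y hx hy =>
      simp only [map_add, TensorProduct.tmul_add, Finset.sum_add_distrib]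
      rw [← hx, ← hy]
    | tmul x n =>
      simp only [slice_tmul, ← TensorProduct.smul_tmul, ← TensorProduct.sum_tmul]
      congr 1
      exact (b.sum_repr x).symm
  rw [key X, key Y]
  simp only [h]

lemma slice_onTail (f : Module.Dual k H) (F : N →ₐ[k] N') (X : H ⊗[k] N) :
    slice f (onTail F X) = F (slice f X) := by
  induction X with
  | zero => simp only [map_zero]
  | add x y hx hy => simp only [map_add, hx, hy]
  | tmul x n => simp

lemma slice_mul_one_tmul (f : Module.Dual k H) (X : H ⊗[k] N) (n : N) :
    slice f (X * 1 ⊗ₜ[k] n) = slice f X * n := by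
  induction X with
  | zero => simp only [map_zero, zero_mul]
  | add x y hx hy => simp only [map_add, add_mul, hx, hy]
  | tmul x n => simp

lemma slice_one_tmul_mul (f : Module.Dual k H) (X : H ⊗[k] N) (n : N) :
    slice f (1 ⊗ₜ[k] n * X) = n * slice f X := by
  induction X with
  | zero => simp only [map_zero, mul_zero]
  | add x y hx hy => simp only [map_add, mul_add, hx, hy]
  | tmul x n => simp

lemma slice_counit (ε : H →ₐ[k] k) (X : H ⊗[k] N) : slice ε.toLinearMap X = evalHead ε X := rfl

/-- `f ⊗ g ⊗ id`. -/
noncomputable def slice₂ (f : Module.Dual k H) (g : Module.Dual k K) :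
    H ⊗[k] (K ⊗[k] N) →ₗ[k] N :=
  slice g ∘ₗ slice f

@[simp] lemma slice₂_tmul (f : Module.Dual k H) (g : Module.Dual k K) (x : H) (y : K) (n : N) :
    slice₂ f g (x ⊗ₜ[k] (y ⊗ₜ[k] n)) = f x • g y • n := by
  simp [slice₂]

lemma slice₂_ext [FiniteDimensional k H] [FiniteDimensional k K] {X Y : H ⊗[k] (K ⊗[k] N)}
    (h : ∀ (f : Module.Dual k H) (g : Module.Dual k K), slice₂ f g X = slice₂ f g Y) : X = Y :=
  slice_ext fun f => slice_ext fun g => h f g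

lemma slice_dualDistrib (f : Module.Dual k H) (g : Module.Dual k K) (X : (H ⊗[k] K) ⊗[k] N) :
    slice (TensorProduct.dualDistrib k H K (f ⊗ₜ g)) X =
      slice₂ f g (Algebra.TensorProduct.assoc k k k H K N X) := by
  induction X with
  | zero => simp only [map_zero]
  | add x y hx hy => simp only [map_add, hx, hy]
  | tmul w n =>
    induction w with
    | zero => simp only [map_zero, TensorProduct.zero_tmul]
    | add x y hx hy => simp only [map_add, TensorProduct.add_tmul, hx, hy]
    | tmul x y => simp [mul_smul]

/-- The left factor is `X¹³` and the right one `Y²³`, so their `H` and `K` legs do not interact and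
only the `N` legs multiply. The fusion relation is a statement about such products. -/
lemma slice₂_mul (f : Module.Dual k H) (g : Module.Dual k K) (X : H ⊗[k] N) (Y : K ⊗[k] N) :
    slice₂ f g (onTail Algebra.TensorProduct.includeRight X * (1 : H) ⊗ₜ[k] Y) =
      slice f X * slice g Y := by
  induction X with
  | zero => simp only [map_zero, zero_mul]
  | add x y hx hy => simp only [map_add, add_mul, hx, hy]
  | tmul x n =>
    induction Y with
    | zero => simp only [map_zero, mul_zero, TensorProduct.tmul_zero]
    | add x y hx hy => simp only [map_add, mul_add, TensorProduct.tmul_add, hx, hy]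
    | tmul y n' => simp [smul_comm (f x)]

end Slice

/-! ### Permutations and insertions of legs. -/

section Legs

variable {k : Type*} [Field k]
variable {A B C D E : Type*} [Ring A] [Algebra k A] [Ring B] [Algebra k B]
  [Ring C] [Algebra k C] [Ring D] [Algebra k D] [Ring E] [Algebra k E]

/-- `x ⊗ y ↦ y ⊗ x`. -/
noncomputable def flip : A ⊗[k] B →ₐ[k] B ⊗[k] A :=
  (Algebra.TensorProduct.comm k A B).toAlgHom

@[simp] lemma flip_tmul (a : A) (b : B) : flip (a ⊗ₜ[k] b) = b ⊗ₜ[k] a := rfl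

/-- `x ⊗ y ⊗ z ↦ y ⊗ z ⊗ x`. -/
noncomputable def rotate : A ⊗[k] (B ⊗[k] C) →ₐ[k] B ⊗[k] (C ⊗[k] A) :=
  (Algebra.TensorProduct.assoc k k k B C A).toAlgHom.comp flip

@[simp] lemma rotate_tmul (a : A) (b : B) (c : C) :
    rotate (a ⊗ₜ[k] (b ⊗ₜ[k] c)) = b ⊗ₜ[k] (c ⊗ₜ[k] a) := rfl

/-- `x ⊗ y ↦ x ⊗ 1 ⊗ y`. -/
noncomputable abbrev skip : A ⊗[k] C →ₐ[k] A ⊗[k] (B ⊗[k] C) :=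
  onTail Algebra.TensorProduct.includeRight

end Legs

/-! ### The linear map out of the crossed product given by a triple. -/

section Lift

variable {k : Type*} {G : Type*} [Field k] [Ring G] [Algebra k G]
variable {A B N : Type*} [Ring A] [Algebra k A] [Ring B] [Algebra k B] [Ring N] [Algebra k N]

/-- The linear map `a ⊗ f ⊗ b ↦ α(a) (f ⊗ id)(Γ) β(b)`. -/
noncomputable def liftLinear (α : A →ₐ[k] N) (β : B →ₐ[k] N) (Γ : G ⊗[k] N) :
    A ⊗[k] (Module.Dual k G ⊗[k] B) →ₗ[k] N :=
  LinearMap.mul' k N ∘ₗ TensorProduct.map α.toLinearMap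
    (LinearMap.mul' k N ∘ₗ TensorProduct.map (sliceLinear Γ) β.toLinearMap)

@[simp] lemma liftLinear_tmul (α : A →ₐ[k] N) (β : B →ₐ[k] N) (Γ : G ⊗[k] N) (a : A)
    (f : Module.Dual k G) (b : B) :
    liftLinear α β Γ (a ⊗ₜ[k] (f ⊗ₜ[k] b)) = α a * (slice f Γ * β b) := rfl

/-- Products in the crossed product are values of `core`. The functional `x ↦ Φ(t δ(x) s)` evaluated
on the `G` leg of `Γ` is `Φ` evaluated on `t · δ · s`, so the whole expression becomes a single
slice of a product in `H ⊗ N`. -/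
lemma liftLinear_core {H : Type*} [Ring H] [Algebra k H] (δ : G →ₐ[k] H) (α : A →ₐ[k] N)
    (β : B →ₐ[k] N) (Γ : G ⊗[k] N) (X : A ⊗[k] H) (Φ : Module.Dual k H) (Y : H ⊗[k] B) :
    liftLinear α β Γ (core δ (X ⊗ₜ[k] (Φ ⊗ₜ[k] Y))) =
      slice Φ (flip (Algebra.TensorProduct.map α (.id k H) X) *
        Algebra.TensorProduct.map δ (.id k N) Γ * onTail β Y) := by
  induction X with
  | zero => simp only [TensorProduct.zero_tmul, map_zero, zero_mul]
  | add x y hx hy => simp only [TensorProduct.add_tmul, map_add, add_mul, hx, hy]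
  | tmul a t =>
    induction Y with
    | zero => simp only [TensorProduct.tmul_zero, map_zero, mul_zero]
    | add x y hx hy => simp only [TensorProduct.tmul_add, map_add, mul_add, hx, hy]
    | tmul s b =>
      rw [core_tmul, liftLinear_tmul]
      induction Γ with
      | zero => simp only [map_zero, zero_mul, mul_zero]
      | add x y hx hy => simp only [map_add, mul_add, add_mul, hx, hy]
      | tmul x n => simp [mul_assoc]

end Lift

/-! ### The relations of the universal property. -/

section Intertwining

variable {k : Type*} {G : Type*} [Field k] [Ring G] [Algebra k G] [QuasiBialgebra k G]
variable {A B N : Type*} [Ring A] [Algebra k A] [Ring B] [Algebra k B] [Ring N] [Algebra k N]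

/-- The relations between algebra maps `α : A → N`, `β : B → N` and an element `Γ ∈ G ⊗ N` which
amount to an algebra map `A ⋊ Ĝ ⋉ B → N`. -/
structure Intertwines (ρ : RightCoaction k G A) (l : LeftCoaction k G B) (α : A →ₐ[k] N)
    (β : B →ₐ[k] N) (Γ : G ⊗[k] N) : Prop where
  intro ::
  commute : ∀ a b, Commute (α a) (β b)
  right : ∀ a, Γ * 1 ⊗ₜ[k] α a =
    flip (Algebra.TensorProduct.map α (.id k G) (ρ.coact a)) * Γ
  left : ∀ b, 1 ⊗ₜ[k] β b * Γ = Γ * onTail β (l.coact b)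
  counit_eq : evalHead counit Γ = 1
  -- Slicing the first two legs by `f` and `g` yields the rule for multiplying the images of `1 ⋊ f
  -- ⋉ 1` and `1 ⋊ g ⋉ 1`. The permutation `rotate` moves the `A` leg of `φ_ρ⁻¹` to the last place,
  -- where `N` sits.
  fusion : skip Γ * (1 : G) ⊗ₜ[k] Γ =
    rotate (Algebra.TensorProduct.map α (.id k (G ⊗[k] G)) (↑(ρ.reassoc⁻¹) : A ⊗[k] (G ⊗[k] G))) *
      splitHead comul Γ * onTail (onTail β) (↑(l.reassoc⁻¹) : G ⊗[k] (G ⊗[k] B))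

end Intertwining

section Legs

variable {k : Type*} {G : Type*} [Field k] [Ring G] [Algebra k G]
variable {A B N : Type*} [Ring A] [Algebra k A] [Ring B] [Algebra k B] [Ring N] [Algebra k N]

lemma assoc_map_tail {H K : Type*} [Ring H] [Algebra k H] [Ring K] [Algebra k K]
    (δ : G →ₐ[k] H ⊗[k] K) (X : G ⊗[k] N) :
    Algebra.TensorProduct.assoc k k k H K N (Algebra.TensorProduct.map δ (.id k N) X) =
      splitHead δ X := rfl

lemma assoc_onTail {H K : Type*} [Ring H] [Algebra k H] [Ring K] [Algebra k K]
    (β : B →ₐ[k] N) (Y : H ⊗[k] (K ⊗[k] B)) :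
    Algebra.TensorProduct.assoc k k k H K N
        (onTail β ((Algebra.TensorProduct.assoc k k k H K B).symm Y)) = onTail (onTail β) Y := by
  induction Y with
  | zero => simp only [map_zero]
  | add x y hx hy => simp only [map_add, hx, hy]
  | tmul h Y =>
    induction Y with
    | zero => simp only [map_zero, TensorProduct.tmul_zero]
    | add x y hx hy => simp only [map_add, TensorProduct.tmul_add, hx, hy]
    | tmul x b => rfl

lemma rotate_map_append₂ (α : A →ₐ[k] N) (w : A ⊗[k] G) :
    rotate (Algebra.TensorProduct.map α (.id k (G ⊗[k] G)) (append₂ w)) =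
      skip (flip (Algebra.TensorProduct.map α (.id k G) w)) := by
  induction w with
  | zero => simp only [map_zero]
  | add x y hx hy => simp only [map_add, hx, hy]
  | tmul x y => rfl

lemma monoid_mul_swap {R : Type*} [Monoid R] {a s r d e t b g g' a' b' : R} (h : r * d * e = g * g')
    (hs : s * g = g * a') (ht : g' * t = b' * g') :
    a * (s * r) * d * (e * t * b) = a * (g * a') * (b' * g' * b) := by
  calc a * (s * r) * d * (e * t * b) = a * s * (r * d * e) * t * b := by simp only [mul_assoc]
    _ = a * (s * g) * (g' * t) * b := by rw [h]; simp only [mul_assoc]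
    _ = _ := by rw [hs, ht]; simp only [mul_assoc]

end Legs

/-! ### Universal property: a triple satisfying the relations induces an algebra map. -/

section Universal

variable {k : Type*} {G : Type*} [Field k] [Ring G] [Algebra k G] [QuasiBialgebra k G]
variable {A B N N' : Type*} [Ring A] [Algebra k A] [Ring B] [Algebra k B] [Ring N] [Algebra k N]
  [Ring N'] [Algebra k N']
variable {ρ : RightCoaction k G A} {l : LeftCoaction k G B}

lemma liftLinear_core_comul (α : A →ₐ[k] N) (β : B →ₐ[k] N) (Γ : G ⊗[k] N)
    (X : A ⊗[k] (G ⊗[k] G)) (f g : Module.Dual k G) (Y : G ⊗[k] (G ⊗[k] B)) :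
    liftLinear α β Γ (core comul (X ⊗ₜ[k] (TensorProduct.dualDistrib k G G (f ⊗ₜ g) ⊗ₜ[k]
        (Algebra.TensorProduct.assoc k k k G G B).symm Y))) =
      slice₂ f g (rotate (Algebra.TensorProduct.map α (.id k (G ⊗[k] G)) X) *
        splitHead comul Γ * onTail (onTail β) Y) := by
  rw [liftLinear_core, slice_dualDistrib, map_mul (Algebra.TensorProduct.assoc k k k G G N),
    map_mul (Algebra.TensorProduct.assoc k k k G G N), assoc_map_tail, assoc_onTail]
  rfl

/-- On elementary tensors the product formula contains `φ_ρ⁻¹ · (Δ ⊗ id)(Γ) · φ_λ⁻¹`, with `ρ(a')`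
to its left and `λ(b)` to its right. Fusion replaces the middle by `Γ¹³ Γ²³`; then `right` turns
`ρ(a')` into `α(a')` behind `Γ¹³`, and `left` turns `λ(b)` into `β(b)` in front of `Γ²³`. -/
lemma Intertwines.liftLinear_crossedMul {α : A →ₐ[k] N} {β : B →ₐ[k] N} {Γ : G ⊗[k] N}
    (h : Intertwines ρ l α β Γ) (x y : A ⊗[k] (Module.Dual k G ⊗[k] B)) :
    liftLinear α β Γ (crossedMul ρ l x y) = liftLinear α β Γ x * liftLinear α β Γ y := by
  induction x using crossed_induction with
  | zero => simp only [map_zero, LinearMap.zero_apply, zero_mul]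
  | add x x' h h' => simp only [map_add, LinearMap.add_apply, add_mul, h, h']
  | tmul a f b =>
  induction y using crossed_induction with
  | zero => simp only [map_zero, mul_zero]
  | add x x' h h' => simp only [map_add, mul_add, h, h']
  | tmul a' g b' =>
  have e1 : rotate (Algebra.TensorProduct.map α (.id k (G ⊗[k] G)) (a ⊗ₜ[k] (1 : G ⊗[k] G))) =
      skip ((1 : G) ⊗ₜ[k] α a) := rfl
  have e2 : onTail (onTail β) ((1 : G) ⊗ₜ[k] l.coact b) = (1 : G) ⊗ₜ[k] onTail β (l.coact b) := rfl
  have e3 : onTail (onTail β) ((1 : G) ⊗ₜ[k] ((1 : G) ⊗ₜ[k] b')) =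
      (1 : G) ⊗ₜ[k] ((1 : G) ⊗ₜ[k] β b') := rfl
  have e4 : skip ((1 : G) ⊗ₜ[k] α a) * (skip Γ * skip ((1 : G) ⊗ₜ[k] α a')) *
      ((1 : G) ⊗ₜ[k] ((1 : G) ⊗ₜ[k] β b) * (1 : G) ⊗ₜ[k] Γ *
        (1 : G) ⊗ₜ[k] ((1 : G) ⊗ₜ[k] β b')) =
      skip ((1 : G) ⊗ₜ[k] α a * (Γ * 1 ⊗ₜ[k] α a')) *
        (1 : G) ⊗ₜ[k] (1 ⊗ₜ[k] β b * Γ * 1 ⊗ₜ[k] β b') := by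
    simp only [Algebra.TensorProduct.tmul_mul_tmul, one_mul, map_mul]
  have hs : skip (flip (Algebra.TensorProduct.map α (.id k G) (ρ.coact a'))) * skip Γ =
      skip Γ * skip (B := G) ((1 : G) ⊗ₜ[k] α a') := by rw [← map_mul, ← map_mul, h.right]
  have ht : (1 : G) ⊗ₜ[k] Γ * (1 : G) ⊗ₜ[k] onTail β (l.coact b) =
      (1 : G) ⊗ₜ[k] ((1 : G) ⊗ₜ[k] β b) * (1 : G) ⊗ₜ[k] Γ := by
    rw [Algebra.TensorProduct.tmul_mul_tmul, Algebra.TensorProduct.tmul_mul_tmul, h.left]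
  rw [crossedMul_tmul, rightFactor_apply, leftFactor_apply, liftLinear_core_comul,
    map_mul (Algebra.TensorProduct.map α _), map_mul (Algebra.TensorProduct.map α _),
    map_mul rotate, map_mul rotate, map_mul (onTail (onTail β)), map_mul (onTail (onTail β)),
    e1, e2, e3, rotate_map_append₂, monoid_mul_swap h.fusion.symm hs ht, e4, slice₂_mul,
    slice_one_tmul_mul, slice_mul_one_tmul, slice_mul_one_tmul, slice_one_tmul_mul,
    liftLinear_tmul, liftLinear_tmul]
  -- Both sides are now the same word except for the order of `α a'` and `β b`, which meet between
  -- the two slices.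
  have hc := (h.commute a' b).eq
  simp only [mul_assoc]
  rw [← mul_assoc (α a'), hc, mul_assoc]

/-- The algebra map `A ⋊ Ĝ ⋉ B → N` given by `α`, `β` and `Γ`. -/
noncomputable def Intertwines.lift {α : A →ₐ[k] N} {β : B →ₐ[k] N} {Γ : G ⊗[k] N}
    (h : Intertwines ρ l α β Γ) : TwoSidedCrossedProduct ρ l →ₐ[k] N :=
  AlgHom.ofLinearMap (A := TwoSidedCrossedProduct ρ l) (liftLinear α β Γ)
    (by
      change liftLinear α β Γ (1 ⊗ₜ[k] (counit.toLinearMap ⊗ₜ[k] 1)) = 1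
      rw [liftLinear_tmul, slice_counit, h.counit_eq, map_one, map_one, one_mul, one_mul])
    h.liftLinear_crossedMul

lemma Intertwines.lift_mk {α : A →ₐ[k] N} {β : B →ₐ[k] N} {Γ : G ⊗[k] N}
    (h : Intertwines ρ l α β Γ) (a : A) (f : Module.Dual k G) (b : B) :
    h.lift (mk ρ l a f b) = α a * (slice f Γ * β b) := rfl

lemma Intertwines.lift_inclLeft {α : A →ₐ[k] N} {β : B →ₐ[k] N} {Γ : G ⊗[k] N}
    (h : Intertwines ρ l α β Γ) (a : A) : h.lift (inclLeft ρ l a) = α a := by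
  change h.lift (mk ρ l a counit.toLinearMap 1) = _
  rw [h.lift_mk, slice_counit, h.counit_eq, map_one, one_mul, mul_one]

lemma Intertwines.lift_inclRight {α : A →ₐ[k] N} {β : B →ₐ[k] N} {Γ : G ⊗[k] N}
    (h : Intertwines ρ l α β Γ) (b : B) : h.lift (inclRight ρ l b) = β b := by
  change h.lift (mk ρ l 1 counit.toLinearMap b) = _
  rw [h.lift_mk, slice_counit, h.counit_eq, map_one, one_mul, one_mul]

/-- The images of `A ⋊ Ĝ ⋉ B → N → N'`. -/
lemma Intertwines.map {α : A →ₐ[k] N} {β : B →ₐ[k] N} {Γ : G ⊗[k] N}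
    (h : Intertwines ρ l α β Γ) (F : N →ₐ[k] N') :
    Intertwines ρ l (F.comp α) (F.comp β) (onTail F Γ) where
  commute a b := (h.commute a b).map F
  right a := by
    have := congrArg (onTail F) (h.right a)
    have e : ∀ w : A ⊗[k] G, onTail F (flip (Algebra.TensorProduct.map α (.id k G) w)) =
        flip (Algebra.TensorProduct.map (F.comp α) (.id k G) w) := by
      intro w
      induction w with
      | zero => simp only [map_zero]
      | add x y hx hy => simp only [map_add, hx, hy]
      | tmul x y => rfl
    rwa [map_mul, map_mul, e] at this
  left b := by
    have := congrArg (onTail F) (h.left b)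
    have e : ∀ w : G ⊗[k] B, onTail F (onTail β w) = onTail (F.comp β) w := by
      intro w
      induction w with
      | zero => simp only [map_zero]
      | add x y hx hy => simp only [map_add, hx, hy]
      | tmul x y => rfl
    rwa [map_mul, map_mul, e] at this
  counit_eq := by
    rw [← slice_counit, slice_onTail, slice_counit, h.counit_eq, map_one]
  fusion := by
    have := congrArg (onTail (onTail F)) h.fusion
    have e1 : ∀ w : A ⊗[k] (G ⊗[k] G), onTail (onTail F)
        (rotate (Algebra.TensorProduct.map α (.id k (G ⊗[k] G)) w)) =
        rotate (Algebra.TensorProduct.map (F.comp α) (.id k (G ⊗[k] G)) w) := by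
      intro w
      induction w with
      | zero => simp only [map_zero]
      | add x y hx hy => simp only [map_add, hx, hy]
      | tmul x w =>
        induction w with
        | zero => simp only [map_zero, TensorProduct.tmul_zero]
        | add x y hx hy => simp only [map_add, TensorProduct.tmul_add, hx, hy]
        | tmul x b => rfl
    have e2 : ∀ w : G ⊗[k] (G ⊗[k] B), onTail (onTail F) (onTail (onTail β) w) =
        onTail (onTail (F.comp β)) w := by
      intro w
      induction w with
      | zero => simp only [map_zero]
      | add x y hx hy => simp only [map_add, hx, hy]
      | tmul x w =>
        induction w with
        | zero => simp only [map_zero, TensorProduct.tmul_zero]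
        | add x y hx hy => simp only [map_add, TensorProduct.tmul_add, hx, hy]
        | tmul x b => rfl
    have e3 : ∀ w : G ⊗[k] N, onTail (onTail F) (splitHead comul w) =
        splitHead comul (onTail F w) := by
      intro w
      induction w with
      | zero => simp only [map_zero]
      | add x y hx hy => simp only [map_add, hx, hy]
      | tmul x n =>
        simp only [splitHead_tmul, Algebra.TensorProduct.map_tmul, AlgHom.coe_id, id]
        induction (comul x : G ⊗[k] G) with
        | zero => simp only [map_zero, TensorProduct.zero_tmul]
        | add x y hx hy => simp only [map_add, TensorProduct.add_tmul, hx, hy]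
        | tmul x y => rfl
    have e4 : ∀ w : G ⊗[k] N, onTail (onTail F) (skip (B := G) w) = skip (onTail F w) := by
      intro w
      induction w with
      | zero => simp only [map_zero]
      | add x y hx hy => simp only [map_add, hx, hy]
      | tmul x n => simp
    rw [map_mul, map_mul, map_mul, e1, e2, e3, e4] at this
    exact this

end Universal

/-! ### The canonical triple and generation by `A`, `B` and `Γ`. -/

section Canonical

variable {k : Type*} {G : Type*} [Field k] [Ring G] [Algebra k G] [QuasiBialgebra k G]
variable {A B N : Type*} [Ring A] [Algebra k A] [Ring B] [Algebra k B] [Ring N] [Algebra k N]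
variable (ρ : RightCoaction k G A) (l : LeftCoaction k G B)

/-- Multiplying by an element whose `Ĝ` component is `ε` involves no reassociator, and a coaction
applied to `1` is trivial. Hence `A`, the elements `1 ⋊ f ⋉ 1` and `B` generate the crossed product,
in this normal order. -/
lemma mk_eq_mul (a : A) (f : Module.Dual k G) (b : B) :
    mk ρ l a f b = inclLeft ρ l a * (mk ρ l 1 f 1 * inclRight ρ l b) := by
  have h : a ⊗ₜ[k] (f ⊗ₜ[k] b) = crossedMul ρ l (a ⊗ₜ (counit.toLinearMap ⊗ₜ 1))
      (crossedMul ρ l (1 ⊗ₜ (f ⊗ₜ 1)) (1 ⊗ₜ (counit.toLinearMap ⊗ₜ b))) := by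
    rw [crossedMul_tmul_counit, map_one, mul_one, one_mul, core_id_one, crossedMul_counit_tmul,
      map_one, one_mul, mul_one, core_id_one]
  exact h

variable {ρ l} in
lemma crossedProduct_induction {P : TwoSidedCrossedProduct ρ l → Prop}
    (x : TwoSidedCrossedProduct ρ l) (zero : P 0) (add : ∀ x y, P x → P y → P (x + y))
    (mk : ∀ a f b, P (mk ρ l a f b)) : P x :=
  crossed_induction x zero add mk

lemma commute_incl (a : A) (b : B) : Commute (inclLeft ρ l a) (inclRight ρ l b) := by
  have : Commute (a ⊗ₜ[k] (1 : B)) ((1 : A) ⊗ₜ[k] b) := by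
    simp [Commute, SemiconjBy]
  exact this.map (incl ρ l)

variable [FiniteDimensional k G]

lemma slice_intertwiner (f : Module.Dual k G) :
    slice f (intertwiner ρ l) = mk ρ l 1 f 1 := by
  have h : (intertwiner ρ l : G ⊗[k] TwoSidedCrossedProduct ρ l) =
      ∑ i, (Module.Basis.ofVectorSpace k G i) ⊗ₜ[k]
        inclDual ρ l ((Module.Basis.ofVectorSpace k G).coord i) := by
    rw [intertwiner, coevaluation_apply_one, map_sum]
    rfl
  rw [h, map_sum]
  simp only [slice_tmul, ← map_smul]
  rw [← map_sum, ← inclDual_apply]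
  congr 1
  exact (Module.Basis.ofVectorSpace k G).sum_dual_apply_smul_coord f

/-- Knowing that the canonical triple induces the identity lets `liftLinear_core` rewrite any
explicit product formula as a slice of an expression in `Γ`. -/
lemma liftLinear_incl (x : A ⊗[k] (Module.Dual k G ⊗[k] B)) :
    liftLinear (inclLeft ρ l) (inclRight ρ l) (intertwiner ρ l) x = x := by
  induction x using crossed_induction with
  | zero => rw [map_zero]; rfl
  | add x y hx hy => rw [map_add, hx, hy]; rfl
  | tmul a f b =>
    rw [liftLinear_tmul, slice_intertwiner]
    exact (mk_eq_mul ρ l a f b).symm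

lemma map_id_id {A B : Type*} [Ring A] [Algebra k A] [Ring B] [Algebra k B] (w : A ⊗[k] B) :
    Algebra.TensorProduct.map (.id k A) (.id k B) w = w := by
  simp

/-- The canonical data of `A ⋊ Ĝ ⋉ B`. -/
lemma intertwines_intertwiner :
    Intertwines ρ l (inclLeft ρ l) (inclRight ρ l) (intertwiner ρ l) where
  commute := commute_incl ρ l
  right a := by
    refine slice_ext fun f => ?_
    -- The slice of the wanted relation is a product formula in the crossed product. Its value is
    -- rewritten by applying `liftLinear` with the canonical triple, which changes nothing but
    -- brings it into the form of a slice.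
    have h : mk ρ l 1 f 1 * inclLeft ρ l a = _ :=
      (crossedMul_tmul_counit ρ l 1 a f 1 1).trans (liftLinear_incl ρ l _).symm
    rw [liftLinear_core, map_id_id, mul_one, ← Algebra.TensorProduct.one_def,
      ← Algebra.TensorProduct.one_def, one_mul, map_one, mul_one] at h
    rwa [slice_mul_one_tmul, slice_intertwiner]
  left b := by
    refine slice_ext fun f => ?_
    have h : inclRight ρ l b * mk ρ l 1 f 1 = _ :=
      (crossedMul_counit_tmul ρ l 1 1 f b 1).trans (liftLinear_incl ρ l _).symm
    rw [liftLinear_core, map_id_id, mul_one, ← Algebra.TensorProduct.one_def,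
      ← Algebra.TensorProduct.one_def, mul_one, map_one, map_one, one_mul] at h
    rwa [slice_one_tmul_mul, slice_intertwiner]
  counit_eq := by
    rw [← slice_counit, slice_intertwiner, ← one_def]
  fusion := by
    refine slice₂_ext fun f g => ?_
    -- With trivial `A` and `B` components the factors of the product reduce to `φ_ρ⁻¹` and `φ_λ⁻¹`.
    have h : mk ρ l 1 f 1 * mk ρ l 1 g 1 = _ :=
      (crossedMul_tmul ρ l 1 1 f g 1 1).trans (liftLinear_incl ρ l _).symm
    rw [rightFactor_apply, leftFactor_apply,
      liftLinear_core_comul, map_one, map_one, map_one,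
      ← Algebra.TensorProduct.one_def, ← Algebra.TensorProduct.one_def,
      ← Algebra.TensorProduct.one_def, one_mul, one_mul, mul_one,
      ← Algebra.TensorProduct.one_def, mul_one] at h
    rw [slice₂_mul, slice_intertwiner, slice_intertwiner]
    exact h

variable {ρ l}

/-- An identity `u F(m) = F'(m) u` between algebra maps on `A ⋊ Ĝ ⋉ B` may be checked on
`A`, `B` and `Γ`. -/
lemma intertwining_of_generators (F F' : TwoSidedCrossedProduct ρ l →ₐ[k] N) (u : N)
    (ha : ∀ a, u * F (inclLeft ρ l a) = F' (inclLeft ρ l a) * u)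
    (hb : ∀ b, u * F (inclRight ρ l b) = F' (inclRight ρ l b) * u)
    (hΓ : (1 : G) ⊗ₜ[k] u * onTail F (intertwiner ρ l) =
      onTail F' (intertwiner ρ l) * (1 : G) ⊗ₜ[k] u) (m : TwoSidedCrossedProduct ρ l) :
    u * F m = F' m * u := by
  induction m using crossedProduct_induction with
  | zero => rw [map_zero, map_zero, zero_mul, mul_zero]
  | add x y hx hy => rw [map_add, map_add, mul_add, add_mul, hx, hy]
  | mk a f b =>
    -- Slicing gives the case `m = 1 ⋊ f ⋉ 1`. The identity is stable under products in `m`, so the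
    -- factorisation `mk_eq_mul` finishes.
    have h := congrArg (slice f) hΓ
    rw [slice_one_tmul_mul, slice_mul_one_tmul, slice_onTail, slice_onTail, slice_intertwiner] at h
    rw [mk_eq_mul, map_mul, map_mul, map_mul, map_mul, ← mul_assoc, ha, mul_assoc,
      ← mul_assoc u, h, mul_assoc, mul_assoc, hb]
    simp only [mul_assoc]

/-- This is `intertwining_of_generators` with `u = 1`. It yields the uniqueness of the coactions and
the counit axioms. -/
lemma crossedProduct_hom_ext {F F' : TwoSidedCrossedProduct ρ l →ₐ[k] N}
    (ha : ∀ a, F (inclLeft ρ l a) = F' (inclLeft ρ l a))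
    (hb : ∀ b, F (inclRight ρ l b) = F' (inclRight ρ l b))
    (hΓ : onTail F (intertwiner ρ l) = onTail F' (intertwiner ρ l)) : F = F' := by
  refine AlgHom.ext fun m => ?_
  have := intertwining_of_generators F F' 1 (fun a => by rw [one_mul, mul_one, ha])
    (fun b => by rw [one_mul, mul_one, hb])
    (by rw [← Algebra.TensorProduct.one_def, one_mul, mul_one, hΓ]) m
  rwa [one_mul, mul_one] at this

lemma Intertwines.onTail_lift {α : A →ₐ[k] N} {β : B →ₐ[k] N} {Γ : G ⊗[k] N}
    (h : Intertwines ρ l α β Γ) : onTail h.lift (intertwiner ρ l) = Γ := by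
  refine slice_ext fun f => ?_
  rw [slice_onTail, slice_intertwiner, h.lift_mk, map_one, map_one, one_mul, mul_one]

end Canonical

/-! ### Naturality of the leg maps and of the counit evaluations. -/

section MoreLegs

variable {k : Type*} [Field k]
variable {A B C D E A' B' C' D' : Type*} [Ring A] [Algebra k A] [Ring B] [Algebra k B]
  [Ring C] [Algebra k C] [Ring D] [Algebra k D] [Ring E] [Algebra k E] [Ring A'] [Algebra k A']
  [Ring B'] [Algebra k B'] [Ring C'] [Algebra k C'] [Ring D'] [Algebra k D']

lemma onTail_comp (F : C →ₐ[k] D) (F' : B →ₐ[k] C) (w : A ⊗[k] B) :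
    onTail (F.comp F') w = onTail F (onTail F' w) := by
  induction w with
  | zero => simp only [map_zero]
  | add x y hx hy => simp only [map_add, hx, hy]
  | tmul x y => rfl

/-- A commuting square may be tensored with one more leg on the left; iterating this carries
naturality to any depth of nesting. -/
lemma onTail_square {F : C →ₐ[k] D} {F' : B →ₐ[k] C} {K : B' →ₐ[k] D} {K' : B →ₐ[k] B'}
    (h : ∀ v, F (F' v) = K (K' v)) (w : A ⊗[k] B) :
    onTail F (onTail F' w) = onTail K (onTail K' w) := by
  rw [← onTail_comp, ← onTail_comp]
  exact congrArg (fun L => onTail (A := A) L w) (AlgHom.ext h)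

lemma onTail_onTail_comp (F : D →ₐ[k] E) (F' : C →ₐ[k] D) (w : A ⊗[k] (B ⊗[k] C)) :
    onTail (onTail (F.comp F')) w = onTail (onTail F) (onTail (onTail F') w) := by
  rw [← onTail_comp]
  exact congrArg (fun L => onTail (A := A) L w) (AlgHom.ext (onTail_comp F F'))

lemma onTail_map (α : A →ₐ[k] A') (F : B →ₐ[k] C) (w : A ⊗[k] B) :
    onTail F (Algebra.TensorProduct.map α (.id k B) w) =
      Algebra.TensorProduct.map α (.id k C) (onTail F w) := by
  induction w with
  | zero => simp only [map_zero]
  | add x y hx hy => simp only [map_add, hx, hy]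
  | tmul x y => rfl

lemma append₂_flip (α : A →ₐ[k] C) (w : A ⊗[k] B) :
    append₂ (C := E) (flip (Algebra.TensorProduct.map α (.id k B) w)) =
      flip (Algebra.TensorProduct.map (Algebra.TensorProduct.includeLeft.comp α) (.id k B) w) := by
  induction w with
  | zero => simp only [map_zero]
  | add x y hx hy => simp only [map_add, hx, hy]
  | tmul x y => rfl

lemma append₃_rotate (α : A →ₐ[k] D) (w : A ⊗[k] (B ⊗[k] C)) :
    append₃ (D := E) (rotate (Algebra.TensorProduct.map α (.id k (B ⊗[k] C)) w)) =
      rotate (Algebra.TensorProduct.map (Algebra.TensorProduct.includeLeft.comp α)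
        (.id k (B ⊗[k] C)) w) := by
  induction w with
  | zero => simp only [map_zero]
  | add x y hx hy => simp only [map_add, hx, hy]
  | tmul x w =>
    induction w with
    | zero => simp only [map_zero, TensorProduct.tmul_zero]
    | add x y hx hy => simp only [map_add, TensorProduct.tmul_add, hx, hy]
    | tmul x b => rfl

lemma onTail_onTail_assoc (F : B →ₐ[k] B') (w : C ⊗[k] D) (b : B) :
    onTail (onTail F) (Algebra.TensorProduct.assoc k k k C D B (w ⊗ₜ[k] b)) =
      Algebra.TensorProduct.assoc k k k C D B' (w ⊗ₜ[k] F b) := by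
  induction w with
  | zero => simp only [map_zero, TensorProduct.zero_tmul]
  | add x y hx hy => simp only [map_add, TensorProduct.add_tmul, hx, hy]
  | tmul x y => rfl

lemma splitHead_onTail (f : A →ₐ[k] C ⊗[k] D) (F : B →ₐ[k] B') (w : A ⊗[k] B) :
    splitHead f (onTail F w) = onTail (onTail F) (splitHead f w) := by
  induction w with
  | zero => simp only [map_zero]
  | add x y hx hy => simp only [map_add, hx, hy]
  | tmul x y => exact (onTail_onTail_assoc F (f x) y).symm

lemma onTail_map_assoc (β : D →ₐ[k] D') (w : C ⊗[k] D) (e : E) :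
    onTail (Algebra.TensorProduct.map β (.id k E))
        (Algebra.TensorProduct.assoc k k k C D E (w ⊗ₜ[k] e)) =
      Algebra.TensorProduct.assoc k k k C D' E (onTail β w ⊗ₜ[k] e) := by
  induction w with
  | zero => simp only [map_zero, TensorProduct.zero_tmul]
  | add x y hx hy => simp only [map_add, TensorProduct.add_tmul, hx, hy]
  | tmul x y => rfl

lemma map_assoc (β : C →ₐ[k] C') (w : C ⊗[k] D) (e : E) :
    Algebra.TensorProduct.map β (.id k (D ⊗[k] E))
        (Algebra.TensorProduct.assoc k k k C D E (w ⊗ₜ[k] e)) =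
      Algebra.TensorProduct.assoc k k k C' D E
        (Algebra.TensorProduct.map β (.id k D) w ⊗ₜ[k] e) := by
  induction w with
  | zero => simp only [map_zero, TensorProduct.zero_tmul]
  | add x y hx hy => simp only [map_add, TensorProduct.add_tmul, hx, hy]
  | tmul x y => rfl

lemma splitHead_map (F : A' →ₐ[k] C' ⊗[k] D) (f : A →ₐ[k] C ⊗[k] D) (ι : A →ₐ[k] A')
    (κ : C →ₐ[k] C') (h : ∀ a, F (ι a) = Algebra.TensorProduct.map κ (.id k D) (f a))
    (w : A ⊗[k] B) :
    splitHead F (Algebra.TensorProduct.map ι (.id k B) w) =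
      Algebra.TensorProduct.map κ (.id k (D ⊗[k] B)) (splitHead f w) := by
  induction w with
  | zero => simp only [map_zero]
  | add x y hx hy => simp only [map_add, hx, hy]
  | tmul x y =>
    rw [splitHead_tmul, map_assoc, ← h]
    rfl

lemma assoc_tmul_eq_append (w : A ⊗[k] B) (t : E) :
    Algebra.TensorProduct.assoc k k k A B E (w ⊗ₜ[k] t) =
      append₂ w * (1 : A) ⊗ₜ[k] ((1 : B) ⊗ₜ[k] t) := by
  induction w with
  | zero => rw [TensorProduct.zero_tmul, map_zero, map_zero, zero_mul]
  | add x y hx hy => rw [TensorProduct.add_tmul, map_add, map_add, add_mul, hx, hy]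
  | tmul x y =>
    simp only [append₂_tmul, Algebra.TensorProduct.assoc_tmul,
      Algebra.TensorProduct.tmul_mul_tmul, one_mul, mul_one]

lemma commute_append₂ (w : A ⊗[k] B) (t : E) :
    Commute ((1 : A) ⊗ₜ[k] ((1 : B) ⊗ₜ[k] t)) (append₂ w) := by
  change _ * _ = _ * _
  rw [← assoc_tmul_eq_append, assoc_tmul_eq_append]
  induction w with
  | zero => rw [map_zero, zero_mul, mul_zero]
  | add x y hx hy => rw [map_add, add_mul, mul_add, hx, hy]
  | tmul x y =>
    simp only [append₂_tmul, Algebra.TensorProduct.tmul_mul_tmul, one_mul, mul_one]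

lemma splitHead_append (f : A →ₐ[k] C ⊗[k] D) (w : A ⊗[k] B) :
    splitHead f (append₂ w : A ⊗[k] (B ⊗[k] E)) = append₃ (splitHead f w) := by
  rw [append₃, append₂, append₂, splitHead_onTail]

lemma onTail_splitHead_append (f : B →ₐ[k] C ⊗[k] D) (w : A ⊗[k] B) :
    onTail (splitHead f) (append₂ w : A ⊗[k] (B ⊗[k] E)) = append₃ (onTail f w) := by
  induction w with
  | zero => simp only [map_zero]
  | add x y hx hy => simp only [map_add, hx, hy]
  | tmul x y =>
    rw [append₂_tmul, Algebra.TensorProduct.map_tmul, Algebra.TensorProduct.map_tmul,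
      splitHead_tmul, assoc_tmul_eq_append, ← Algebra.TensorProduct.one_def,
      ← Algebra.TensorProduct.one_def, mul_one]
    rfl

lemma append₃_append (w : A ⊗[k] B) :
    (append₃ (append₂ w : A ⊗[k] (B ⊗[k] C)) : A ⊗[k] (B ⊗[k] (C ⊗[k] D))) = append₂ w := by
  induction w with
  | zero => simp only [map_zero]
  | add x y hx hy => simp only [map_add, hx, hy]
  | tmul x y => rfl

lemma onTail_onTail_append (F : C →ₐ[k] D) (w : A ⊗[k] B) :
    onTail (onTail F) (append₂ w) = append₂ w := by
  induction w with
  | zero => simp only [map_zero]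
  | add x y hx hy => simp only [map_add, hx, hy]
  | tmul x y => simp

lemma append₃_skip (w : A ⊗[k] C) :
    append₃ (skip (B := B) w) = skip (append₂ (C := E) w) := by
  induction w with
  | zero => simp only [map_zero]
  | add x y hx hy => simp only [map_add, hx, hy]
  | tmul x y => rfl

lemma commute_onTail_map {α : A →ₐ[k] D} {β : B →ₐ[k] D} (h : ∀ a b, Commute (α a) (β b)) (a : A)
    (w : C ⊗[k] (B ⊗[k] E)) :
    Commute ((1 : C) ⊗ₜ[k] (α a ⊗ₜ[k] (1 : E)))
      (onTail (Algebra.TensorProduct.map β (.id k E)) w) := by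
  change _ * _ = _ * _
  induction w with
  | zero => rw [map_zero, zero_mul, mul_zero]
  | add x y hx hy => rw [map_add, add_mul, mul_add, hx, hy]
  | tmul x w =>
    induction w with
    | zero => rw [TensorProduct.tmul_zero, map_zero, zero_mul, mul_zero]
    | add x y hx hy => rw [TensorProduct.tmul_add, map_add, add_mul, mul_add, hx, hy]
    | tmul y e =>
      simp only [Algebra.TensorProduct.map_tmul, Algebra.TensorProduct.tmul_mul_tmul, one_mul,
        mul_one, (h a y).eq]

lemma evalHead_onTail (ε : A →ₐ[k] k) (F : B →ₐ[k] C) (w : A ⊗[k] B) :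
    evalHead ε (onTail F w) = F (evalHead ε w) := by
  induction w with
  | zero => simp only [map_zero]
  | add x y hx hy => simp only [map_add, hx, hy]
  | tmul x y => simp

lemma evalHead_assoc (ε : C →ₐ[k] k) (w : C ⊗[k] D) (e : E) :
    evalHead ε (Algebra.TensorProduct.assoc k k k C D E (w ⊗ₜ[k] e)) =
      evalHead ε w ⊗ₜ[k] e := by
  induction w with
  | zero => simp only [map_zero, TensorProduct.zero_tmul]
  | add x y hx hy => simp only [map_add, TensorProduct.add_tmul, hx, hy]
  | tmul x y => simp [TensorProduct.smul_tmul']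

lemma onTail_evalHead_assoc (ε : D →ₐ[k] k) (w : C ⊗[k] D) (e : E) :
    onTail (evalHead ε) (Algebra.TensorProduct.assoc k k k C D E (w ⊗ₜ[k] e)) =
      evalTail ε w ⊗ₜ[k] e := by
  induction w with
  | zero => simp only [map_zero, TensorProduct.zero_tmul]
  | add x y hx hy => simp only [map_add, TensorProduct.add_tmul, hx, hy]
  | tmul x y => simp [TensorProduct.smul_tmul]

lemma evalHead_splitHead {f : A →ₐ[k] C ⊗[k] A} {ε : C →ₐ[k] k} (h : ∀ a, evalHead ε (f a) = a)
    (w : A ⊗[k] B) : evalHead ε (splitHead f w) = w := by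
  induction w with
  | zero => simp only [map_zero]
  | add x y hx hy => simp only [map_add, hx, hy]
  | tmul x y => rw [splitHead_tmul, evalHead_assoc, h]

lemma onTail_evalHead_splitHead {f : A →ₐ[k] A ⊗[k] D} {ε : D →ₐ[k] k}
    (h : ∀ a, evalTail ε (f a) = a) (w : A ⊗[k] B) :
    onTail (evalHead ε) (splitHead f w) = w := by
  induction w with
  | zero => simp only [map_zero]
  | add x y hx hy => simp only [map_add, hx, hy]
  | tmul x y => rw [splitHead_tmul, onTail_evalHead_assoc, h]

lemma onTail_id {F : B →ₐ[k] B} (h : ∀ b, F b = b) (w : A ⊗[k] B) : onTail F w = w := by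
  rw [show F = .id k B from AlgHom.ext h]
  simp

lemma onTail_evalTail_append (ε : C →ₐ[k] k) (w : A ⊗[k] B) :
    onTail (evalTail ε) (append₂ w : A ⊗[k] (B ⊗[k] C)) = w := by
  induction w with
  | zero => simp only [map_zero]
  | add x y hx hy => simp only [map_add, hx, hy]
  | tmul x y => simp

lemma evalTail_map (ε : B →ₐ[k] k) (F : A →ₐ[k] C) (w : A ⊗[k] B) :
    evalTail ε (Algebra.TensorProduct.map F (.id k B) w) = F (evalTail ε w) := by
  induction w with
  | zero => simp only [map_zero]
  | add x y hx hy => simp only [map_add, hx, hy]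
  | tmul x y => simp

lemma mul_inv_mul_inv_of_mul_mul_eq {R : Type*} [Monoid R] {u v w x y w' v' x' : R} (h : u * v * w = x * y)
    (hv : v * v' = 1) (hw : w * w' = 1) (hx : x' * x = 1) :
    y * w' * v' = x' * u :=
  calc y * w' * v' = x' * (x * y) * w' * v' := by simp only [← mul_assoc, hx, one_mul]
    _ = x' * u * (v * (w * w') * v') := by rw [← h]; simp only [mul_assoc]
    _ = _ := by rw [hw, mul_one, hv, mul_one]

end MoreLegs

/-! ### Counit normalisations of `φ_λρ`. -/

section MixedCounit

variable {k : Type*} {G : Type*} [Field k] [Ring G] [Algebra k G] [QuasiBialgebra k G]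
variable {B : Type*} [Ring B] [Algebra k B] (P : QuasiCommutingPair k G B)

/-- This normalisation is not among the axioms. Applying `ε` to the second leg of `pentagon_left`
kills both occurrences of `φ_λ` and leaves `(1 ⊗ (ε ⊗ id ⊗ id)(φ_λρ)) φ_λρ = φ_λρ`, where the unit
`φ_λρ` cancels. -/
lemma QuasiCommutingPair.evalHead_mixed :
    evalHead counit (P.mixed : G ⊗[k] (B ⊗[k] G)) = 1 := by
  have h := congrArg (onTail (evalHead (counit : G →ₐ[k] k))) P.pentagon_left
  rw [map_mul, map_mul, map_mul] at h
  have e1 : onTail (evalHead counit) (onTail (splitHead P.left.coact)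
      (P.mixed : G ⊗[k] (B ⊗[k] G))) = (P.mixed : G ⊗[k] (B ⊗[k] G)) := by
    rw [← onTail_comp]
    exact onTail_id (fun v => evalHead_splitHead P.left.counit_coact v) _
  have e2 : onTail (evalHead counit) (append₃ (D := G) (P.left.reassoc : G ⊗[k] (G ⊗[k] B))) =
      1 := by
    refine (onTail_square (K := Algebra.TensorProduct.includeLeft) (K' := evalHead counit)
      (fun v => ?_) _).trans ?_
    · exact evalHead_onTail _ _ _
    · rw [P.left.counit_mid, map_one]
  have e3 : onTail (evalHead counit) (onTail (onTail P.right.coact)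
      (P.left.reassoc : G ⊗[k] (G ⊗[k] B))) = 1 := by
    rw [onTail_square (K := P.right.coact) (K' := evalHead counit)
      (fun v => evalHead_onTail _ _ _), P.left.counit_mid, map_one]
  rw [e1, e2, e3, mul_one, one_mul, onTail_evalHead_splitHead comul_counit]
    at h
  have := congrArg (evalHead (counit : G →ₐ[k] k))
    (P.mixed.mul_left_inj.mp (h.trans (one_mul _).symm))
  simpa using this

/-- Applying `ε` to the third leg of `pentagon_right` kills both occurrences of `φ_ρ` and leaves
`φ_λρ ((id ⊗ id ⊗ ε)(φ_λρ) ⊗ 1) = φ_λρ`. -/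
lemma QuasiCommutingPair.evalTail_mixed :
    onTail (evalTail counit) (P.mixed : G ⊗[k] (B ⊗[k] G)) = 1 := by
  have h := congrArg (onTail (onTail (evalHead (counit : G →ₐ[k] k)))) P.pentagon_right
  rw [map_mul, map_mul, map_mul] at h
  have e1 : onTail (onTail (evalHead counit)) (onTail (splitHead P.right.coact)
      (P.mixed : G ⊗[k] (B ⊗[k] G))) = (P.mixed : G ⊗[k] (B ⊗[k] G)) := by
    rw [← onTail_comp]
    exact onTail_id (fun v => onTail_evalHead_splitHead P.right.counit_coact v) _
  have e2 : onTail (onTail (evalHead counit))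
      ((1 : G) ⊗ₜ[k] (P.right.reassoc : B ⊗[k] (G ⊗[k] G))) = 1 := by
    rw [Algebra.TensorProduct.map_tmul, P.right.counit_mid, map_one]
    rfl
  have e3 : onTail (onTail (evalHead counit)) (append₃ (D := G)
      (P.mixed : G ⊗[k] (B ⊗[k] G))) =
      append₂ (onTail (evalTail counit) (P.mixed : G ⊗[k] (B ⊗[k] G))) := by
    refine onTail_square (fun v => ?_) _
    induction v with
    | zero => simp only [map_zero]
    | add x y hx hy => simp only [map_add, hx, hy]
    | tmul x y => simp [TensorProduct.smul_tmul']
  have e4 : onTail (onTail (evalHead counit)) (onTail (onTail comul)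
      (P.mixed : G ⊗[k] (B ⊗[k] G))) = (P.mixed : G ⊗[k] (B ⊗[k] G)) := by
    rw [← onTail_comp]
    refine onTail_id (fun v => ?_) _
    rw [AlgHom.comp_apply, ← onTail_comp]
    exact onTail_id counit_comul v
  have e5 : onTail (onTail (evalHead counit)) (splitHead P.left.coact
      (P.right.reassoc : B ⊗[k] (G ⊗[k] G))) = 1 := by
    rw [← splitHead_onTail, P.right.counit_mid, map_one]
  rw [e1, e2, e3, e4, e5, one_mul, mul_one] at h
  have := congrArg (onTail (evalTail (counit : G →ₐ[k] k)))
    (P.mixed.mul_right_inj.mp (h.trans (mul_one _).symm))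
  rwa [onTail_evalTail_append, map_one] at this

end MixedCounit

/-! ### The triple defining the induced right coaction. -/

section RightExtension

variable {k : Type*} {G : Type*} [Field k] [Ring G] [Algebra k G] [QuasiBialgebra k G]
variable {A B N E : Type*} [Ring A] [Algebra k A] [Ring B] [Algebra k B] [Ring N] [Algebra k N]
  [Ring E] [Algebra k E]

/-- The relation `left` with a spectator leg `E` behind `N`: elements of `E` commute with `Γ ⊗ 1`.
It serves for moving `φ_λρ⁻¹` and `φ_ρ` past `Γ`. -/
lemma Intertwines.tmul_map_mul_append₂ {ρ : RightCoaction k G A} {l : LeftCoaction k G B}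
    {α : A →ₐ[k] N} {β : B →ₐ[k] N} {Γ : G ⊗[k] N} (h : Intertwines ρ l α β Γ) (w : B ⊗[k] E) :
    (1 : G) ⊗ₜ[k] Algebra.TensorProduct.map β (.id k E) w * append₂ Γ =
      append₂ Γ * onTail (Algebra.TensorProduct.map β (.id k E)) (splitHead l.coact w) := by
  induction w with
  | zero => simp only [map_zero, TensorProduct.tmul_zero, zero_mul, mul_zero]
  | add x y hx hy => simp only [map_add, TensorProduct.tmul_add, add_mul, mul_add, hx, hy]
  | tmul b e =>
    have h1 : (1 : G) ⊗ₜ[k] Algebra.TensorProduct.map β (.id k E) (b ⊗ₜ[k] e) =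
        (1 : G) ⊗ₜ[k] ((1 : N) ⊗ₜ[k] e) * append₂ ((1 : G) ⊗ₜ[k] β b) := by
      simp
    rw [splitHead_tmul, onTail_map_assoc, assoc_tmul_eq_append, h1, mul_assoc, ← map_mul, h.left,
      map_mul, ← mul_assoc, (commute_append₂ Γ e).eq, mul_assoc,
      (commute_append₂ _ e).eq]

lemma Intertwines.skip_mul_tmul_append₂ {ρ : RightCoaction k G A} {l : LeftCoaction k G B}
    {α : A →ₐ[k] N} {β : B →ₐ[k] N} {Γ : G ⊗[k] N} (h : Intertwines ρ l α β Γ)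
    (w : G ⊗[k] (B ⊗[k] E)) :
    skip (onTail (Algebra.TensorProduct.map β (.id k E)) w) * (1 : G) ⊗ₜ[k] append₂ Γ =
      (1 : G) ⊗ₜ[k] append₂ Γ * onTail (onTail (Algebra.TensorProduct.map β (.id k E)))
        (onTail (splitHead l.coact) w) := by
  induction w with
  | zero => simp only [map_zero, zero_mul]; exact (mul_zero _).symm
  | add x y hx hy => simp only [map_add, add_mul, hx, hy]; exact (mul_add _ _ _).symm
  | tmul x w =>
    simp only [Algebra.TensorProduct.map_tmul, AlgHom.coe_id, id,
      Algebra.TensorProduct.includeRight_apply, Algebra.TensorProduct.tmul_mul_tmul, one_mul,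
      mul_one, h.tmul_map_mul_append₂]

lemma skip_onTail {C D F : Type*} [Ring C] [Algebra k C] [Ring D] [Algebra k D] [Ring F]
    [Algebra k F] (f : D →ₐ[k] F) (w : C ⊗[k] D) :
    skip (B := E) (onTail f w) = onTail (onTail f) (skip w) := by
  refine (onTail_square (fun v => ?_) w)
  simp

/-- The skeleton of the fusion check for the right extension: `s`, `t` are the two copies of `Γ`,
and `p`, `q` the two copies of `φ_λρ⁻¹`. The hypotheses are the exchange of `p` with `t`, the old
fusion relation and the inverted pentagon. -/
lemma mul_mul_mul_eq_of_intertwine {R : Type*} [Monoid R] {s p t q c d r a i e : R}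
    (hpt : p * t = t * i) (hst : s * t = c * d * r) (hq : r * i * q = e * a) :
    s * p * (t * q) = c * (d * e) * a :=
  calc s * p * (t * q) = s * (p * t) * q := by simp only [mul_assoc]
    _ = s * t * i * q := by rw [hpt]; simp only [mul_assoc]
    _ = c * d * (r * i * q) := by rw [hst]; simp only [mul_assoc]
    _ = _ := by rw [hq]; simp only [mul_assoc]

variable {ρ : RightCoaction k G A} {P : QuasiCommutingPair k G B}

/-- Inverting all of `pentagon_left` reverses the order of the factors, so that `φ_λ⁻¹` comes first,
as it does after the old fusion relation. -/
lemma mixed_pentagon_left_inv :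
    append₃ (↑(P.left.reassoc⁻¹) : G ⊗[k] (G ⊗[k] B)) *
        onTail (splitHead P.left.coact) (↑(P.mixed⁻¹) : G ⊗[k] (B ⊗[k] G)) *
        (1 : G) ⊗ₜ[k] (↑(P.mixed⁻¹) : G ⊗[k] (B ⊗[k] G)) =
      splitHead comul (↑(P.mixed⁻¹) : G ⊗[k] (B ⊗[k] G)) *
        onTail (onTail P.right.coact) (↑(P.left.reassoc⁻¹) : G ⊗[k] (G ⊗[k] B)) := by
  have h := congrArg Units.val (congrArg Inv.inv (Units.ext (u :=
      Units.map (Algebra.TensorProduct.includeRight :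
        G ⊗[k] (B ⊗[k] G) →ₐ[k] G ⊗[k] (G ⊗[k] (B ⊗[k] G))).toMonoidHom P.mixed *
      Units.map (onTail (splitHead P.left.coact)).toMonoidHom P.mixed *
      Units.map (append₃ (D := G)).toMonoidHom P.left.reassoc)
    (v := Units.map (onTail (onTail P.right.coact)).toMonoidHom P.left.reassoc *
      Units.map (splitHead comul).toMonoidHom P.mixed) P.pentagon_left))
  rw [mul_inv_rev, mul_inv_rev, mul_inv_rev, ← mul_assoc] at h
  exact h

/-- The data extending `A ⋊ Ĝ ⋉ B → N` to `A ⋊ Ĝ ⋉ B → N ⊗ G`. -/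
lemma Intertwines.rightExtension {α : A →ₐ[k] N} {β : B →ₐ[k] N} {Γ : G ⊗[k] N}
    (h : Intertwines ρ P.left α β Γ) :
    Intertwines ρ P.left ((Algebra.TensorProduct.includeLeft : N →ₐ[k] N ⊗[k] G).comp α)
      ((Algebra.TensorProduct.map β (.id k G)).comp P.right.coact)
      (append₂ Γ * onTail (Algebra.TensorProduct.map β (.id k G))
        (↑(P.mixed⁻¹) : G ⊗[k] (B ⊗[k] G))) where
  commute a b := by
    change Commute (α a ⊗ₜ[k] (1 : G)) (Algebra.TensorProduct.map β (.id k G) (P.right.coact b))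
    change _ * _ = _ * _
    induction P.right.coact b with
    | zero => rw [map_zero, zero_mul, mul_zero]
    | add x y hx hy => rw [map_add, add_mul, mul_add, hx, hy]
    | tmul x y =>
      simp only [Algebra.TensorProduct.map_tmul, Algebra.TensorProduct.tmul_mul_tmul, one_mul,
        mul_one, (h.commute a x).eq]
  right a := by
    change _ * (1 : G) ⊗ₜ[k] (α a ⊗ₜ[k] (1 : G)) = _
    -- The middle leg of `φ_λρ⁻¹` lies in the image of `β`, hence commutes with `α(a)`; only the old
    -- relation for `Γ` remains.
    rw [mul_assoc, ← (commute_onTail_map h.commute a _).eq, ← mul_assoc, ← append₂_tmul,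
      ← map_mul, h.right, map_mul, append₂_flip, mul_assoc]
  left b := by
    change (1 : G) ⊗ₜ[k] Algebra.TensorProduct.map β (.id k G) (P.right.coact b) * _ = _
    have hq : splitHead P.left.coact (P.right.coact b) * (↑(P.mixed⁻¹) : G ⊗[k] (B ⊗[k] G)) =
        (↑(P.mixed⁻¹) : G ⊗[k] (B ⊗[k] G)) * onTail P.right.coact (P.left.coact b) := by
      rw [Units.eq_inv_mul_iff_mul_eq, ← mul_assoc, P.quasi_comm, mul_assoc, Units.mul_inv,
        mul_one]
    -- Passing `Γ` turns `ρ(b)` into `(λ ⊗ id)(ρ(b))`, and passing `φ_λρ⁻¹` turns this into `(id ⊗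
    -- ρ)(λ(b))`, the required value of the new `β` on `λ(b)`.
    rw [← mul_assoc, h.tmul_map_mul_append₂, mul_assoc, ← map_mul, hq, map_mul, mul_assoc,
      onTail_comp]
  counit_eq := by
    rw [map_mul, evalHead_onTail, inv_counit _ _ P.evalHead_mixed, map_one, mul_one, append₂,
      evalHead_onTail, h.counit_eq, map_one]
  fusion := by
    have e1 : (1 : G) ⊗ₜ[k] (append₂ Γ * onTail (Algebra.TensorProduct.map β (.id k G))
        (↑(P.mixed⁻¹) : G ⊗[k] (B ⊗[k] G))) =
        (1 : G) ⊗ₜ[k] append₂ Γ * onTail (onTail (Algebra.TensorProduct.map β (.id k G)))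
          ((1 : G) ⊗ₜ[k] (↑(P.mixed⁻¹) : G ⊗[k] (B ⊗[k] G))) := by
      rw [Algebra.TensorProduct.map_tmul, Algebra.TensorProduct.tmul_mul_tmul, map_one, one_mul]
    have e2 : ∀ w : G ⊗[k] (G ⊗[k] B), append₃ (onTail (onTail β) w) =
        onTail (onTail (Algebra.TensorProduct.map β (.id k G))) (append₃ w) := by
      intro w
      refine onTail_square (fun v => onTail_square (fun v => ?_) v) w
      simp
    have hf := congrArg (append₃ (D := G)) h.fusion
    have hp := congrArg (onTail (onTail (Algebra.TensorProduct.map β (.id k G))))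
      (mixed_pentagon_left_inv (P := P))
    rw [map_mul, map_mul, map_mul] at hp
    rw [map_mul, map_mul, map_mul, append₃_skip, append₃_rotate, ← splitHead_append, e2] at hf
    rw [map_mul skip, e1, map_mul (splitHead _), splitHead_onTail,
      mul_mul_mul_eq_of_intertwine (h.skip_mul_tmul_append₂ _) hf hp, onTail_onTail_comp]

end RightExtension

/-! ### Part (i): the induced right coaction. -/

section InducedRight

variable {k : Type*} {G : Type*} [Field k] [Ring G] [Algebra k G] [QuasiBialgebra k G]
variable {A B : Type*} [Ring A] [Algebra k A] [Ring B] [Algebra k B]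
variable {ρ : RightCoaction k G A} {P : QuasiCommutingPair k G B}

/-- Here only `φ_λρ` is inverted. The factor `φ_ρ` stays as it is, since it plays the intertwiner
`u` in the proof of quasi-coassociativity. -/
lemma mixed_pentagon_right_inv :
    splitHead P.left.coact (P.right.reassoc : B ⊗[k] (G ⊗[k] G)) *
        append₃ (↑(P.mixed⁻¹) : G ⊗[k] (B ⊗[k] G)) *
        onTail (splitHead P.right.coact) (↑(P.mixed⁻¹) : G ⊗[k] (B ⊗[k] G)) =
      onTail (onTail comul) (↑(P.mixed⁻¹) : G ⊗[k] (B ⊗[k] G)) *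
        (1 : G) ⊗ₜ[k] (P.right.reassoc : B ⊗[k] (G ⊗[k] G)) :=
  mul_inv_mul_inv_of_mul_mul_eq P.pentagon_right (map_unit_mul_inv _ _) (map_unit_mul_inv _ _)
    (map_unit_inv_mul _ _)

lemma commute_map_inclRight {E : Type*} [Ring E] [Algebra k E] (a : A) (w : B ⊗[k] E) :
    Commute (inclLeft ρ P.left a ⊗ₜ[k] (1 : E))
      (Algebra.TensorProduct.map (inclRight ρ P.left) (.id k E) w) := by
  change _ * _ = _ * _
  induction w with
  | zero => rw [map_zero, zero_mul, mul_zero]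
  | add x y hx hy => rw [map_add, add_mul, mul_add, hx, hy]
  | tmul y e =>
    simp only [Algebra.TensorProduct.map_tmul, Algebra.TensorProduct.tmul_mul_tmul, one_mul,
      mul_one, (commute_incl ρ P.left a y).eq]

lemma map_incl_assoc_symm (a : A) (w : B ⊗[k] G) :
    Algebra.TensorProduct.map (incl ρ P.left) (.id k G)
        ((Algebra.TensorProduct.assoc k k k A B G).symm (a ⊗ₜ w)) =
      inclLeft ρ P.left a ⊗ₜ[k] (1 : G) *
        Algebra.TensorProduct.map (inclRight ρ P.left) (.id k G) w := by
  induction w with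
  | zero => rw [TensorProduct.tmul_zero, map_zero, map_zero, map_zero, mul_zero]
  | add x y hx hy =>
    rw [TensorProduct.tmul_add, map_add, map_add, map_add, mul_add, hx, hy]
  | tmul b x =>
    simp only [Algebra.TensorProduct.assoc_symm_tmul, Algebra.TensorProduct.map_tmul,
      Algebra.TensorProduct.tmul_mul_tmul, one_mul, AlgHom.comp_apply, ← map_mul,
      Algebra.TensorProduct.includeLeft_apply, Algebra.TensorProduct.includeRight_apply, mul_one]

lemma incl_eq_mul (ρ : RightCoaction k G A) (l : LeftCoaction k G B) (a : A) (b : B) :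
    incl ρ l (a ⊗ₜ b) = inclLeft ρ l a * inclRight ρ l b := by
  simp only [AlgHom.comp_apply, ← map_mul, Algebra.TensorProduct.includeLeft_apply,
    Algebra.TensorProduct.includeRight_apply, Algebra.TensorProduct.tmul_mul_tmul, one_mul,
    mul_one]

variable [FiniteDimensional k G]

variable (ρ P) in
/-- The algebra map `A ⋊ Ĝ ⋉ B → (A ⋊ Ĝ ⋉ B) ⊗ G` underlying the induced right coaction. -/
noncomputable def inducedRightMap :
    TwoSidedCrossedProduct ρ P.left →ₐ[k] TwoSidedCrossedProduct ρ P.left ⊗[k] G :=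
  (intertwines_intertwiner ρ P.left).rightExtension.lift

lemma inducedRightMap_inclLeft (a : A) :
    inducedRightMap ρ P (inclLeft ρ P.left a) = inclLeft ρ P.left a ⊗ₜ[k] (1 : G) :=
  (intertwines_intertwiner ρ P.left).rightExtension.lift_inclLeft a

lemma inducedRightMap_inclRight (b : B) :
    inducedRightMap ρ P (inclRight ρ P.left b) =
      Algebra.TensorProduct.map (inclRight ρ P.left) (.id k G) (P.right.coact b) :=
  (intertwines_intertwiner ρ P.left).rightExtension.lift_inclRight b

lemma onTail_inducedRightMap :
    onTail (inducedRightMap ρ P) (intertwiner ρ P.left) =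
      append₂ (intertwiner ρ P.left) *
        onTail (Algebra.TensorProduct.map (inclRight ρ P.left) (.id k G))
          (↑(P.mixed⁻¹) : G ⊗[k] (B ⊗[k] G)) :=
  (intertwines_intertwiner ρ P.left).rightExtension.onTail_lift

lemma mul_mul_eq_of_shift_left {R : Type*} [Monoid R] {u g s a o d : R} (hu : u * g = g * s)
    (hp : s * a * o = d * u) : u * (g * a * o) = g * d * u := by
  calc u * (g * a * o) = u * g * a * o := by simp only [mul_assoc]
    _ = g * (s * a * o) := by rw [hu]; simp only [mul_assoc]
    _ = _ := by rw [hp, mul_assoc]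

-- The two iterated coactions are algebra maps, so generators suffice. On `A` both are `a ⊗ 1 ⊗ 1`,
-- which commutes with `φ_ρ`; on `B` this is the axiom for `ρ_B`. On `Γ`, moving `φ_ρ` past `Γ`
-- turns it into `(λ ⊗ id ⊗ id)(φ_ρ)`, and `mixed_pentagon_right_inv` moves it past the two copies
-- of `φ_λρ⁻¹`.
variable (ρ P) in
lemma inducedRight_quasi_coassoc (m : TwoSidedCrossedProduct ρ P.left) :
    Algebra.TensorProduct.map (inclRight ρ P.left) (.id k (G ⊗[k] G))
        (P.right.reassoc : B ⊗[k] (G ⊗[k] G)) *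
        splitHead (inducedRightMap ρ P) (inducedRightMap ρ P m) =
      onTail comul (inducedRightMap ρ P m) *
        Algebra.TensorProduct.map (inclRight ρ P.left) (.id k (G ⊗[k] G))
          (P.right.reassoc : B ⊗[k] (G ⊗[k] G)) := by
  refine intertwining_of_generators
    ((splitHead (inducedRightMap ρ P)).comp (inducedRightMap ρ P))
    ((onTail comul).comp (inducedRightMap ρ P)) _ (fun a => ?_) (fun b => ?_) ?_ m
  · have e1 : splitHead (inducedRightMap ρ P) (inclLeft ρ P.left a ⊗ₜ[k] (1 : G)) =
        inclLeft ρ P.left a ⊗ₜ[k] (1 : G ⊗[k] G) := by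
      rw [splitHead_tmul, inducedRightMap_inclLeft]
      rfl
    change _ * splitHead (inducedRightMap ρ P) (inducedRightMap ρ P (inclLeft ρ P.left a)) =
      onTail comul (inducedRightMap ρ P (inclLeft ρ P.left a)) * _
    rw [inducedRightMap_inclLeft, e1,
      Algebra.TensorProduct.map_tmul, map_one]
    exact (commute_map_inclRight a _).eq.symm
  · change _ * splitHead (inducedRightMap ρ P) (inducedRightMap ρ P (inclRight ρ P.left b)) =
      onTail comul (inducedRightMap ρ P (inclRight ρ P.left b)) * _
    rw [inducedRightMap_inclRight,
      splitHead_map _ P.right.coact _ _ inducedRightMap_inclRight, onTail_map, ← map_mul,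
      ← map_mul, P.right.quasi_coassoc]
  · have e1 : ∀ w : G ⊗[k] (B ⊗[k] G), append₃ (D := G)
        (onTail (Algebra.TensorProduct.map (inclRight ρ P.left) (.id k G)) w) =
        onTail (Algebra.TensorProduct.map (inclRight ρ P.left) (.id k (G ⊗[k] G)))
          (append₃ w) :=
      fun w => onTail_square (fun v => onTail_map _ _ v) w
    have e2 : ∀ w : G ⊗[k] (B ⊗[k] G), onTail (splitHead (inducedRightMap ρ P))
        (onTail (Algebra.TensorProduct.map (inclRight ρ P.left) (.id k G)) w) =
        onTail (Algebra.TensorProduct.map (inclRight ρ P.left) (.id k (G ⊗[k] G)))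
          (onTail (splitHead P.right.coact) w) :=
      fun w => onTail_square
        (fun v => splitHead_map _ P.right.coact _ _ inducedRightMap_inclRight v) w
    have e3 : ∀ w : G ⊗[k] (B ⊗[k] G), onTail (onTail comul)
        (onTail (Algebra.TensorProduct.map (inclRight ρ P.left) (.id k G)) w) =
        onTail (Algebra.TensorProduct.map (inclRight ρ P.left) (.id k (G ⊗[k] G)))
          (onTail (onTail comul) w) :=
      fun w => onTail_square (fun v => onTail_map _ _ v) w
    have hp := congrArg (onTail (Algebra.TensorProduct.map (inclRight ρ P.left)
      (.id k (G ⊗[k] G)))) (mixed_pentagon_right_inv (P := P))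
    rw [map_mul, map_mul, map_mul] at hp
    rw [onTail_comp, onTail_comp, onTail_inducedRightMap, map_mul, map_mul,
      onTail_splitHead_append, onTail_inducedRightMap, map_mul, e1, e2, e3, append₃_append,
      onTail_onTail_append]
    exact mul_mul_eq_of_shift_left ((intertwines_intertwiner ρ P.left).tmul_map_mul_append₂
      (P.right.reassoc : B ⊗[k] (G ⊗[k] G))) hp

/-- On `Γ` this needs `(id ⊗ id ⊗ ε)(φ_λρ⁻¹) = 1`, which comes from `evalTail_mixed`. -/
lemma inducedRight_counit (m : TwoSidedCrossedProduct ρ P.left) :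
    evalTail counit (inducedRightMap ρ P m) = m := by
  have h : (evalTail counit).comp (inducedRightMap ρ P) = .id k _ := by
    refine crossedProduct_hom_ext (fun a => ?_) (fun b => ?_) ?_
    · rw [AlgHom.comp_apply, inducedRightMap_inclLeft, evalTail_tmul, map_one, one_smul]
      rfl
    · rw [AlgHom.comp_apply, inducedRightMap_inclRight, evalTail_map, P.right.counit_coact]
      rfl
    · rw [onTail_comp, onTail_inducedRightMap, map_mul, onTail_evalTail_append,
        onTail_square (fun v => evalTail_map _ _ v), inv_counit _ _ P.evalTail_mixed, map_one,
        mul_one, onTail_id (fun b => rfl)]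
  exact DFunLike.congr_fun h m

-- All terms are images of the corresponding terms for `B`, because the coaction extends `ρ_B`; the
-- pentagon is therefore the image of that of `B`.
variable (ρ P) in
lemma inducedRight_pentagon :
    (1 : TwoSidedCrossedProduct ρ P.left) ⊗ₜ[k] (QuasiBialgebra.reassoc (k := k) (G := G)).val *
        onTail (splitHead comul) (Algebra.TensorProduct.map (inclRight ρ P.left)
          (.id k (G ⊗[k] G)) (P.right.reassoc : B ⊗[k] (G ⊗[k] G))) *
        append₃ (Algebra.TensorProduct.map (inclRight ρ P.left)
          (.id k (G ⊗[k] G)) (P.right.reassoc : B ⊗[k] (G ⊗[k] G))) =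
      onTail (onTail comul) (Algebra.TensorProduct.map (inclRight ρ P.left)
          (.id k (G ⊗[k] G)) (P.right.reassoc : B ⊗[k] (G ⊗[k] G))) *
        splitHead (inducedRightMap ρ P) (Algebra.TensorProduct.map (inclRight ρ P.left)
          (.id k (G ⊗[k] G)) (P.right.reassoc : B ⊗[k] (G ⊗[k] G))) := by
  have h := congrArg (Algebra.TensorProduct.map (inclRight ρ P.left)
    (.id k (G ⊗[k] (G ⊗[k] G)))) P.right.pentagon
  rw [map_mul, map_mul, map_mul, Algebra.TensorProduct.map_tmul, map_one, append₃,
    ← onTail_map, ← onTail_map, ← onTail_map,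
    ← splitHead_map _ P.right.coact _ _ inducedRightMap_inclRight] at h
  exact h

variable (ρ P) in
/-- The right coaction on `A ⋊ Ĝ ⋉ B` induced by the right coaction on `B`. -/
noncomputable def inducedRight : RightCoaction k G (TwoSidedCrossedProduct ρ P.left) where
  coact := inducedRightMap ρ P
  reassoc := Units.map (Algebra.TensorProduct.map (inclRight ρ P.left)
    (.id k (G ⊗[k] G))).toMonoidHom P.right.reassoc
  quasi_coassoc := inducedRight_quasi_coassoc ρ P
  pentagon := inducedRight_pentagon ρ P
  counit_coact := inducedRight_counit
  counit_mid := by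
    change onTail (evalHead counit) (Algebra.TensorProduct.map (inclRight ρ P.left)
      (.id k (G ⊗[k] G)) (P.right.reassoc : B ⊗[k] (G ⊗[k] G))) = 1
    rw [onTail_map, P.right.counit_mid, map_one]
  counit_tail := by
    change onTail (evalTail counit) (Algebra.TensorProduct.map (inclRight ρ P.left)
      (.id k (G ⊗[k] G)) (P.right.reassoc : B ⊗[k] (G ⊗[k] G))) = 1
    rw [onTail_map, P.right.counit_tail, map_one]

variable (ρ P) in
lemma isInducedRight_inducedRight : IsInducedRight ρ P (inducedRight ρ P) where
  reassoc_eq := rfl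
  coact_incl a b := by
    rw [map_incl_assoc_symm, incl_eq_mul, map_mul]
    exact congrArg₂ _ (inducedRightMap_inclLeft a) (inducedRightMap_inclRight b)
  coact_intertwiner := onTail_inducedRightMap

lemma IsInducedRight.coact_inclLeft {ρt : RightCoaction k G (TwoSidedCrossedProduct ρ P.left)}
    (h : IsInducedRight ρ P ρt) (a : A) :
    ρt.coact (inclLeft ρ P.left a) = inclLeft ρ P.left a ⊗ₜ[k] (1 : G) := by
  have := h.coact_incl a 1
  rw [map_incl_assoc_symm, map_one, map_one, mul_one] at this
  exact this

lemma IsInducedRight.coact_inclRight {ρt : RightCoaction k G (TwoSidedCrossedProduct ρ P.left)}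
    (h : IsInducedRight ρ P ρt) (b : B) :
    ρt.coact (inclRight ρ P.left b) =
      Algebra.TensorProduct.map (inclRight ρ P.left) (.id k G) (P.right.coact b) := by
  have := h.coact_incl 1 b
  rw [map_incl_assoc_symm, map_one, ← Algebra.TensorProduct.one_def, one_mul] at this
  exact this

/-- The formulas prescribe the algebra map on `A`, `B` and `Γ`, and also the reassociator. -/
lemma IsInducedRight.unique {ρt ρt' : RightCoaction k G (TwoSidedCrossedProduct ρ P.left)}
    (h : IsInducedRight ρ P ρt) (h' : IsInducedRight ρ P ρt') : ρt = ρt' := by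
  refine RightCoaction.ext (crossedProduct_hom_ext (fun a => ?_) (fun b => ?_) ?_)
    (Units.ext (h.reassoc_eq.trans h'.reassoc_eq.symm))
  · rw [h.coact_inclLeft, h'.coact_inclLeft]
  · rw [h.coact_inclRight, h'.coact_inclRight]
  · rw [h.coact_intertwiner, h'.coact_intertwiner]

end InducedRight

/-! ### Permutations that bring the module algebra to the last leg. -/

section Permutations

variable {k : Type*} [Field k]
variable {A B C D E F : Type*} [Ring A] [Algebra k A] [Ring B] [Algebra k B]
  [Ring C] [Algebra k C] [Ring D] [Algebra k D] [Ring E] [Algebra k E] [Ring F] [Algebra k F]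

/-- `x ⊗ y ⊗ z ↦ y ⊗ x ⊗ z`. -/
noncomputable def swap : A ⊗[k] (B ⊗[k] C) →ₐ[k] B ⊗[k] (A ⊗[k] C) :=
  (onTail flip).comp rotate

@[simp] lemma swap_tmul (a : A) (b : B) (c : C) :
    swap (a ⊗ₜ[k] (b ⊗ₜ[k] c)) = b ⊗ₜ[k] (a ⊗ₜ[k] c) := rfl

/-- `x ⊗ y ⊗ z ⊗ w ↦ w ⊗ x ⊗ y ⊗ z`. -/
noncomputable def cycle₄ : A ⊗[k] (B ⊗[k] (C ⊗[k] D)) →ₐ[k] D ⊗[k] (A ⊗[k] (B ⊗[k] C)) :=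
  cycle.comp (onTail (Algebra.TensorProduct.assoc k k k B C D).symm.toAlgHom)

@[simp] lemma cycle₄_tmul (a : A) (b : B) (c : C) (d : D) :
    cycle₄ (a ⊗ₜ[k] (b ⊗ₜ[k] (c ⊗ₜ[k] d))) = d ⊗ₜ[k] (a ⊗ₜ[k] (b ⊗ₜ[k] c)) := rfl

/-- `x ⊗ y ⊗ z ⊗ w ↦ z ⊗ w ⊗ x ⊗ y`. -/
noncomputable def halfTurn : A ⊗[k] (B ⊗[k] (C ⊗[k] D)) →ₐ[k] C ⊗[k] (D ⊗[k] (A ⊗[k] B)) :=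
  rotate.comp (Algebra.TensorProduct.assoc k k k A B (C ⊗[k] D)).symm.toAlgHom

@[simp] lemma halfTurn_tmul (a : A) (b : B) (c : C) (d : D) :
    halfTurn (a ⊗ₜ[k] (b ⊗ₜ[k] (c ⊗ₜ[k] d))) = c ⊗ₜ[k] (d ⊗ₜ[k] (a ⊗ₜ[k] b)) := rfl

lemma tensor_induction₃ {p : A ⊗[k] (B ⊗[k] C) → Prop} (w : A ⊗[k] (B ⊗[k] C)) (zero : p 0)
    (add : ∀ x y, p x → p y → p (x + y)) (tmul : ∀ a b c, p (a ⊗ₜ (b ⊗ₜ c))) : p w := by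
  refine TensorProduct.induction_on w zero (fun a z => ?_) add
  refine TensorProduct.induction_on z ?_ (fun f b => tmul a f b) (fun z z' h h' => ?_)
  · rw [TensorProduct.tmul_zero]; exact zero
  · rw [TensorProduct.tmul_add]; exact add _ _ h h'

lemma cycle_assoc (w : A ⊗[k] B) (c : C) :
    cycle (Algebra.TensorProduct.assoc k k k A B C (w ⊗ₜ[k] c)) = c ⊗ₜ[k] w := by
  induction w with
  | zero => simp only [map_zero, TensorProduct.zero_tmul, TensorProduct.tmul_zero]
  | add x y hx hy => simp only [map_add, TensorProduct.add_tmul, TensorProduct.tmul_add, hx, hy]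
  | tmul x y => rfl

lemma flip_map_comp (α : C →ₐ[k] D) (f : A →ₐ[k] E ⊗[k] C) (w : A ⊗[k] B) :
    flip (Algebra.TensorProduct.map ((onTail α).comp f) (.id k B) w) =
      onTail (onTail α) (cycle (splitHead f w)) := by
  induction w with
  | zero => simp only [map_zero]
  | add x y hx hy => simp only [map_add, hx, hy]
  | tmul x y =>
    rw [splitHead_tmul, cycle_assoc]
    rfl

lemma halfTurn_append₃ (w : A ⊗[k] (B ⊗[k] C)) :
    halfTurn (append₃ (D := D) w) = skip (cycle w) := by
  induction w using tensor_induction₃ with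
  | zero => simp only [map_zero]
  | add x y hx hy => simp only [map_add, hx, hy]
  | tmul x y z => simp

/-- By definition `halfTurn` undoes the bracketing and then applies `rotate`, so it cancels the
re-bracketing inside `splitHead`. -/
lemma halfTurn_splitHead (f : A →ₐ[k] E ⊗[k] F) (w : A ⊗[k] (B ⊗[k] C)) :
    halfTurn (splitHead f w) = rotate (Algebra.TensorProduct.map f (.id k (B ⊗[k] C)) w) := by
  have h : ∀ v : (E ⊗[k] F) ⊗[k] (B ⊗[k] C),
      halfTurn (Algebra.TensorProduct.assoc k k k E F (B ⊗[k] C) v) = rotate v := fun v =>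
    congrArg rotate ((Algebra.TensorProduct.assoc k k k E F (B ⊗[k] C)).symm_apply_apply v)
  exact h _

lemma halfTurn_one_tmul (w : B ⊗[k] (C ⊗[k] D)) :
    halfTurn ((1 : A) ⊗ₜ[k] w) = onTail skip (rotate w) := by
  induction w using tensor_induction₃ with
  | zero => simp only [map_zero, TensorProduct.tmul_zero]
  | add x y hx hy => simp only [map_add, TensorProduct.tmul_add, hx, hy]
  | tmul x y z => simp

lemma halfTurn_onTail_splitHead (f : B →ₐ[k] E ⊗[k] F) (w : A ⊗[k] (B ⊗[k] C)) :
    halfTurn (onTail (splitHead f) w) = cycle₄ (onTail (onTail f) (cycle w)) := by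
  induction w using tensor_induction₃ with
  | zero => simp only [map_zero]
  | add x y hx hy => simp only [map_add, hx, hy]
  | tmul x y z =>
    simp only [Algebra.TensorProduct.map_tmul, cycle_tmul, splitHead_tmul, AlgHom.coe_id, id]
    induction f y with
    | zero => simp only [map_zero, TensorProduct.zero_tmul, TensorProduct.tmul_zero]
    | add x y hx hy => simp only [map_add, TensorProduct.add_tmul, TensorProduct.tmul_add, hx, hy]
    | tmul x y => rfl

lemma halfTurn_onTail_onTail (f : C →ₐ[k] E ⊗[k] F) (w : A ⊗[k] (B ⊗[k] C)) :
    halfTurn (onTail (onTail f) w) = splitHead f (cycle w) := by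
  induction w using tensor_induction₃ with
  | zero => simp only [map_zero]
  | add x y hx hy => simp only [map_add, hx, hy]
  | tmul x y z =>
    simp only [Algebra.TensorProduct.map_tmul, cycle_tmul, splitHead_tmul, AlgHom.coe_id, id]
    induction f z with
    | zero => simp only [map_zero, TensorProduct.zero_tmul, TensorProduct.tmul_zero]
    | add x y hx hy => simp only [map_add, TensorProduct.add_tmul, TensorProduct.tmul_add, hx, hy]
    | tmul x y => rfl

lemma cycle₄_append₃ (w : A ⊗[k] (B ⊗[k] C)) :
    cycle₄ (append₃ w) = (1 : D) ⊗ₜ[k] w := by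
  induction w using tensor_induction₃ with
  | zero => simp only [map_zero, TensorProduct.tmul_zero]
  | add x y hx hy => simp only [map_add, TensorProduct.tmul_add, hx, hy]
  | tmul x y z => simp

lemma cycle₄_splitHead (f : A →ₐ[k] E ⊗[k] F) (w : A ⊗[k] (B ⊗[k] C)) :
    cycle₄ (splitHead f w) = onTail (splitHead f) (cycle w) := by
  induction w using tensor_induction₃ with
  | zero => simp only [map_zero]
  | add x y hx hy => simp only [map_add, hx, hy]
  | tmul x y z =>
    simp only [Algebra.TensorProduct.map_tmul, cycle_tmul, splitHead_tmul, AlgHom.coe_id, id]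
    induction f x with
    | zero => simp only [map_zero, TensorProduct.zero_tmul, TensorProduct.tmul_zero]
    | add x y hx hy => simp only [map_add, TensorProduct.add_tmul, TensorProduct.tmul_add, hx, hy]
    | tmul x y => rfl

lemma cycle₄_onTail_splitHead (f : B →ₐ[k] E ⊗[k] F) (w : A ⊗[k] (B ⊗[k] C)) :
    cycle₄ (onTail (splitHead f) w) = onTail (onTail f) (cycle w) := by
  induction w using tensor_induction₃ with
  | zero => simp only [map_zero]
  | add x y hx hy => simp only [map_add, hx, hy]
  | tmul x y z =>
    simp only [Algebra.TensorProduct.map_tmul, cycle_tmul, splitHead_tmul, AlgHom.coe_id, id]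
    induction f y with
    | zero => simp only [map_zero, TensorProduct.zero_tmul, TensorProduct.tmul_zero]
    | add x y hx hy => simp only [map_add, TensorProduct.add_tmul, TensorProduct.tmul_add, hx, hy]
    | tmul x y => rfl

lemma cycle₄_one_tmul (w : B ⊗[k] (C ⊗[k] D)) :
    cycle₄ ((1 : A) ⊗ₜ[k] w) = skip (cycle w) := by
  induction w using tensor_induction₃ with
  | zero => simp only [map_zero, TensorProduct.tmul_zero]
  | add x y hx hy => simp only [map_add, TensorProduct.tmul_add, hx, hy]
  | tmul x y z => simp

lemma evalHead_cycle (ε : C →ₐ[k] k) (w : A ⊗[k] (B ⊗[k] C)) :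
    evalHead ε (cycle w) = onTail (evalTail ε) w := by
  induction w using tensor_induction₃ with
  | zero => simp only [map_zero]
  | add x y hx hy => simp only [map_add, hx, hy]
  | tmul x y z => simp

lemma onTail_evalHead_cycle (ε : A →ₐ[k] k) (w : A ⊗[k] (B ⊗[k] C)) :
    onTail (evalHead ε) (cycle w) = flip (evalHead ε w) := by
  induction w using tensor_induction₃ with
  | zero => simp only [map_zero]
  | add x y hx hy => simp only [map_add, hx, hy]
  | tmul x y z => simp

lemma rotate_map_comp (α : D →ₐ[k] F) (f : A →ₐ[k] E ⊗[k] D) (w : A ⊗[k] (B ⊗[k] C)) :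
    rotate (Algebra.TensorProduct.map ((onTail α).comp f) (.id k (B ⊗[k] C)) w) =
      onTail (onTail (onTail α))
        (rotate (Algebra.TensorProduct.map f (.id k (B ⊗[k] C)) w)) := by
  induction w using tensor_induction₃ with
  | zero => simp only [map_zero]
  | add x y hx hy => simp only [map_add, hx, hy]
  | tmul x y z => rfl

lemma onTail_rotate_map (α : A →ₐ[k] D) (g : D →ₐ[k] E) (g' : A →ₐ[k] F) (α' : F →ₐ[k] E)
    (h : ∀ a, g (α a) = α' (g' a)) (w : A ⊗[k] (B ⊗[k] C)) :
    onTail (onTail g) (rotate (Algebra.TensorProduct.map α (.id k (B ⊗[k] C)) w)) =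
      onTail (onTail α') (onTail (onTail g') (rotate w)) := by
  induction w using tensor_induction₃ with
  | zero => simp only [map_zero]
  | add x y hx hy => simp only [map_add, hx, hy]
  | tmul x y z =>
    simp only [Algebra.TensorProduct.map_tmul, AlgHom.coe_id, id, rotate_tmul, h]

lemma commute_one_tmul_onTail {α : A →ₐ[k] D} {β : B →ₐ[k] D} (h : ∀ a b, Commute (α a) (β b))
    (b : B) (w : C ⊗[k] (E ⊗[k] A)) :
    Commute ((1 : C) ⊗ₜ[k] ((1 : E) ⊗ₜ[k] β b)) (onTail (onTail α) w) := by
  change _ * _ = _ * _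
  induction w using tensor_induction₃ with
  | zero => rw [map_zero, zero_mul, mul_zero]
  | add x y hx hy => rw [map_add, add_mul, mul_add, hx, hy]
  | tmul x y z =>
    simp only [Algebra.TensorProduct.map_tmul, Algebra.TensorProduct.tmul_mul_tmul, one_mul,
      mul_one, (h z b).eq]

lemma skip_skip_eq (w : A ⊗[k] D) :
    skip (B := B) (skip (B := C) w) = onTail skip (skip w) := by
  induction w with
  | zero => simp only [map_zero]
  | add x y hx hy => simp only [map_add, hx, hy]
  | tmul x y => simp

lemma swap_one_tmul_skip (w : A ⊗[k] D) :
    swap ((1 : B) ⊗ₜ[k] (skip (B := C) w)) = skip (skip w) := by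
  induction w with
  | zero => simp only [map_zero, TensorProduct.tmul_zero]
  | add x y hx hy => simp only [map_add, TensorProduct.tmul_add, hx, hy]
  | tmul x y => simp

lemma swap_tmul_cycle (α : B →ₐ[k] F) (x : E) (w : A ⊗[k] (B ⊗[k] C)) :
    swap (x ⊗ₜ[k] onTail (onTail α) (cycle w)) =
      onTail (onTail (onTail α)) (cycle₄ (x ⊗ₜ[k] w)) := by
  induction w using tensor_induction₃ with
  | zero => simp only [map_zero, TensorProduct.tmul_zero]
  | add x y hx hy => simp only [map_add, TensorProduct.tmul_add, hx, hy]
  | tmul x y z => rfl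

end Permutations

/-! ### The triple defining the induced left coaction. -/

section LeftExtension

variable {k : Type*} {G : Type*} [Field k] [Ring G] [Algebra k G] [QuasiBialgebra k G]
variable {B C N E E' : Type*} [Ring B] [Algebra k B] [Ring C] [Algebra k C] [Ring N] [Algebra k N]
  [Ring E] [Algebra k E] [Ring E'] [Algebra k E']

/-- The relation `right` with a spectator leg `E` in the middle, which commutes with `Γ¹³`. It is
the mirror of `Intertwines.tmul_map_mul_append₂`. -/
lemma Intertwines.skip_mul_one_tmul {ρ : RightCoaction k G B} {l : LeftCoaction k G C}
    {α : B →ₐ[k] N} {β : C →ₐ[k] N} {Γ : G ⊗[k] N} (h : Intertwines ρ l α β Γ) (w : E ⊗[k] B) :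
    skip Γ * (1 : G) ⊗ₜ[k] onTail α w =
      onTail (onTail α) (cycle (onTail ρ.coact w)) * skip Γ := by
  induction w with
  | zero => simp only [map_zero, TensorProduct.tmul_zero, zero_mul, mul_zero]
  | add x y hx hy => simp only [map_add, TensorProduct.tmul_add, add_mul, mul_add, hx, hy]
  | tmul e b =>
    have h1 : (1 : G) ⊗ₜ[k] onTail α (e ⊗ₜ[k] b) =
        skip ((1 : G) ⊗ₜ[k] α b) * (1 : G) ⊗ₜ[k] (e ⊗ₜ[k] (1 : N)) := by
      simp
    have h2 : ∀ v : B ⊗[k] G, onTail (onTail α) (cycle (e ⊗ₜ[k] v)) =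
        (1 : G) ⊗ₜ[k] (e ⊗ₜ[k] (1 : N)) *
          skip (flip (Algebra.TensorProduct.map α (.id k G) v)) := by
      intro v
      induction v with
      | zero => simp only [map_zero, TensorProduct.tmul_zero, mul_zero]
      | add x y hx hy => simp only [map_add, TensorProduct.tmul_add, mul_add, hx, hy]
      | tmul x y => simp
    have h3 : ∀ v : G ⊗[k] N, skip v * (1 : G) ⊗ₜ[k] (e ⊗ₜ[k] (1 : N)) =
        (1 : G) ⊗ₜ[k] (e ⊗ₜ[k] (1 : N)) * skip v := by
      intro v
      induction v with
      | zero => simp only [map_zero, zero_mul, mul_zero]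
      | add x y hx hy => simp only [map_add, add_mul, mul_add, hx, hy]
      | tmul x y => simp
    rw [h1, ← mul_assoc, ← map_mul, h.right, h3, map_mul, ← mul_assoc, ← h2]
    rfl

lemma Intertwines.skip_skip_mul_one_tmul {ρ : RightCoaction k G B} {l : LeftCoaction k G C}
    {α : B →ₐ[k] N} {β : C →ₐ[k] N} {Γ : G ⊗[k] N} (h : Intertwines ρ l α β Γ)
    (w : E ⊗[k] (E' ⊗[k] B)) :
    skip (skip Γ) * (1 : G) ⊗ₜ[k] onTail (onTail α) w =
      onTail (onTail (onTail α)) (cycle₄ (onTail (onTail ρ.coact) w)) * skip (skip Γ) := by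
  induction w with
  | zero => simp only [map_zero, TensorProduct.tmul_zero, zero_mul, mul_zero]
  | add x y hx hy => simp only [map_add, TensorProduct.tmul_add, add_mul, mul_add, hx, hy]
  | tmul x w =>
    -- The second spectator is tensored on in front and then swapped behind the `G` leg of `Γ`.
    have hs := congrArg (fun v => swap (x ⊗ₜ[k] v)) (h.skip_mul_one_tmul w)
    have h1 : ∀ u v : G ⊗[k] (E' ⊗[k] N), x ⊗ₜ[k] (u * v) = (1 : E) ⊗ₜ[k] u * x ⊗ₜ[k] v := by
      intro u v
      rw [Algebra.TensorProduct.tmul_mul_tmul, one_mul]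
    have h2 : ∀ u v : G ⊗[k] (E' ⊗[k] N), x ⊗ₜ[k] (u * v) = x ⊗ₜ[k] u * (1 : E) ⊗ₜ[k] v := by
      intro u v
      rw [Algebra.TensorProduct.tmul_mul_tmul, mul_one]
    rw [h1, h2, map_mul, map_mul, swap_one_tmul_skip, swap_tmul_cycle] at hs
    exact hs

variable {P : QuasiCommutingPair k G B} {l : LeftCoaction k G C}

lemma mixed_pentagon_right_inv' :
    append₃ (↑(P.mixed⁻¹) : G ⊗[k] (B ⊗[k] G)) *
        onTail (splitHead P.right.coact) (↑(P.mixed⁻¹) : G ⊗[k] (B ⊗[k] G)) *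
        (1 : G) ⊗ₜ[k] (↑(P.right.reassoc⁻¹) : B ⊗[k] (G ⊗[k] G)) =
      splitHead P.left.coact (↑(P.right.reassoc⁻¹) : B ⊗[k] (G ⊗[k] G)) *
        onTail (onTail comul) (↑(P.mixed⁻¹) : G ⊗[k] (B ⊗[k] G)) := by
  have h := congrArg Units.val (congrArg Inv.inv (Units.ext (u :=
      Units.map (Algebra.TensorProduct.includeRight :
        B ⊗[k] (G ⊗[k] G) →ₐ[k] G ⊗[k] (B ⊗[k] (G ⊗[k] G))).toMonoidHom P.right.reassoc *
      Units.map (onTail (splitHead P.right.coact)).toMonoidHom P.mixed *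
      Units.map (append₃ (D := G)).toMonoidHom P.mixed)
    (v := Units.map (onTail (onTail comul)).toMonoidHom P.mixed *
      Units.map (splitHead P.left.coact).toMonoidHom P.right.reassoc) P.pentagon_right))
  rw [mul_inv_rev, mul_inv_rev, mul_inv_rev, ← mul_assoc] at h
  exact h

/-- The inverted pentagon has its legs in the order `G, B, G, G`. A half turn produces `G, G, G, B`,
the order in which the fusion relation in `G ⊗ G ⊗ (G ⊗ N)` is written. -/
lemma cycle_mixed_pentagon :
    skip (cycle (↑(P.mixed⁻¹) : G ⊗[k] (B ⊗[k] G))) *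
        cycle₄ (onTail (onTail P.right.coact) (cycle (↑(P.mixed⁻¹) : G ⊗[k] (B ⊗[k] G)))) *
        onTail skip (rotate (↑(P.right.reassoc⁻¹) : B ⊗[k] (G ⊗[k] G))) =
      rotate (Algebra.TensorProduct.map P.left.coact (.id k (G ⊗[k] G))
          (↑(P.right.reassoc⁻¹) : B ⊗[k] (G ⊗[k] G))) *
        splitHead comul (cycle (↑(P.mixed⁻¹) : G ⊗[k] (B ⊗[k] G))) := by
  have h := congrArg halfTurn (mixed_pentagon_right_inv' (P := P))
  rwa [map_mul, map_mul, map_mul, halfTurn_append₃, halfTurn_onTail_splitHead,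
    halfTurn_one_tmul, halfTurn_splitHead, halfTurn_onTail_onTail] at h

lemma mul_mul_mul_eq_of_shift {R : Type*} [Monoid R] {s p c t q r d b e f : R}
    (hs : s * c = p * s) (ht : s * t = r * d * b) (hp : q * p * r = e * f) :
    q * s * (c * t) = e * (f * d) * b :=
  calc q * s * (c * t) = q * (s * c) * t := by simp only [mul_assoc]
    _ = q * p * (s * t) := by rw [hs]; simp only [mul_assoc]
    _ = q * p * r * d * b := by rw [ht]; simp only [mul_assoc]
    _ = _ := by rw [hp]; simp only [mul_assoc]

/-- The data extending `B ⋊ Ĝ ⋉ C → N` to `B ⋊ Ĝ ⋉ C → G ⊗ N`. -/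
lemma Intertwines.leftExtension {α : B →ₐ[k] N} {β : C →ₐ[k] N} {Γ : G ⊗[k] N}
    (h : Intertwines P.right l α β Γ) :
    Intertwines P.right l ((onTail α).comp P.left.coact)
      ((Algebra.TensorProduct.includeRight : N →ₐ[k] G ⊗[k] N).comp β)
      (onTail (onTail α) (cycle (↑(P.mixed⁻¹) : G ⊗[k] (B ⊗[k] G))) * skip Γ) where
  commute b c := by
    change Commute (onTail α (P.left.coact b)) ((1 : G) ⊗ₜ[k] β c)
    change _ * _ = _ * _
    induction P.left.coact b with
    | zero => rw [map_zero, zero_mul, mul_zero]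
    | add x y hx hy => rw [map_add, add_mul, mul_add, hx, hy]
    | tmul x y =>
      simp only [Algebra.TensorProduct.map_tmul, Algebra.TensorProduct.tmul_mul_tmul, one_mul,
        mul_one, (h.commute y c).eq]
  right b := by
    change _ * (1 : G) ⊗ₜ[k] onTail α (P.left.coact b) = _
    have hq : splitHead P.left.coact (P.right.coact b) * (↑(P.mixed⁻¹) : G ⊗[k] (B ⊗[k] G)) =
        (↑(P.mixed⁻¹) : G ⊗[k] (B ⊗[k] G)) * onTail P.right.coact (P.left.coact b) := by
      rw [Units.eq_inv_mul_iff_mul_eq, ← mul_assoc, P.quasi_comm, mul_assoc, Units.mul_inv,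
        mul_one]
    -- Passing `Γ¹³` applies `ρ` to the second leg of `λ(b)`, and quasi-commutativity carries the
    -- result past the cycled `φ_λρ⁻¹`.
    rw [mul_assoc, h.skip_mul_one_tmul, ← mul_assoc, ← map_mul, ← map_mul, ← hq, map_mul, map_mul,
      mul_assoc, flip_map_comp]
  left c := by
    change (1 : G) ⊗ₜ[k] ((1 : G) ⊗ₜ[k] β c) * _ = _
    have e : skip ((1 : G) ⊗ₜ[k] β c) = (1 : G) ⊗ₜ[k] ((1 : G) ⊗ₜ[k] β c) := rfl
    rw [← mul_assoc, (commute_one_tmul_onTail h.commute c _).eq, mul_assoc, ← e, ← map_mul,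
      h.left, map_mul, mul_assoc, onTail_comp]
  counit_eq := by
    rw [map_mul, evalHead_onTail, evalHead_cycle, inv_counit _ _ P.evalTail_mixed, map_one,
      one_mul, evalHead_onTail, h.counit_eq, map_one]
  fusion := by
    have e1 : (1 : G) ⊗ₜ[k] (onTail (onTail α) (cycle (↑(P.mixed⁻¹) : G ⊗[k] (B ⊗[k] G))) *
        skip Γ) = (1 : G) ⊗ₜ[k] onTail (onTail α) (cycle (↑(P.mixed⁻¹) : G ⊗[k] (B ⊗[k] G))) *
          (1 : G) ⊗ₜ[k] skip Γ := by
      rw [Algebra.TensorProduct.tmul_mul_tmul, one_mul]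
    have hf := congrArg (onTail (skip (B := G))) h.fusion
    have hp := congrArg (onTail (onTail (onTail α))) (cycle_mixed_pentagon (P := P))
    rw [map_mul, map_mul, map_mul] at hp
    rw [map_mul, map_mul, map_mul, ← skip_skip_eq, ← splitHead_onTail, ← onTail_onTail_comp,
      onTail_rotate_map α _ (Algebra.TensorProduct.includeRight) (onTail α) (fun a => by simp)]
      at hf
    rw [map_mul skip, skip_onTail, e1, map_mul (splitHead _), splitHead_onTail, rotate_map_comp]
    -- The second `φ_λρ⁻¹` is moved left past the first `Γ`, the two copies of `Γ` fuse, and the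
    -- cycled pentagon collects `φ_ρ⁻¹` with the two copies of `φ_λρ⁻¹`.
    exact mul_mul_mul_eq_of_shift (h.skip_skip_mul_one_tmul _) hf hp

end LeftExtension

section Skip

variable {k : Type*} [Field k]
variable {A B C D E F : Type*} [Ring A] [Algebra k A] [Ring B] [Algebra k B]
  [Ring C] [Algebra k C] [Ring D] [Algebra k D] [Ring E] [Algebra k E] [Ring F] [Algebra k F]

lemma onTail_splitHead_onTail (f : A →ₐ[k] C ⊗[k] D) (g : B →ₐ[k] F) (w : E ⊗[k] (A ⊗[k] B)) :
    onTail (splitHead f) (onTail (onTail g) w) =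
      onTail (onTail (onTail g)) (onTail (splitHead f) w) :=
  onTail_square (fun v => splitHead_onTail f g v) w

lemma onTail_splitHead_skip (f : A →ₐ[k] C ⊗[k] D) (w : E ⊗[k] B) :
    onTail (splitHead f) (skip w) = skip (skip w) := by
  induction w with
  | zero => simp only [map_zero]
  | add x y hx hy => simp only [map_add, hx, hy]
  | tmul x n =>
    simp only [Algebra.TensorProduct.map_tmul, AlgHom.coe_id, id,
      Algebra.TensorProduct.includeRight_apply, splitHead_tmul, map_one]
    rfl

end Skip

/-! ### Part (ii): the induced left coaction. -/

section InducedLeft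

variable {k : Type*} {G : Type*} [Field k] [Ring G] [Algebra k G] [QuasiBialgebra k G]
variable {B C : Type*} [Ring B] [Algebra k B] [Ring C] [Algebra k C]
variable {P : QuasiCommutingPair k G B} {l : LeftCoaction k G C}

lemma onTail_incl_assoc (w : G ⊗[k] B) (c : C) :
    onTail (incl P.right l) (Algebra.TensorProduct.assoc k k k G B C (w ⊗ₜ c)) =
      onTail (inclLeft P.right l) w * (1 : G) ⊗ₜ[k] inclRight P.right l c := by
  induction w with
  | zero => rw [TensorProduct.zero_tmul, map_zero, map_zero, map_zero, zero_mul]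
  | add x y hx hy =>
    rw [TensorProduct.add_tmul, map_add, map_add, map_add, add_mul, hx, hy]
  | tmul x b =>
    simp only [Algebra.TensorProduct.assoc_tmul, Algebra.TensorProduct.map_tmul,
      Algebra.TensorProduct.tmul_mul_tmul, mul_one, AlgHom.comp_apply, ← map_mul,
      Algebra.TensorProduct.includeLeft_apply, Algebra.TensorProduct.includeRight_apply, one_mul]

lemma mul_inv_eq_inv_mul_of_mul_mul_eq {R : Type*} [Monoid R] {u v w x y u' v' y' : R} (h : u * v * w = x * y)
    (hu : u' * u = 1) (hv : v' * v = 1) (hy : y * y' = 1) :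
    w * y' = v' * u' * x :=
  calc w * y' = v' * (u' * u) * v * w * y' := by rw [hu, mul_one, hv, one_mul]
    _ = v' * u' * (u * v * w) * y' := by simp only [mul_assoc]
    _ = v' * u' * x * (y * y') := by rw [h]; simp only [mul_assoc]
    _ = _ := by rw [hy, mul_one]

lemma mixed_pentagon_left_inv_eq :
    append₃ (P.left.reassoc : G ⊗[k] (G ⊗[k] B)) *
        splitHead comul (↑(P.mixed⁻¹) : G ⊗[k] (B ⊗[k] G)) =
      onTail (splitHead P.left.coact) (↑(P.mixed⁻¹) : G ⊗[k] (B ⊗[k] G)) *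
        (1 : G) ⊗ₜ[k] (↑(P.mixed⁻¹) : G ⊗[k] (B ⊗[k] G)) *
        onTail (onTail P.right.coact) (P.left.reassoc : G ⊗[k] (G ⊗[k] B)) :=
  mul_inv_eq_inv_mul_of_mul_mul_eq P.pentagon_left (map_unit_inv_mul (k := k)
      (Algebra.TensorProduct.includeRight : G ⊗[k] (B ⊗[k] G) →ₐ[k] G ⊗[k] (G ⊗[k] (B ⊗[k] G)))
      P.mixed) (map_unit_inv_mul _ _) (map_unit_mul_inv _ _)

/-- The legs `G, G, B, G` of the pentagon become `G, G, G, B` under `cycle₄`. As `φ_λ` is the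
intertwiner here, it remains uninverted. -/
lemma cycle_mixed_pentagon_left :
    (1 : G) ⊗ₜ[k] (P.left.reassoc : G ⊗[k] (G ⊗[k] B)) *
        onTail (splitHead comul) (cycle (↑(P.mixed⁻¹) : G ⊗[k] (B ⊗[k] G))) =
      onTail (onTail P.left.coact) (cycle (↑(P.mixed⁻¹) : G ⊗[k] (B ⊗[k] G))) *
        skip (cycle (↑(P.mixed⁻¹) : G ⊗[k] (B ⊗[k] G))) *
        cycle₄ (onTail (onTail P.right.coact) (P.left.reassoc : G ⊗[k] (G ⊗[k] B))) := by
  have h := congrArg cycle₄ (mixed_pentagon_left_inv_eq (P := P))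
  rwa [map_mul, map_mul, map_mul, cycle₄_append₃, cycle₄_splitHead, cycle₄_onTail_splitHead,
    cycle₄_one_tmul] at h

variable [FiniteDimensional k G]

variable (P l) in
/-- The algebra map `B ⋊ Ĝ ⋉ C → G ⊗ (B ⋊ Ĝ ⋉ C)` underlying the induced left coaction. -/
noncomputable def inducedLeftMap :
    TwoSidedCrossedProduct P.right l →ₐ[k] G ⊗[k] TwoSidedCrossedProduct P.right l :=
  (intertwines_intertwiner P.right l).leftExtension.lift

lemma inducedLeftMap_inclLeft (b : B) :
    inducedLeftMap P l (inclLeft P.right l b) = onTail (inclLeft P.right l) (P.left.coact b) :=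
  (intertwines_intertwiner P.right l).leftExtension.lift_inclLeft b

lemma inducedLeftMap_inclRight (c : C) :
    inducedLeftMap P l (inclRight P.right l c) = (1 : G) ⊗ₜ[k] inclRight P.right l c :=
  (intertwines_intertwiner P.right l).leftExtension.lift_inclRight c

lemma onTail_inducedLeftMap :
    onTail (inducedLeftMap P l) (intertwiner P.right l) =
      onTail (onTail (inclLeft P.right l)) (cycle (↑(P.mixed⁻¹) : G ⊗[k] (B ⊗[k] G))) *
        skip (intertwiner P.right l) :=
  (intertwines_intertwiner P.right l).leftExtension.onTail_lift

lemma onTail_onTail_inducedLeftMap {E : Type*} [Ring E] [Algebra k E] (w : E ⊗[k] B) :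
    onTail (inducedLeftMap P l) (onTail (inclLeft P.right l) w) =
      onTail (onTail (inclLeft P.right l)) (onTail P.left.coact w) :=
  onTail_square (fun v => inducedLeftMap_inclLeft v) w

lemma mul_mul_eq_of_shift_right {R : Type*} [Monoid R] {u d s c k' p : R} (hs : s * u = p * s)
    (hp : u * d = c * k' * p) : u * (d * s) = c * (k' * s) * u := by
  calc u * (d * s) = c * k' * (p * s) := by rw [← mul_assoc, hp, mul_assoc]
    _ = _ := by rw [← hs]; simp only [mul_assoc]

-- The mirror of the right-handed case: on `B` it is the axiom for `λ_B`, on `C` both coactions are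
-- `1 ⊗ 1 ⊗ c`, and on `Γ` it is `cycle_mixed_pentagon_left`, used after `φ_λ` has been moved past
-- `Γ` by the relation `right`.
variable (P l) in
lemma inducedLeft_quasi_coassoc (m : TwoSidedCrossedProduct P.right l) :
    onTail (inducedLeftMap P l) (inducedLeftMap P l m) *
        onTail (onTail (inclLeft P.right l)) (P.left.reassoc : G ⊗[k] (G ⊗[k] B)) =
      onTail (onTail (inclLeft P.right l)) (P.left.reassoc : G ⊗[k] (G ⊗[k] B)) *
        splitHead comul (inducedLeftMap P l m) := by
  refine (intertwining_of_generators ((splitHead comul).comp (inducedLeftMap P l))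
    ((onTail (inducedLeftMap P l)).comp (inducedLeftMap P l)) _ (fun b => ?_) (fun c => ?_) ?_
    m).symm
  · change _ * splitHead comul (inducedLeftMap P l (inclLeft P.right l b)) =
      onTail (inducedLeftMap P l) (inducedLeftMap P l (inclLeft P.right l b)) * _
    rw [inducedLeftMap_inclLeft, splitHead_onTail, onTail_onTail_inducedLeftMap, ← map_mul,
      ← map_mul, P.left.quasi_coassoc]
  · change _ * splitHead comul (inducedLeftMap P l (inclRight P.right l c)) =
      onTail (inducedLeftMap P l) (inducedLeftMap P l (inclRight P.right l c)) * _
    have e1 : splitHead comul ((1 : G) ⊗ₜ[k] inclRight P.right l c) =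
        (1 : G) ⊗ₜ[k] ((1 : G) ⊗ₜ[k] inclRight P.right l c) := by
      rw [splitHead_tmul, map_one]
      rfl
    rw [inducedLeftMap_inclRight, e1, Algebra.TensorProduct.map_tmul, map_one,
      inducedLeftMap_inclRight]
    exact (commute_one_tmul_onTail (commute_incl P.right l) c _).eq.symm
  · have e3 : ∀ w : G ⊗[k] (G ⊗[k] B), onTail (onTail (inducedLeftMap P l))
        (onTail (onTail (inclLeft P.right l)) w) =
        onTail (onTail (onTail (inclLeft P.right l))) (onTail (onTail P.left.coact) w) :=
      fun w => onTail_square (fun v => onTail_onTail_inducedLeftMap v) w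
    -- The second application of the coaction meets the factor `Γ` of the first one and so produces
    -- a second copy of `φ_λρ⁻¹`.
    have e4 : onTail (onTail (inducedLeftMap P l)) (skip (B := G) (intertwiner P.right l)) =
        onTail (onTail (onTail (inclLeft P.right l)))
          (skip (cycle (↑(P.mixed⁻¹) : G ⊗[k] (B ⊗[k] G)))) *
          skip (skip (intertwiner P.right l)) := by
      rw [← skip_onTail, onTail_inducedLeftMap, map_mul, skip_onTail]
    have hp := congrArg (onTail (onTail (onTail (inclLeft P.right l))))
      (cycle_mixed_pentagon_left (P := P))
    rw [map_mul, map_mul, map_mul] at hp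
    rw [onTail_comp, onTail_comp, onTail_inducedLeftMap, map_mul, map_mul, onTail_splitHead_skip,
      onTail_splitHead_onTail, e3, e4]
    exact mul_mul_eq_of_shift_right
      ((intertwines_intertwiner P.right l).skip_skip_mul_one_tmul
        (P.left.reassoc : G ⊗[k] (G ⊗[k] B))) hp

lemma inducedLeft_counit (m : TwoSidedCrossedProduct P.right l) :
    evalHead counit (inducedLeftMap P l m) = m := by
  have h : (evalHead counit).comp (inducedLeftMap P l) = .id k _ := by
    refine crossedProduct_hom_ext (fun b => ?_) (fun c => ?_) ?_
    · change evalHead counit (inducedLeftMap P l (inclLeft P.right l b)) = _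
      rw [inducedLeftMap_inclLeft, evalHead_onTail, P.left.counit_coact]
      rfl
    · change evalHead counit (inducedLeftMap P l (inclRight P.right l c)) = _
      rw [inducedLeftMap_inclRight, evalHead_tmul, map_one, one_smul]
      rfl
    · have e : onTail (evalHead counit) (skip (B := G) (intertwiner P.right l)) =
          intertwiner P.right l := by
        rw [← onTail_comp]
        exact onTail_id (fun v => by simp) _
      rw [onTail_comp, onTail_inducedLeftMap, map_mul,
        onTail_square (fun v => evalHead_onTail _ _ v), onTail_evalHead_cycle,
        inv_counit _ _ P.evalHead_mixed, map_one, map_one, one_mul, e, onTail_id (fun b => rfl)]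
  exact DFunLike.congr_fun h m

variable (P l) in
lemma inducedLeft_pentagon :
    (1 : G) ⊗ₜ[k] onTail (onTail (inclLeft P.right l)) (P.left.reassoc : G ⊗[k] (G ⊗[k] B)) *
        onTail (splitHead comul)
          (onTail (onTail (inclLeft P.right l)) (P.left.reassoc : G ⊗[k] (G ⊗[k] B))) *
        append₃ (QuasiBialgebra.reassoc (k := k) (G := G)).val =
      onTail (onTail (inducedLeftMap P l))
          (onTail (onTail (inclLeft P.right l)) (P.left.reassoc : G ⊗[k] (G ⊗[k] B))) *
        splitHead comul
          (onTail (onTail (inclLeft P.right l)) (P.left.reassoc : G ⊗[k] (G ⊗[k] B))) := by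
  have h := congrArg (onTail (onTail (onTail (inclLeft P.right l)))) P.left.pentagon
  have e1 : ∀ w : G ⊗[k] (G ⊗[k] G), onTail (onTail (onTail (inclLeft P.right l))) (append₃ w) =
      append₃ w := by
    intro w
    induction w using tensor_induction₃ with
    | zero => simp only [map_zero]
    | add x y hx hy => simp only [map_add, hx, hy]
    | tmul x y z =>
      simp only [append₃_tmul, Algebra.TensorProduct.map_tmul, AlgHom.coe_id, id, map_one]
  rw [map_mul, map_mul, map_mul, e1, ← splitHead_onTail,
    ← onTail_splitHead_onTail,
    onTail_square (K := onTail (inducedLeftMap P l)) (K' := onTail (inclLeft P.right l))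
      (fun v => (onTail_onTail_inducedLeftMap v).symm)] at h
  exact h

variable (P l) in
/-- The left coaction on `B ⋊ Ĝ ⋉ C` induced by the left coaction on `B`. -/
noncomputable def inducedLeft : LeftCoaction k G (TwoSidedCrossedProduct P.right l) where
  coact := inducedLeftMap P l
  reassoc := Units.map (onTail (onTail (inclLeft P.right l))).toMonoidHom P.left.reassoc
  quasi_coassoc := inducedLeft_quasi_coassoc P l
  pentagon := inducedLeft_pentagon P l
  counit_coact := inducedLeft_counit
  counit_mid := by
    change onTail (evalHead counit)
      (onTail (onTail (inclLeft P.right l)) (P.left.reassoc : G ⊗[k] (G ⊗[k] B))) = 1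
    rw [onTail_square (fun v => evalHead_onTail _ _ v), P.left.counit_mid, map_one]
  counit_head := by
    change evalHead counit
      (onTail (onTail (inclLeft P.right l)) (P.left.reassoc : G ⊗[k] (G ⊗[k] B))) = 1
    rw [evalHead_onTail, P.left.counit_head, map_one]

variable (P l) in
lemma isInducedLeft_inducedLeft : IsInducedLeft P l (inducedLeft P l) where
  reassoc_eq := rfl
  coact_incl b c := by
    rw [onTail_incl_assoc, incl_eq_mul, map_mul]
    exact congrArg₂ _ (inducedLeftMap_inclLeft b) (inducedLeftMap_inclRight c)
  coact_intertwiner := onTail_inducedLeftMap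

lemma IsInducedLeft.coact_inclLeft {lt : LeftCoaction k G (TwoSidedCrossedProduct P.right l)}
    (h : IsInducedLeft P l lt) (b : B) :
    lt.coact (inclLeft P.right l b) = onTail (inclLeft P.right l) (P.left.coact b) := by
  have := h.coact_incl b 1
  rw [onTail_incl_assoc, map_one, ← Algebra.TensorProduct.one_def, mul_one] at this
  exact this

lemma IsInducedLeft.coact_inclRight {lt : LeftCoaction k G (TwoSidedCrossedProduct P.right l)}
    (h : IsInducedLeft P l lt) (c : C) :
    lt.coact (inclRight P.right l c) = (1 : G) ⊗ₜ[k] inclRight P.right l c := by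
  have := h.coact_incl 1 c
  rw [onTail_incl_assoc, map_one, map_one, one_mul] at this
  exact this

lemma IsInducedLeft.unique {lt lt' : LeftCoaction k G (TwoSidedCrossedProduct P.right l)}
    (h : IsInducedLeft P l lt) (h' : IsInducedLeft P l lt') : lt = lt' := by
  refine LeftCoaction.ext (crossedProduct_hom_ext (fun a => ?_) (fun b => ?_) ?_)
    (Units.ext (h.reassoc_eq.trans h'.reassoc_eq.symm))
  · rw [h.coact_inclLeft, h'.coact_inclLeft]
  · rw [h.coact_inclRight, h'.coact_inclRight]
  · rw [h.coact_intertwiner, h'.coact_intertwiner]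

end InducedLeft

/-! ### Part (iii): associativity of the crossed products. -/

section Associativity

variable {k : Type*} {G : Type*} [Field k] [Ring G] [Algebra k G] [QuasiBialgebra k G]
variable {A B B' C N E : Type*} [Ring A] [Algebra k A] [Ring B] [Algebra k B] [Ring C]
  [Algebra k C] [Ring N] [Algebra k N] [Ring B'] [Algebra k B'] [Ring E] [Algebra k E]

lemma reassoc_inv_of_eq {H K : Type*} [Ring H] [Algebra k H] [Ring K] [Algebra k K]
    {u : Hˣ} {v : Kˣ} (F : H →ₐ[k] K) (h : (v : K) = F u) : (↑(v⁻¹) : K) = F ↑(u⁻¹) := by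
  have : v = Units.map F.toMonoidHom u := Units.ext h
  rw [this]
  rfl

/-- Restriction along a morphism of left comodule algebras. -/
lemma Intertwines.restrict {ρ : RightCoaction k G A} {l' : LeftCoaction k G B'}
    {α : A →ₐ[k] N} {β : B' →ₐ[k] N} {Γ : G ⊗[k] N} (h : Intertwines ρ l' α β Γ)
    {l : LeftCoaction k G B} (κ : B →ₐ[k] B')
    (hκ : ∀ b, l'.coact (κ b) = onTail κ (l.coact b))
    (hr : (l'.reassoc : G ⊗[k] (G ⊗[k] B')) =
      onTail (onTail κ) (l.reassoc : G ⊗[k] (G ⊗[k] B))) :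
    Intertwines ρ l α (β.comp κ) Γ where
  commute a b := h.commute a (κ b)
  right := h.right
  left b := by
    rw [onTail_comp, ← hκ]
    exact h.left (κ b)
  counit_eq := h.counit_eq
  fusion := by
    rw [onTail_onTail_comp, ← reassoc_inv_of_eq _ hr, h.fusion]

/-- The relation `left` with a spectator leg, stated for a tensor `w` rather than a single `b`, so
that it can be applied to `Γ_BC`. -/
lemma Intertwines.one_tmul_mul_skip {ρ : RightCoaction k G A} {l : LeftCoaction k G B}
    {α : A →ₐ[k] N} {β : B →ₐ[k] N} {Γ : G ⊗[k] N} (h : Intertwines ρ l α β Γ) (w : E ⊗[k] B) :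
    (1 : G) ⊗ₜ[k] onTail β w * skip Γ =
      skip Γ * swap (onTail (onTail β) (onTail l.coact w)) := by
  induction w with
  | zero => simp only [map_zero, TensorProduct.tmul_zero, zero_mul, mul_zero]
  | add x y hx hy => simp only [map_add, TensorProduct.tmul_add, add_mul, mul_add, hx, hy]
  | tmul e b =>
    have h1 : (1 : G) ⊗ₜ[k] onTail β (e ⊗ₜ[k] b) =
        (1 : G) ⊗ₜ[k] (e ⊗ₜ[k] (1 : N)) * skip ((1 : G) ⊗ₜ[k] β b) := by
      simp
    have h2 : ∀ v : G ⊗[k] N, swap (e ⊗ₜ[k] v) =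
        (1 : G) ⊗ₜ[k] (e ⊗ₜ[k] (1 : N)) * skip v := by
      intro v
      induction v with
      | zero => simp only [map_zero, TensorProduct.tmul_zero, mul_zero]
      | add x y hx hy => simp only [map_add, TensorProduct.tmul_add, mul_add, hx, hy]
      | tmul x y => simp
    have h3 : ∀ v : G ⊗[k] N, skip v * (1 : G) ⊗ₜ[k] (e ⊗ₜ[k] (1 : N)) =
        (1 : G) ⊗ₜ[k] (e ⊗ₜ[k] (1 : N)) * skip v := by
      intro v
      induction v with
      | zero => simp only [map_zero, zero_mul, mul_zero]
      | add x y hx hy => simp only [map_add, add_mul, mul_add, hx, hy]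
      | tmul x y => simp
    have h4 : onTail (onTail β) (onTail l.coact (e ⊗ₜ[k] b)) =
        e ⊗ₜ[k] onTail β (l.coact b) := rfl
    rw [h1, mul_assoc, ← map_mul, h.left, map_mul, ← mul_assoc, ← h3, mul_assoc, h4, h2]

lemma swap_cycle (κ : B →ₐ[k] N) (w : A ⊗[k] (B ⊗[k] C)) :
    swap (onTail (onTail κ) (cycle w)) =
      onTail flip (onTail (Algebra.TensorProduct.map κ (.id k C)) w) := by
  induction w using tensor_induction₃ with
  | zero => simp only [map_zero]
  | add x y hx hy => simp only [map_add, hx, hy]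
  | tmul x y z => rfl

lemma swap_skip (w : A ⊗[k] C) : swap (skip (B := B) w) = (1 : B) ⊗ₜ[k] w := by
  induction w with
  | zero => simp only [map_zero, TensorProduct.tmul_zero]
  | add x y hx hy => simp only [map_add, TensorProduct.tmul_add, hx, hy]
  | tmul x y => rfl

lemma onTail_flip_append₂ (f : B →ₐ[k] N) (w : A ⊗[k] B) :
    onTail flip (onTail (Algebra.TensorProduct.map f (.id k C)) (append₂ w)) =
      skip (onTail f w) := by
  induction w with
  | zero => simp only [map_zero]
  | add x y hx hy => simp only [map_add, hx, hy]
  | tmul x y => simp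

lemma map_map_id (f : B →ₐ[k] N) (g : A →ₐ[k] B) (w : A ⊗[k] C) :
    Algebra.TensorProduct.map f (.id k C) (Algebra.TensorProduct.map g (.id k C) w) =
      Algebra.TensorProduct.map (f.comp g) (.id k C) w := by
  induction w with
  | zero => simp only [map_zero]
  | add x y hx hy => simp only [map_add, hx, hy]
  | tmul x y => rfl

lemma commute_one_tmul_onTail₂ {α : A →ₐ[k] N} {β : B →ₐ[k] N} (h : ∀ a b, Commute (α a) (β b))
    (a : A) (w : C ⊗[k] B) : Commute ((1 : C) ⊗ₜ[k] α a) (onTail β w) := by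
  change _ * _ = _ * _
  induction w with
  | zero => rw [map_zero, zero_mul, mul_zero]
  | add x y hx hy => rw [map_add, add_mul, mul_add, hx, hy]
  | tmul x y =>
    simp only [Algebra.TensorProduct.map_tmul, Algebra.TensorProduct.tmul_mul_tmul, one_mul,
      mul_one, (h a y).eq]

variable [FiniteDimensional k G]
variable {ρ : RightCoaction k G A} {P : QuasiCommutingPair k G B} {l : LeftCoaction k G C}
  {ρt : RightCoaction k G (TwoSidedCrossedProduct ρ P.left)}
  {lt : LeftCoaction k G (TwoSidedCrossedProduct P.right l)}

/-- The embedding `B → B ⋊ Ĝ ⋉ C` is a morphism of left comodule algebras, by the prescribed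
restriction of the coaction and the prescribed reassociator. -/
lemma IsInducedLeft.intertwines (hl : IsInducedLeft P l lt) :
    Intertwines ρ P.left (inclLeft ρ lt) ((inclRight ρ lt).comp (inclLeft P.right l))
      (intertwiner ρ lt) :=
  (intertwines_intertwiner ρ lt).restrict (inclLeft P.right l) hl.coact_inclLeft hl.reassoc_eq

/-- The algebra map `A ⋊ Ĝ ⋉ B → A ⋊ Ĝ ⋉ (B ⋊ Ĝ ⋉ C)`. -/
noncomputable def IsInducedLeft.innerMap (hl : IsInducedLeft P l lt) :
    TwoSidedCrossedProduct ρ P.left →ₐ[k] TwoSidedCrossedProduct ρ lt :=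
  (hl.intertwines (ρ := ρ)).lift

lemma IsInducedLeft.innerMap_inclLeft (hl : IsInducedLeft P l lt) (a : A) :
    hl.innerMap (inclLeft ρ P.left a) = inclLeft ρ lt a :=
  (hl.intertwines (ρ := ρ)).lift_inclLeft a

lemma IsInducedLeft.innerMap_inclRight (hl : IsInducedLeft P l lt) (b : B) :
    hl.innerMap (inclRight ρ P.left b) = inclRight ρ lt (inclLeft P.right l b) :=
  (hl.intertwines (ρ := ρ)).lift_inclRight b

lemma IsInducedLeft.onTail_innerMap (hl : IsInducedLeft P l lt) :
    onTail hl.innerMap (intertwiner ρ P.left) = intertwiner ρ lt :=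
  (hl.intertwines (ρ := ρ)).onTail_lift

lemma IsInducedLeft.innerMap_comp_inclRight (hl : IsInducedLeft P l lt) :
    hl.innerMap.comp (inclRight ρ P.left) = (inclRight ρ lt).comp (inclLeft P.right l) :=
  AlgHom.ext hl.innerMap_inclRight

/-- The exchange of `Γ_BC` with `Γ_AB`: the slices of `Γ_BC` belong to the left comodule algebra `B
⋊ Ĝ ⋉ C`, so passing `Γ_AB` applies the left coaction to `Γ_BC`, and its formula introduces
`φ_λρ⁻¹`. -/
lemma IsInducedLeft.one_tmul_mul_skip_intertwiner (hl : IsInducedLeft P l lt) :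
    (1 : G) ⊗ₜ[k] onTail (inclRight ρ lt) (intertwiner P.right l) * skip (intertwiner ρ lt) =
      skip (intertwiner ρ lt) *
        (onTail flip (onTail (Algebra.TensorProduct.map
          ((inclRight ρ lt).comp (inclLeft P.right l)) (.id k G))
            (↑(P.mixed⁻¹) : G ⊗[k] (B ⊗[k] G))) *
          (1 : G) ⊗ₜ[k] onTail (inclRight ρ lt) (intertwiner P.right l)) := by
  rw [(intertwines_intertwiner ρ lt).one_tmul_mul_skip, hl.coact_intertwiner, map_mul, map_mul,
    ← onTail_onTail_comp, swap_cycle, ← skip_onTail, swap_skip]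

/-- The relation `right` for the outer crossed product. On `A` both factors commute, on `B` it is
the relation inside `B ⋊ Ĝ ⋉ C`, and on `Γ_AB` it compares the formulas for the two induced
coactions. -/
lemma IsInducedRight.intertwiner_mul_innerMap (hr : IsInducedRight ρ P ρt)
    (hl : IsInducedLeft P l lt) (m : TwoSidedCrossedProduct ρ P.left) :
    onTail (inclRight ρ lt) (intertwiner P.right l) * (1 : G) ⊗ₜ[k] hl.innerMap m =
      flip (Algebra.TensorProduct.map hl.innerMap (.id k G) (ρt.coact m)) *
        onTail (inclRight ρ lt) (intertwiner P.right l) := by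
  refine intertwining_of_generators
    ((Algebra.TensorProduct.includeRight : _ →ₐ[k] G ⊗[k] TwoSidedCrossedProduct ρ lt).comp
      hl.innerMap)
    ((flip.comp (Algebra.TensorProduct.map hl.innerMap (.id k G))).comp ρt.coact)
    (onTail (inclRight ρ lt) (intertwiner P.right l)) (fun a => ?_) (fun b => ?_) ?_ m
  · change _ * (1 : G) ⊗ₜ[k] hl.innerMap (inclLeft ρ P.left a) =
      flip (Algebra.TensorProduct.map hl.innerMap (.id k G) (ρt.coact (inclLeft ρ P.left a))) * _
    rw [hr.coact_inclLeft, Algebra.TensorProduct.map_tmul, map_one, hl.innerMap_inclLeft]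
    exact (commute_one_tmul_onTail₂ (commute_incl ρ lt) a _).eq.symm
  · change _ * (1 : G) ⊗ₜ[k] hl.innerMap (inclRight ρ P.left b) =
      flip (Algebra.TensorProduct.map hl.innerMap (.id k G) (ρt.coact (inclRight ρ P.left b))) * _
    rw [hr.coact_inclRight, map_map_id, hl.innerMap_comp_inclRight, hl.innerMap_inclRight]
    exact ((intertwines_intertwiner P.right l).map (inclRight ρ lt)).right b
  · have e : ∀ w : G ⊗[k] (B ⊗[k] G), onTail (Algebra.TensorProduct.map hl.innerMap (.id k G))
        (onTail (Algebra.TensorProduct.map (inclRight ρ P.left) (.id k G)) w) =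
        onTail (Algebra.TensorProduct.map
          ((inclRight ρ lt).comp (inclLeft P.right l)) (.id k G)) w := by
      intro w
      rw [← onTail_comp, ← hl.innerMap_comp_inclRight]
      exact congrArg (fun L => onTail (A := G) L w) (AlgHom.ext fun v => map_map_id _ _ v)
    have h1 : onTail ((Algebra.TensorProduct.includeRight :
        _ →ₐ[k] G ⊗[k] TwoSidedCrossedProduct ρ lt).comp hl.innerMap) (intertwiner ρ P.left) =
        skip (intertwiner ρ lt) := by
      rw [onTail_comp, hl.onTail_innerMap]
    -- The right coaction of `Γ_AB` contributes the same `φ_λρ⁻¹` as the left coaction of `Γ_BC`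
    -- does in the exchange relation.
    have h2 : onTail ((flip.comp (Algebra.TensorProduct.map hl.innerMap (.id k G))).comp ρt.coact)
        (intertwiner ρ P.left) = skip (intertwiner ρ lt) *
          onTail flip (onTail (Algebra.TensorProduct.map
            ((inclRight ρ lt).comp (inclLeft P.right l)) (.id k G))
              (↑(P.mixed⁻¹) : G ⊗[k] (B ⊗[k] G))) := by
      rw [onTail_comp _ ρt.coact, hr.coact_intertwiner, onTail_comp flip, map_mul, map_mul,
        onTail_flip_append₂, hl.onTail_innerMap, e]
    rw [h1, h2, mul_assoc]
    exact hl.one_tmul_mul_skip_intertwiner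

/-- The relations `left`, `counit_eq` and `fusion` are those of `B ⋊ Ĝ ⋉ C` transported along its
embedding; for fusion this uses that the reassociator of the right coaction comes from `B`. -/
lemma IsInducedRight.intertwines (hr : IsInducedRight ρ P ρt) (hl : IsInducedLeft P l lt) :
    Intertwines ρt l hl.innerMap ((inclRight ρ lt).comp (inclRight P.right l))
      (onTail (inclRight ρ lt) (intertwiner P.right l)) where
  commute m c := by
    refine Commute.symm (intertwining_of_generators hl.innerMap hl.innerMap
      (inclRight ρ lt (inclRight P.right l c)) (fun a => ?_) (fun b => ?_) ?_ m)
    · rw [hl.innerMap_inclLeft]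
      exact (commute_incl ρ lt a _).eq.symm
    · rw [hl.innerMap_inclRight]
      exact (((commute_incl P.right l b c).map (inclRight ρ lt))).eq.symm
    -- Elements of `C` commute with `Γ_AB` because the left coaction sends `c` to `1 ⊗ c`.
    · rw [hl.onTail_innerMap, (intertwines_intertwiner ρ lt).left, hl.coact_inclRight]
      rfl
  right := hr.intertwiner_mul_innerMap hl
  left := ((intertwines_intertwiner P.right l).map (inclRight ρ lt)).left
  counit_eq := ((intertwines_intertwiner P.right l).map (inclRight ρ lt)).counit_eq
  fusion := by
    rw [((intertwines_intertwiner P.right l).map (inclRight ρ lt)).fusion,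
      reassoc_inv_of_eq _ hr.reassoc_eq, map_map_id, hl.innerMap_comp_inclRight]

/-- The algebra map `(A ⋊ Ĝ ⋉ B) ⋊ Ĝ ⋉ C → A ⋊ Ĝ ⋉ (B ⋊ Ĝ ⋉ C)`. -/
noncomputable def assocHom (hr : IsInducedRight ρ P ρt) (hl : IsInducedLeft P l lt) :
    TwoSidedCrossedProduct ρt l →ₐ[k] TwoSidedCrossedProduct ρ lt :=
  (hr.intertwines hl).lift

/-- By `mk_eq_mul` both sides are the product of the images of `a`, `f`, `b`, `g`, `c` in this
order; only the bracketing differs. -/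
lemma assocHom_mk (hr : IsInducedRight ρ P ρt) (hl : IsInducedLeft P l lt) (a : A)
    (f : Module.Dual k G) (b : B) (g : Module.Dual k G) (c : C) :
    assocHom hr hl (mk ρt l (mk ρ P.left a f b) g c) = mk ρ lt a f (mk P.right l b g c) := by
  have h1 : assocHom hr hl (mk ρt l (mk ρ P.left a f b) g c) =
      hl.innerMap (mk ρ P.left a f b) *
        (slice g (onTail (inclRight ρ lt) (intertwiner P.right l)) *
          inclRight ρ lt (inclRight P.right l c)) :=
    (hr.intertwines hl).lift_mk (mk ρ P.left a f b) g c
  have h2 : hl.innerMap (mk ρ P.left a f b) = inclLeft ρ lt a *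
      (slice f (intertwiner ρ lt) * inclRight ρ lt (inclLeft P.right l b)) :=
    (hl.intertwines (ρ := ρ)).lift_mk a f b
  have h3 : slice g (onTail (inclRight ρ lt) (intertwiner P.right l)) =
      inclRight ρ lt (mk P.right l 1 g 1) := by
    rw [slice_onTail, slice_intertwiner]
  have h4 : inclRight ρ lt (mk P.right l b g c) = inclRight ρ lt (inclLeft P.right l b) *
      (inclRight ρ lt (mk P.right l 1 g 1) * inclRight ρ lt (inclRight P.right l c)) := by
    rw [mk_eq_mul P.right l b g c, map_mul, map_mul]
  have h5 := mk_eq_mul ρ lt a f (mk P.right l b g c)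
  rw [h4] at h5
  rw [h1, h2, h3, h5, slice_intertwiner ρ lt]
  simp only [mul_assoc]

variable (ρt lt) in
/-- The reassociation of `(A ⊗ Ĝ ⊗ B) ⊗ Ĝ ⊗ C`. -/
noncomputable def assocLinear :
    TwoSidedCrossedProduct ρt l ≃ₗ[k] TwoSidedCrossedProduct ρ lt :=
  (TensorProduct.assoc k A (Module.Dual k G ⊗[k] B) (Module.Dual k G ⊗[k] C)).trans
    (TensorProduct.congr (LinearEquiv.refl k A)
      (TensorProduct.assoc k (Module.Dual k G) B (Module.Dual k G ⊗[k] C)))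

/-- Bijectivity of the algebra map follows from this comparison, so no inverse algebra map has to be
constructed. -/
lemma assocHom_eq_assocLinear (hr : IsInducedRight ρ P ρt) (hl : IsInducedLeft P l lt)
    (x : TwoSidedCrossedProduct ρt l) : assocHom hr hl x = assocLinear ρt lt x := by
  induction x using crossedProduct_induction with
  | zero => rw [map_zero, map_zero]
  | add x y hx hy => rw [map_add, map_add, hx, hy]
  | mk m g c =>
    induction m using crossedProduct_induction with
    | zero =>
      rw [show mk ρt l 0 g c = 0 from TensorProduct.zero_tmul _ _, map_zero, map_zero]
    | add x y hx hy =>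
      rw [show mk ρt l (x + y) g c = mk ρt l x g c + mk ρt l y g c from
        TensorProduct.add_tmul _ _ _, map_add, map_add, hx, hy]
    | mk a f b => exact assocHom_mk hr hl a f b g c

/-- The isomorphism `(A ⋊ Ĝ ⋉ B) ⋊ Ĝ ⋉ C ≅ A ⋊ Ĝ ⋉ (B ⋊ Ĝ ⋉ C)`. -/
noncomputable def assocEquiv (hr : IsInducedRight ρ P ρt) (hl : IsInducedLeft P l lt) :
    TwoSidedCrossedProduct ρt l ≃ₐ[k] TwoSidedCrossedProduct ρ lt :=
  AlgEquiv.ofBijective (assocHom hr hl) (by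
    rw [show ⇑(assocHom hr hl) = assocLinear ρt lt from funext (assocHom_eq_assocLinear hr hl)]
    exact (assocLinear ρt lt).bijective)

end Associativity

end QuasiHopf

theorem proposition11p5 {G A B C : Type*} [Ring G] [Algebra ℂ G] [FiniteDimensional ℂ G]
    [QuasiHopf.QuasiHopfAlgebra ℂ G] [Ring A] [Algebra ℂ A] [Ring B] [Algebra ℂ B]
    [Ring C] [Algebra ℂ C] (ρA : QuasiHopf.RightCoaction ℂ G A)
    (PB : QuasiHopf.QuasiCommutingPair ℂ G B) (lC : QuasiHopf.LeftCoaction ℂ G C) :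
    (∃! ρt : QuasiHopf.RightCoaction ℂ G (QuasiHopf.TwoSidedCrossedProduct ρA PB.left),
      QuasiHopf.IsInducedRight ρA PB ρt) ∧
    (∃! lt : QuasiHopf.LeftCoaction ℂ G (QuasiHopf.TwoSidedCrossedProduct PB.right lC),
      QuasiHopf.IsInducedLeft PB lC lt) ∧
    ∀ (ρt : QuasiHopf.RightCoaction ℂ G (QuasiHopf.TwoSidedCrossedProduct ρA PB.left))
      (lt : QuasiHopf.LeftCoaction ℂ G (QuasiHopf.TwoSidedCrossedProduct PB.right lC)),
      QuasiHopf.IsInducedRight ρA PB ρt → QuasiHopf.IsInducedLeft PB lC lt →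
      ∃ e : QuasiHopf.TwoSidedCrossedProduct ρt lC ≃ₐ[ℂ] QuasiHopf.TwoSidedCrossedProduct ρA lt,
        ∀ (a : A) (f : Module.Dual ℂ G) (b : B) (g : Module.Dual ℂ G) (c : C),
          e (QuasiHopf.TwoSidedCrossedProduct.mk ρt lC
              (QuasiHopf.TwoSidedCrossedProduct.mk ρA PB.left a f b) g c) =
            QuasiHopf.TwoSidedCrossedProduct.mk ρA lt a f
              (QuasiHopf.TwoSidedCrossedProduct.mk PB.right lC b g c) := by
  -- The isomorphism is built from the characterising formulas alone, so it applies directly to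
  -- arbitrary coactions satisfying them.
  refine ⟨⟨QuasiHopf.inducedRight ρA PB, QuasiHopf.isInducedRight_inducedRight ρA PB,
    fun _ h => h.unique (QuasiHopf.isInducedRight_inducedRight ρA PB)⟩,
    ⟨QuasiHopf.inducedLeft PB lC, QuasiHopf.isInducedLeft_inducedLeft PB lC,
      fun _ h => h.unique (QuasiHopf.isInducedLeft_inducedLeft PB lC)⟩,
    fun ρt lt hr hl => ⟨QuasiHopf.assocEquiv hr hl, fun a f b g c =>
      QuasiHopf.assocHom_mk hr hl a f b g c⟩⟩
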